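/- Let $\Omega\subset\mathbb R^N$ be open, let $A:\Omega\to\mathbb R^{N\times N}$ be smooth, and let $\Phi:[0,1]\times\Omega\times\Omega\to\Omega$ be a family of paths: $\Phi$ is locally Lipschitz, $\Phi(0;a,b)=a$, $\Phi(1;a,b)=b$, $\Phi(s;a,a)=a$, and for every compact $K\subset\Omega$ there is $k$ with $|\partial_s\Phi(s;a,b)|\le k|b-a|$ for all $a,b\in K$ and a.e. $s$. Consider the system $u_t+A(u)u_x=0$ (hyperbolicity is not needed below). *Nonconservative product and graph completion.* For $w:\mathbb R\to\Omega$ of bounded variation with one-sided limits in $\Omega$, $[A(w)w_x]_\Phi$ is the bounded $\mathbb R^N$-valued measure that equals $A(w)\,\frac{dw}{dx}$ on the set of continuity points of $w$ and has mass $\int_0^1A(\Phi(s;w(x-),w(x+)))\,\partial_s\Phi(s;w(x-),w(x+))\,ds$ at each jump point $x$. The $\Phi$-completion $(X,W_\Phi):\mathbb R\to\mathbb R\times\Omega$ of the graph of $w$ is obtained by parametrizing this graph by $\sigma(x)=x+TV(w;(-\infty,x])$ (computed with the right-continuous representative of $w$) and inserting at each jump point $x$, over the interval $[\sigma(x-),\sigma(x)]$,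 the affinely reparametrized path $\Phi(\cdot\,;w(x-),w(x+))$. The uniform distance of two parametrized graphs $\gamma,\gamma'$ is $\inf_\alpha\sup_s|\gamma(\alpha(s))-\gamma'(s)|$ over increasing bijections $\alpha$ of $\mathbb R$. A function of $x$ that is a.e. equal to a function of bounded variation is identified with its right-continuous representative of bounded variation. *Scheme.* Let $\Delta x_k,\Delta t_k>0$ tend to $0$. Let $p\ge1$, $q\ge 0$, and let $M^{\pm}_k:\Omega^{p+q+1}\to\mathbb R^N$ be numerical functions that are Lipschitz continuous on bounded subsets of $\Omega^{p+q+1}$ uniformly in $k$ (they may depend on $k$, for instance through $\Delta t_k/\Delta x_k$; a fixed pair $M^\pm$ is a special case) and formally consistent with $\Phi$: $$M_k^\pm(a,\dots,a)=0,\qquad M_k^-(u_{-q},\dots,u_p)+M_k^+(u_{-q},\dots,u_p)=\int_0^1A(\Phi(s;u_0,u_1))\,\partial_s\Phi(s;u_0,u_1)\,ds .$$ This covers the schemes of Godunov, Roe and Lax–Friedrichs type that satisfy these conditions. For each $k$ let $u_i^n\in\Omega$ ($n\ge0$, $i\in\mathbb Z$; the index $k$ is omitted) satisfy $$u_i^{n+1}=u_i^n-\frac{\Delta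 t_k}{\Delta x_k}\Big(M_k^+(u^n_{i-1-q},\dots,u^n_{i-1+p})+M_k^-(u^n_{i-q},\dots,u^n_{i+p})\Big),$$ and let $u^{\Delta_k}(t,x)=u_i^n$ for $t\in[n\Delta t_k,(n+1)\Delta t_k)$, $x\in[(i-1)\Delta x_k,i\Delta x_k)$. Assume that $\sup_x|u^{\Delta_k}(t,x)|+TV(u^{\Delta_k}(t,\cdot))\le C$ with $C$ independent of $k$ and $t\ge0$. Let a subsequence of $u^{\Delta_k}$ converge almost everywhere on $(0,\infty)\times\mathbb R$ to a limit $v$ with values in $\Omega$, in the sense that for a.e. $t>0$ all the one-sided limits of (the representative of bounded variation of) $v(t,\cdot)$ lie in $\Omega$. Then: 1. For a.e. $t>0$, $v(t,\cdot)$ has bounded variation, uniformly in $t$, and there is an $\mathbb R^N$-valued measure $\mu_v=\int_0^\infty\mu_v(t)\,dt$ on $(0,\infty)\times\mathbb R$ (the convergence error measure), where $t\mapsto\mu_v(t)$ is a weakly measurable family of measures on $\mathbb R$ whose total variations are bounded uniformly in $t$ (so that $\mu_v$ is bounded on $(0,T)\times\mathbb R$ for every $T$), such that $$v_t+[A(v)v_x]_\Phi=\mu_v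 ,$$ that is, $t\mapsto[A(v(t,\cdot))v_x(t,\cdot)]_\Phi$ is a weakly measurable, uniformly bounded family of measures and for every $\varphi\in C_c^\infty((0,\infty)\times\mathbb R)$ $$-\int_0^\infty\!\!\int_{\mathbb R} v\,\varphi_t\,dx\,dt+\int_0^\infty\big\langle[A(v(t,\cdot))v_x(t,\cdot)]_\Phi,\varphi(t,\cdot)\big\rangle dt=\int_0^\infty\langle\mu_v(t),\varphi(t,\cdot)\rangle\,dt .$$ 2. If, moreover, for a.e. $t>0$ the $\Phi$-completions of the graphs of $u^{\Delta_k}(t,\cdot)$ (along the subsequence) converge, in the uniform distance of graphs, to the $\Phi$-completion of the graph of $v(t,\cdot)$, then any such measure $\mu_v$ vanishes ($\mu_v(t)=0$ for a.e. $t>0$), and $v$ is a weak solution of $v_t+[A(v)v_x]_\Phi=0$. -/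

import Mathlib

open MeasureTheory Filter Set Topology
open scoped ContDiff NNReal ENNReal

noncomputable section

namespace PathConsistent

/-- The phase space `ℝ^N`; `N × N` matrices are elements of `Phase N →L[ℝ] Phase N`. -/
abbrev Phase (N : ℕ) := EuclideanSpace ℝ (Fin N)

variable {N : ℕ}

/-! ### Families of paths -/

/-- A (Dal Maso–LeFloch–Murat) family of paths in the open set `Ω`. Only the values `Φ s a b` with
`s ∈ [0,1]` and `a, b ∈ Ω` matter. The last condition is the customary linear bound on the speed
of the paths, on compact subsets of `Ω`. -/
structure IsDLMFamily (Ω : Set (Phase N)) (Φ : ℝ → Phase N → Phase N → Phase N) : Prop where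
  mapsTo : ∀ s ∈ Icc (0 : ℝ) 1, ∀ a ∈ Ω, ∀ b ∈ Ω, Φ s a b ∈ Ω
  locallyLipschitz : LocallyLipschitzOn (Icc (0 : ℝ) 1 ×ˢ (Ω ×ˢ Ω))
    (fun z : ℝ × (Phase N × Phase N) ↦ Φ z.1 z.2.1 z.2.2)
  left : ∀ a ∈ Ω, ∀ b ∈ Ω, Φ 0 a b = a
  right : ∀ a ∈ Ω, ∀ b ∈ Ω, Φ 1 a b = b
  diag : ∀ s ∈ Icc (0 : ℝ) 1, ∀ a ∈ Ω, Φ s a a = a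
  speed : ∀ K ⊆ Ω, IsCompact K → ∃ k : ℝ, ∀ a ∈ K, ∀ b ∈ K,
    ∀ᵐ s ∂(volume.restrict (Icc (0 : ℝ) 1)), ‖deriv (fun r ↦ Φ r a b) s‖ ≤ k * ‖b - a‖

/-- The integral `∫₀¹ A(Φ(s;a,b)) ∂ₛΦ(s;a,b) ds` of `A` along the path from `a` to `b`. -/
def pathIntegral (A : Phase N → Phase N →L[ℝ] Phase N) (Φ : ℝ → Phase N → Phase N → Phase N)
    (a b : Phase N) : Phase N :=
  ∫ s in (0 : ℝ)..1, A (Φ s a b) (deriv (fun r ↦ Φ r a b) s)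

/-! ### Nonconservative products -/

/-- The set of jump points of a function of one real variable with one-sided limits. -/
def jumpSet (u : ℝ → Phase N) : Set ℝ := {x | u.leftLim x ≠ u.rightLim x}

open scoped Classical in
/-- The nonconservative product `[A(u) u_x]_Φ` of a function `u` of bounded variation on `ℝ`:
the vector measure that equals `A(u) du/dx` on the set of continuity points of `u`, and has at
each jump point `x` the mass `∫₀¹ A(Φ(s;u(x-),u(x+))) ∂ₛΦ(s;u(x-),u(x+)) ds`. Here
`hu.vectorMeasure` is the derivative `du/dx`, and the second summand is the sum of these
point masses, written as a density with respect to the counting measure of the jump set. -/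
def nonconsProduct (A : Phase N → Phase N →L[ℝ] Phase N) (Φ : ℝ → Phase N → Phase N → Phase N)
    (u : ℝ → Phase N) : VectorMeasure ℝ (Phase N) :=
  if hu : BoundedVariationOn u univ then
    (hu.vectorMeasure.restrict (jumpSet u)ᶜ).withDensity (fun x ↦ A (u.rightLim x))
        (ContinuousLinearMap.id ℝ (Phase N →L[ℝ] Phase N))
      + (Measure.count.restrict (jumpSet u)).withDensityᵥ
        (fun x ↦ pathIntegral A Φ (u.leftLim x) (u.rightLim x))
  else 0

/-- `u` coincides almost everywhere with a function of bounded variation on `ℝ`. -/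
def HasBVVersion (u : ℝ → Phase N) : Prop :=
  ∃ w : ℝ → Phase N, BoundedVariationOn w univ ∧ w =ᵐ[volume] u

open scoped Classical in
/-- The right-continuous representative, of bounded variation, of `u` (`0` if there is none).
It does not depend on the choice made in the definition. -/
def bvVersion (u : ℝ → Phase N) : ℝ → Phase N :=
  if h : HasBVVersion u then h.choose.rightLim else 0

/-! ### Graph completions -/

/-- The strictly increasing function `x ↦ x + TV(u; (-∞, x])`, computed with the right-continuous
representative of `u`. -/
def graphLength (u : ℝ → Phase N) (x : ℝ) : ℝ :=
  x + (eVariationOn u.rightLim (Iic x)).toReal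

/-- The abscissa `X` of the graph completion: the continuous nondecreasing inverse of
`graphLength u`, constant equal to `x` on `[graphLength u x-, graphLength u x]`. -/
def graphAbscissa (u : ℝ → Phase N) (s : ℝ) : ℝ := sInf {x | s ≤ graphLength u x}

/-- The `Φ`-completion `s ↦ (X(s), U(s))` of the graph of a function `u` of bounded variation:
at each jump point `x` the graph is completed with the path `Φ(·; u(x-), u(x+))`. At a
point of continuity the quotient is `0 / 0 = 0` and `U = Φ(0; u(x), u(x)) = u(x)`. -/
def graphCompletion (Φ : ℝ → Phase N → Phase N → Phase N) (u : ℝ → Phase N) (s : ℝ) :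
    ℝ × Phase N :=
  let x := graphAbscissa u s
  let l := (graphLength u).leftLim x
  (x, Φ ((s - l) / (graphLength u x - l)) (u.leftLim x) (u.rightLim x))

/-- The uniform distance of two parametrized graphs, up to increasing changes of parameter. -/
def graphDist (γ γ' : ℝ → ℝ × Phase N) : ℝ≥0∞ :=
  ⨅ α : ℝ ≃o ℝ, ⨆ s : ℝ, edist (γ (α s)) (γ' s)

/-! ### Finite difference schemes -/

/-- Formal path-consistency of a family, indexed by `k`, of pairs `M⁻ = Mm k`, `M⁺ = Mp k` of
numerical functions of `p + q + 1` arguments `u_{-q}, …, u_p` (the argument `w j` is `u_{j-q}`, so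
that `u₀` and `u₁` are `w q` and `w (q+1)`). Lipschitz continuity is required on bounded subsets
of the domain, uniformly in `k`. -/
structure IsPathConsistent (Ω : Set (Phase N)) (A : Phase N → Phase N →L[ℝ] Phase N)
    (Φ : ℝ → Phase N → Phase N → Phase N) (p q : ℕ) (hp : 1 ≤ p)
    (Mm Mp : ℕ → (Fin (p + q + 1) → Phase N) → Phase N) : Prop where
  lipschitz : ∀ R : ℝ, ∃ L : ℝ≥0, ∀ k,
    LipschitzOnWith L (Mm k) {w | ∀ j, w j ∈ Ω ∧ ‖w j‖ ≤ R} ∧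
    LipschitzOnWith L (Mp k) {w | ∀ j, w j ∈ Ω ∧ ‖w j‖ ≤ R}
  consistent : ∀ k, ∀ a ∈ Ω, Mm k (fun _ ↦ a) = 0 ∧ Mp k (fun _ ↦ a) = 0
  jump : ∀ k, ∀ w : Fin (p + q + 1) → Phase N, (∀ j, w j ∈ Ω) →
    Mm k w + Mp k w = pathIntegral A Φ (w ⟨q, by omega⟩) (w ⟨q + 1, by omega⟩)

/-- The arguments `(u_{i-q}, …, u_{i+p})` of the numerical functions at the interface `i + 1/2`. -/
def stencil (p q : ℕ) (u : ℤ → Phase N) (i : ℤ) : Fin (p + q + 1) → Phase N :=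
  fun j ↦ u (i - q + (j : ℕ))

/-- `u n i` is produced by the scheme
`u_i^{n+1} = u_i^n - (Δt/Δx) (M⁺_{i-1/2} + M⁻_{i+1/2})`. -/
def IsSchemeSolution (p q : ℕ) (Mm Mp : (Fin (p + q + 1) → Phase N) → Phase N) (dx dt : ℝ)
    (u : ℕ → ℤ → Phase N) : Prop :=
  ∀ n i, u (n + 1) i = u n i -
    (dt / dx) • (Mp (stencil p q (u n) (i - 1)) + Mm (stencil p q (u n) i))

/-- The piecewise constant approximate solution: it equals `u n i` for `t` in `[n dt, (n+1) dt)`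
and `x` in the cell `[(i-1) dx, i dx)`. -/
def approx (dx dt : ℝ) (u : ℕ → ℤ → Phase N) (t x : ℝ) : Phase N :=
  u ⌊t / dt⌋₊ (⌊x / dx⌋ + 1)

/-! ### Solutions with a measure source-term -/

/-- A time-dependent vector measure `t ↦ m t`, `t > 0`, on `ℝ` which is weakly measurable and
uniformly bounded in time. It is the disintegration in time of the measure
`∫ m t dt` on `(0,∞) × ℝ`, whose total variation on `(0,T) × ℝ` is at most `C T`. -/
structure IsBoundedMeasureFamily (m : ℝ → VectorMeasure ℝ (Phase N)) : Prop where
  measurable : ∀ B : Set ℝ, MeasurableSet B →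
    AEStronglyMeasurable (fun t ↦ m t B) (volume.restrict (Ioi (0 : ℝ)))
  bounded : ∃ C : ℝ≥0, ∀ᵐ t ∂(volume.restrict (Ioi (0 : ℝ))), (m t).variation univ ≤ C

/-- Smooth test functions `φ(t,x)` with compact support in `(0,∞) × ℝ`. -/
def IsTestFunction (φ : ℝ → ℝ → ℝ) : Prop :=
  ContDiff ℝ ∞ (fun z : ℝ × ℝ ↦ φ z.1 z.2) ∧ HasCompactSupport (fun z : ℝ × ℝ ↦ φ z.1 z.2) ∧
    tsupport (fun z : ℝ × ℝ ↦ φ z.1 z.2) ⊆ Ioi (0 : ℝ) ×ˢ univ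

/-- The product `[A(v(t,·)) v_x(t,·)]_Φ` at time `t`. -/
def slicedProduct (A : Phase N → Phase N →L[ℝ] Phase N) (Φ : ℝ → Phase N → Phase N → Phase N)
    (v : ℝ → ℝ → Phase N) (t : ℝ) : VectorMeasure ℝ (Phase N) :=
  nonconsProduct A Φ (bvVersion (v t))

/-- `v` is a bounded function on `(0,∞) × ℝ`, of bounded variation in `x` uniformly in time, that
satisfies `v_t + [A(v) v_x]_Φ = m` in the sense of distributions on `(0,∞) × ℝ`. -/
structure SolvesWithSource (A : Phase N → Phase N →L[ℝ] Phase N)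
    (Φ : ℝ → Phase N → Phase N → Phase N) (v : ℝ → ℝ → Phase N)
    (m : ℝ → VectorMeasure ℝ (Phase N)) : Prop where
  measurable : AEStronglyMeasurable (fun z : ℝ × ℝ ↦ v z.1 z.2)
    (volume.restrict (Ioi (0 : ℝ) ×ˢ (univ : Set ℝ)))
  bounded : ∃ C : ℝ, ∀ᵐ z : ℝ × ℝ ∂(volume.restrict (Ioi (0 : ℝ) ×ˢ (univ : Set ℝ))),
    ‖v z.1 z.2‖ ≤ C
  bv : ∃ C : ℝ≥0, ∀ᵐ t ∂(volume.restrict (Ioi (0 : ℝ))),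
    HasBVVersion (v t) ∧ eVariationOn (bvVersion (v t)) univ ≤ C
  product : IsBoundedMeasureFamily (slicedProduct A Φ v)
  equation : ∀ φ : ℝ → ℝ → ℝ, IsTestFunction φ →
    -(∫ t in Ioi (0 : ℝ), ∫ x, deriv (fun r ↦ φ r x) t • v t x)
      + ∫ t in Ioi (0 : ℝ), (slicedProduct A Φ v t).integral (φ t) (ContinuousLinearMap.lsmul ℝ ℝ)
      = ∫ t in Ioi (0 : ℝ), (m t).integral (φ t) (ContinuousLinearMap.lsmul ℝ ℝ)

/-- Weak solutions of `v_t + [A(v) v_x]_Φ = 0`. -/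
def IsWeakSolution (A : Phase N → Phase N →L[ℝ] Phase N)
    (Φ : ℝ → Phase N → Phase N → Phase N) (v : ℝ → ℝ → Phase N) : Prop :=
  SolvesWithSource A Φ v (fun _ ↦ 0)

end PathConsistent

end

/-! Why the theorem holds. The first assertion is soft. The numerical functions are Lipschitz and
vanish on constant stencils, so their sums over all interfaces are controlled by the total variation
(`IsPathConsistent.exists_tsum_le`). The approximate solutions are therefore Lipschitz in time with
values in L¹ up to an error of order Δt, and by Fatou the limit v is genuinely so on a set of times
of full measure (`IsConvergentScheme.isLipschitzFamily`). The primitives in x of v(t,·), taken at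
rational points, are Lipschitz in t and hence differentiable almost everywhere. As the difference
quotients in time are bounded in L¹, they converge weakly to a measure for a.e. t, and v_t is a
bounded family of measures (`IsLipschitzFamily.exists_timeDerivative`). The nonconservative product
of the slices is another such family, and μ_v is simply the sum of the two.

The second assertion combines consistency and stability. Consistency: the jump condition M⁻ + M⁺ =
path integral and one summation by parts show that the difference quotient in time of an approximate
solution is the opposite of its nonconservative product, up to O(Δx) when tested against a Lipschitz
function (`IsSchemeRun.norm_integral_add_pairing_le`). Stability: the nonconservative product passes
to the limit when the graph completions converge uniformly (`tendsto_pairing_nonconsProduct`).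
Dominated convergence in time then gives the equation without source, and a bounded family of
measures that vanishes against all test functions is zero.

Stability holds because the nonconservative product is the integral of A along the graph completion
(`nonconsProduct_Ioc_eq_curveIntegral`, `pairing_nonconsProduct_eq`), a curve that is Lipschitz in
its parameter. On one fixed subdivision the Riemann sums along the limit graph and along the
reparametrized nearby graphs have uniformly small error, although the reparametrizations have no
regularity beyond monotonicity; and for a fixed subdivision the sums converge since they involve
finitely many points of the graphs. The identification itself comes from the fact that both
quantities are additive functions of the interval with the same behaviour near each point, so both
are limits of the sums of path integrals over uniform grids (`tendsto_sum_pathIntegral`). These sums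
also give the measurability in t of the nonconservative product.

Bounded subsets of Ω need not be relatively compact in Ω, so continuity alone does not bound A along
the approximate solutions. The bound comes from the scheme: its Lipschitz constants control the path
integral, whose differential on the diagonal is A (`IsPathConsistent.exists_pathBound`). -/

noncomputable section

namespace PathConsistent

variable {N : ℕ}

/-! ### Integrals along Lipschitz curves -/

/-- The derivative of a Lipschitz curve is bounded by the Lipschitz constant, up to the endpoints. -/
lemma norm_deriv_le_of_lipschitzOn_Icc {f : ℝ → Phase N} {K : ℝ≥0} {a b : ℝ}
    (hf : LipschitzOnWith K f (Icc a b)) :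
    ∀ᵐ s ∂(volume.restrict (Ioc a b)), ‖deriv f s‖ ≤ K := by
  rw [ae_restrict_iff' measurableSet_Ioc]
  -- At the end point `b` the two-sided derivative depends on values of `f` outside the interval, so
  -- this one point is discarded.
  have h : ∀ᵐ s : ℝ, s ≠ b := by simp [ae_iff, measure_singleton]
  filter_upwards [h] with s hs hsab
  exact norm_deriv_le_of_lipschitzOn (Icc_mem_nhds hsab.1 (lt_of_le_of_ne hsab.2 hs)) hf

lemma intervalIntegrable_deriv_of_lipschitzOn {f : ℝ → Phase N} {K : ℝ≥0} {a b : ℝ} (hab : a ≤ b)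
    (hf : LipschitzOnWith K f (Icc a b)) : IntervalIntegrable (deriv f) volume a b := by
  rw [intervalIntegrable_iff_integrableOn_Ioc_of_le hab]
  exact Integrable.of_bound (aestronglyMeasurable_deriv f _) K (norm_deriv_le_of_lipschitzOn_Icc hf)

/-- Scalar Lipschitz functions are absolutely continuous and so are integrals of their derivatives;
the vector case follows by taking inner products with every `y`. -/
lemma integral_deriv_of_lipschitzOn {f : ℝ → Phase N} {K : ℝ≥0} {a b : ℝ} (hab : a ≤ b)
    (hf : LipschitzOnWith K f (Icc a b)) : ∫ s in a..b, deriv f s = f b - f a := by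
  have hint := intervalIntegrable_deriv_of_lipschitzOn hab hf
  refine ext_inner_left ℝ fun y ↦ ?_
  have h1 : inner ℝ y (∫ s in a..b, deriv f s) = ∫ s in a..b, inner ℝ y (deriv f s) :=
    ((innerSL ℝ y).intervalIntegral_comp_comm hint).symm
  have hg : LipschitzOnWith (‖innerSL ℝ y‖₊ * K) (fun s ↦ inner ℝ y (f s)) (Icc a b) :=
    ((innerSL ℝ y).lipschitz.lipschitzOnWith (s := univ)).comp hf (mapsTo_univ _ _)
  have hg' := hg
  rw [← uIcc_of_le hab] at hg'
  have h2 := hg'.absolutelyContinuousOnInterval.integral_deriv_eq_sub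
  rw [h1, inner_sub_right, ← h2]
  refine intervalIntegral.integral_congr_ae ?_
  have hd := hf.ae_differentiableWithinAt_of_mem_real
  have h : ∀ᵐ s : ℝ, s ≠ b := by simp [ae_iff, measure_singleton]
  filter_upwards [hd, h] with s hs hsb hsab
  rw [uIoc_of_le hab] at hsab
  have hd' : DifferentiableAt ℝ f s :=
    (hs ⟨hsab.1.le, hsab.2⟩).differentiableAt (Icc_mem_nhds hsab.1 (lt_of_le_of_ne hsab.2 hsb))
  exact (((innerSL ℝ y).hasFDerivAt.comp_hasDerivAt s hd'.hasDerivAt).deriv).symm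

lemma intervalIntegrable_clm_deriv {f : ℝ → Phase N} {g : ℝ → Phase N →L[ℝ] Phase N} {K : ℝ≥0}
    {a b : ℝ} (hab : a ≤ b) (hf : LipschitzOnWith K f (Icc a b)) (hg : ContinuousOn g (Icc a b)) :
    IntervalIntegrable (fun s ↦ g s (deriv f s)) volume a b := by
  rw [intervalIntegrable_iff_integrableOn_Ioc_of_le hab]
  obtain ⟨C, hC⟩ := isCompact_Icc.exists_bound_of_continuousOn hg
  have hm : AEStronglyMeasurable g (volume.restrict (Ioc a b)) :=
    (hg.mono Ioc_subset_Icc_self).aestronglyMeasurable measurableSet_Ioc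
  refine Integrable.of_bound (C := C * K)
    ((ContinuousLinearMap.id ℝ (Phase N →L[ℝ] Phase N)).aestronglyMeasurable_comp₂ hm
      (aestronglyMeasurable_deriv f _)) ?_
  filter_upwards [norm_deriv_le_of_lipschitzOn_Icc hf, ae_restrict_mem measurableSet_Ioc]
    with s hs hsab
  have hc := hC s (Ioc_subset_Icc_self hsab)
  calc ‖g s (deriv f s)‖ ≤ ‖g s‖ * ‖deriv f s‖ := (g s).le_opNorm _
    _ ≤ C * K := mul_le_mul hc hs (norm_nonneg _) ((norm_nonneg _).trans hc)

/-- The integral of `g f'` along a Lipschitz curve is close to `T (f b - f a)` if `g` is close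
to `T`. -/
lemma norm_integral_clm_deriv_sub_le {f : ℝ → Phase N} {g : ℝ → Phase N →L[ℝ] Phase N} {K : ℝ≥0}
    {a b ε : ℝ} (hab : a ≤ b) (hf : LipschitzOnWith K f (Icc a b)) (hg : ContinuousOn g (Icc a b))
    (T : Phase N →L[ℝ] Phase N) (hε : ∀ s ∈ Icc a b, ‖g s - T‖ ≤ ε) :
    ‖(∫ s in a..b, g s (deriv f s)) - T (f b - f a)‖ ≤ ε * K * (b - a) := by
  have hint := intervalIntegrable_deriv_of_lipschitzOn hab hf
  rw [← integral_deriv_of_lipschitzOn hab hf, ← T.intervalIntegral_comp_comm hint,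
    ← intervalIntegral.integral_sub (intervalIntegrable_clm_deriv hab hf hg)
      (intervalIntegrable_clm_deriv hab hf continuousOn_const)]
  have := intervalIntegral.norm_integral_le_of_norm_le_const_ae (a := a) (b := b) (C := ε * K)
    (f := fun s ↦ g s (deriv f s) - T (deriv f s)) ?_
  · rwa [abs_of_nonneg (sub_nonneg.2 hab)] at this
  have h1 := norm_deriv_le_of_lipschitzOn_Icc hf
  rw [ae_restrict_iff' measurableSet_Ioc] at h1
  filter_upwards [h1] with s hs hsab
  rw [uIoc_of_le hab] at hsab
  have he := hε s (Ioc_subset_Icc_self hsab)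
  calc ‖g s (deriv f s) - T (deriv f s)‖ = ‖(g s - T) (deriv f s)‖ := by simp
    _ ≤ ‖g s - T‖ * ‖deriv f s‖ := (g s - T).le_opNorm _
    _ ≤ ε * K := mul_le_mul he (hs hsab) (norm_nonneg _) ((norm_nonneg _).trans he)

/-! ### Paths -/

section Paths

variable {Ω : Set (Phase N)} {A : Phase N → Phase N →L[ℝ] Phase N}
  {Φ : ℝ → Phase N → Phase N → Phase N}

/-- A single path lives over a compact set of parameters, so the local Lipschitz condition becomes
global. The constant is not quantitative; it serves only to make the path the integral of its
derivative. -/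
lemma IsDLMFamily.lipschitzOn_path (hΦ : IsDLMFamily Ω Φ) {a b : Phase N} (ha : a ∈ Ω)
    (hb : b ∈ Ω) : ∃ K, LipschitzOnWith K (fun s ↦ Φ s a b) (Icc 0 1) := by
  obtain ⟨K, hK⟩ := (hΦ.locallyLipschitz.mono
    (show Icc (0 : ℝ) 1 ×ˢ {(a, b)} ⊆ Icc (0 : ℝ) 1 ×ˢ (Ω ×ˢ Ω) from
      Set.prod_mono le_rfl (singleton_subset_iff.2 (Set.mk_mem_prod ha hb)))).exists_lipschitzOnWith_of_compact
      (isCompact_Icc.prod isCompact_singleton)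
  refine ⟨K, fun s hs r hr ↦ ?_⟩
  have := hK (show (s, (a, b)) ∈ Icc (0 : ℝ) 1 ×ˢ {(a, b)} from ⟨hs, rfl⟩)
    (show (r, (a, b)) ∈ Icc (0 : ℝ) 1 ×ˢ {(a, b)} from ⟨hr, rfl⟩)
  simpa [Prod.edist_eq] using this

/-- On a compact subset of `Ω`, the path from `a` to `b` is Lipschitz with constant `k |b - a|`. -/
lemma IsDLMFamily.exists_speed (hΦ : IsDLMFamily Ω Φ) {K : Set (Phase N)} (hKΩ : K ⊆ Ω)
    (hK : IsCompact K) : ∃ k : ℝ≥0, ∀ a ∈ K, ∀ b ∈ K,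
      LipschitzOnWith (k * ‖b - a‖₊) (fun s ↦ Φ s a b) (Icc 0 1) := by
  obtain ⟨k, hk⟩ := hΦ.speed K hKΩ hK
  refine ⟨k.toNNReal, fun a ha b hb ↦ ?_⟩
  obtain ⟨L, hL⟩ := hΦ.lipschitzOn_path (hKΩ ha) (hKΩ hb)
  -- The qualitative constant `L` makes the path absolutely continuous, so that the a.e. bound on
  -- the speed can be integrated into a Lipschitz bound.
  have key : ∀ s ∈ Icc (0 : ℝ) 1, ∀ r ∈ Icc (0 : ℝ) 1, s ≤ r →
      ‖Φ r a b - Φ s a b‖ ≤ k.toNNReal * ‖b - a‖ * (r - s) := by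
    intro s hs r hr hsr
    have hsub : Icc s r ⊆ Icc 0 1 := Icc_subset_Icc hs.1 hr.2
    rw [← integral_deriv_of_lipschitzOn hsr (hL.mono hsub)]
    have := intervalIntegral.norm_integral_le_of_norm_le_const_ae (a := s) (b := r)
      (C := k.toNNReal * ‖b - a‖) (f := deriv fun s ↦ Φ s a b) ?_
    · rwa [abs_of_nonneg (sub_nonneg.2 hsr)] at this
    have h1 := hk a ha b hb
    rw [ae_restrict_iff' measurableSet_Icc] at h1
    filter_upwards [h1] with t ht htsr
    rw [uIoc_of_le hsr] at htsr
    refine (ht (hsub (Ioc_subset_Icc_self htsr))).trans ?_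
    gcongr
    exact Real.le_coe_toNNReal k
  refine LipschitzOnWith.of_dist_le_mul fun s hs r hr ↦ ?_
  rw [dist_eq_norm, Real.dist_eq, NNReal.coe_mul, coe_nnnorm]
  rcases le_total s r with h | h
  · rw [norm_sub_rev, abs_sub_comm, abs_of_nonneg (sub_nonneg.2 h)]
    exact key s hs r hr h
  · rw [abs_of_nonneg (sub_nonneg.2 h)]
    exact key r hr s hs h

/-- The speed bound for equal end points gives the Lipschitz constant `k * 0`, so the derivative
vanishes almost everywhere. -/
lemma pathIntegral_self (hΦ : IsDLMFamily Ω Φ) {a : Phase N} (ha : a ∈ Ω) :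
    pathIntegral A Φ a a = 0 := by
  have hΩ : ({a} : Set (Phase N)) ⊆ Ω := singleton_subset_iff.2 ha
  obtain ⟨k, hk⟩ := hΦ.exists_speed hΩ isCompact_singleton
  have h1 := norm_deriv_le_of_lipschitzOn_Icc (hk a rfl a rfl)
  rw [ae_restrict_iff' measurableSet_Ioc] at h1
  unfold pathIntegral
  refine intervalIntegral.integral_zero_ae ?_
  filter_upwards [h1] with s hs hs01
  rw [uIoc_of_le zero_le_one] at hs01
  have h0 : deriv (fun s ↦ Φ s a a) s = 0 := by simpa using hs hs01
  rw [h0, map_zero]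

/-- Near a point `e` of `Ω`, the integral of `A` along the path from `c` to `d` is
`A(e)(d - c) + o(|d - c|)`. -/
lemma exists_pathIntegral_sub_le (hΩ : IsOpen Ω) (hA : ContinuousOn A Ω) (hΦ : IsDLMFamily Ω Φ)
    {e : Phase N} (he : e ∈ Ω) {ε : ℝ} (hε : 0 < ε) :
    ∃ δ > 0, Metric.ball e δ ⊆ Ω ∧ ∀ c ∈ Metric.ball e δ, ∀ d ∈ Metric.ball e δ,
      ‖pathIntegral A Φ c d - A e (d - c)‖ ≤ ε * ‖d - c‖ := by
  obtain ⟨r, hr, hrΩ⟩ := Metric.nhds_basis_closedBall.mem_iff.1 (hΩ.mem_nhds he)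
  obtain ⟨k, hk⟩ := hΦ.exists_speed hrΩ (isCompact_closedBall e r)
  have hAe : ContinuousAt A e := hA.continuousAt (hΩ.mem_nhds he)
  -- The path has speed at most `k * ‖d - c‖`, so an oscillation `ε / (k + 1)` of `A` costs at most
  -- `ε * ‖d - c‖`. The radius `η / (1 + 2 * k)` below keeps the whole path within `η` of `e`, since
  -- the path strays from `c` by at most `k * ‖d - c‖`.
  obtain ⟨η, hη, hη'⟩ := Metric.continuousAt_iff.1 hAe (ε / (k + 1)) (by positivity)
  refine ⟨min r (η / (1 + 2 * k)), by positivity, fun x hx ↦ hrΩ ?_, fun c hc d hd ↦ ?_⟩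
  · exact Metric.ball_subset_closedBall (Metric.ball_subset_ball (min_le_left _ _) hx)
  have hcr : c ∈ Metric.closedBall e r :=
    Metric.ball_subset_closedBall (Metric.ball_subset_ball (min_le_left _ _) hc)
  have hdr : d ∈ Metric.closedBall e r :=
    Metric.ball_subset_closedBall (Metric.ball_subset_ball (min_le_left _ _) hd)
  have hc' : dist c e < η / (1 + 2 * k) := lt_of_lt_of_le hc (min_le_right _ _)
  have hd' : dist d e < η / (1 + 2 * k) := lt_of_lt_of_le hd (min_le_right _ _)
  have hL := hk c hcr d hdr
  have hcd : ‖d - c‖ < 2 * (η / (1 + 2 * k)) := by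
    rw [← dist_eq_norm]
    linarith [dist_triangle_right d c e]
  have hnear : ∀ s ∈ Icc (0 : ℝ) 1, dist (Φ s c d) e < η := by
    intro s hs
    have h1 := hL.dist_le_mul s hs 0 (by simp)
    rw [hΦ.left c (hrΩ hcr) d (hrΩ hdr), NNReal.coe_mul, coe_nnnorm, Real.dist_eq, sub_zero,
      abs_of_nonneg hs.1] at h1
    have h2 : (k : ℝ) * ‖d - c‖ * s ≤ k * (2 * (η / (1 + 2 * k))) := by
      calc (k : ℝ) * ‖d - c‖ * s ≤ k * ‖d - c‖ * 1 := by gcongr; exact hs.2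
        _ ≤ _ := by rw [mul_one]; gcongr
    calc dist (Φ s c d) e ≤ dist (Φ s c d) c + dist c e := dist_triangle _ _ _
      _ < k * (2 * (η / (1 + 2 * k))) + η / (1 + 2 * k) := by linarith
      _ = η := by field_simp; ring
  have hcont : ContinuousOn (fun s ↦ A (Φ s c d)) (Icc 0 1) :=
    hA.comp hL.continuousOn fun s hs ↦ hΦ.mapsTo s hs c (hrΩ hcr) d (hrΩ hdr)
  have := norm_integral_clm_deriv_sub_le zero_le_one hL hcont (A e) (ε := ε / (k + 1))
    fun s hs ↦ by rw [← dist_eq_norm]; exact (hη' (hnear s hs)).le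
  rw [hΦ.left c (hrΩ hcr) d (hrΩ hdr), hΦ.right c (hrΩ hcr) d (hrΩ hdr)] at this
  refine this.trans ?_
  rw [NNReal.coe_mul, coe_nnnorm, sub_zero, mul_one, ← mul_assoc]
  gcongr
  rw [div_mul_eq_mul_div, div_le_iff₀ (by positivity)]
  nlinarith [k.coe_nonneg]

end Paths

/-! ### Consequences of the consistency of the scheme -/

section Bounds

/-- The bounds on `A` and on the integrals along paths, on the part of norm at most `R` of `Ω`,
that a consistent scheme provides. -/
structure PathBound (Ω : Set (Phase N)) (A : Phase N → Phase N →L[ℝ] Phase N)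
    (Φ : ℝ → Phase N → Phase N → Phase N) (R : ℝ) (c : ℝ≥0) : Prop where
  norm_le : ∀ a ∈ Ω, ‖a‖ ≤ R → ‖A a‖ ≤ c
  norm_pathIntegral_le : ∀ a ∈ Ω, ‖a‖ ≤ R → ∀ b ∈ Ω, ‖b‖ ≤ R → ‖pathIntegral A Φ a b‖ ≤ c * ‖b - a‖

variable {Ω : Set (Phase N)} {A : Phase N → Phase N →L[ℝ] Phase N}
  {Φ : ℝ → Phase N → Phase N → Phase N} {p q : ℕ} {hp : 1 ≤ p}
  {Mm Mp : ℕ → (Fin (p + q + 1) → Phase N) → Phase N}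

/-- On the stencil whose entries are `a` up to the index `q` and `b` afterwards, the jump condition
expresses the path integral as M⁻ + M⁺, and the Lipschitz bound of the scheme is inherited. It holds
on all bounded parts of `Ω`, up to the boundary; any single index, here 0, suffices. -/
lemma IsPathConsistent.lipschitz_pathIntegral (hM : IsPathConsistent Ω A Φ p q hp Mm Mp) (R : ℝ) :
    ∃ c : ℝ≥0, LipschitzOnWith c (fun z : Phase N × Phase N ↦ pathIntegral A Φ z.1 z.2)
      ((Ω ∩ Metric.closedBall 0 R) ×ˢ (Ω ∩ Metric.closedBall 0 R)) := by
  obtain ⟨L, hL⟩ := hM.lipschitz R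
  let W : Phase N × Phase N → Fin (p + q + 1) → Phase N := fun z j ↦ if (j : ℕ) ≤ q then z.1 else z.2
  have hW : LipschitzWith 1 W := by
    refine LipschitzWith.of_edist_le fun z z' ↦ ?_
    refine edist_pi_le_iff.2 fun j ↦ ?_
    by_cases hj : (j : ℕ) ≤ q
    · simp [W, hj, Prod.edist_eq]
    · simp [W, hj, Prod.edist_eq]
  set S := (Ω ∩ Metric.closedBall (0 : Phase N) R) ×ˢ (Ω ∩ Metric.closedBall (0 : Phase N) R)
  have hmaps : MapsTo W S {w | ∀ j, w j ∈ Ω ∧ ‖w j‖ ≤ R} := by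
    rintro ⟨a, b⟩ ⟨⟨ha, ha'⟩, hb, hb'⟩ j
    rw [mem_closedBall_zero_iff] at ha' hb'
    by_cases hj : (j : ℕ) ≤ q
    · simp [W, hj, ha, ha']
    · simp [W, hj, hb, hb']
  have h := ((hL 0).1.comp hW.lipschitzOnWith hmaps).add ((hL 0).2.comp hW.lipschitzOnWith hmaps)
  refine ⟨L * 1 + L * 1, fun z hz z' hz' ↦ ?_⟩
  have key : ∀ z ∈ S, pathIntegral A Φ z.1 z.2 = Mm 0 (W z) + Mp 0 (W z) := by
    intro z hz
    rw [hM.jump 0 (W z) fun j ↦ (hmaps hz j).1]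
    simp [W]
  simp only [key z hz, key z' hz']
  exact h hz hz'

lemma IsPathConsistent.continuousOn_pathIntegral (hM : IsPathConsistent Ω A Φ p q hp Mm Mp) :
    ContinuousOn (fun z : Phase N × Phase N ↦ pathIntegral A Φ z.1 z.2) (Ω ×ˢ Ω) := by
  rintro ⟨a, b⟩ ⟨ha, hb⟩
  obtain ⟨c, hc⟩ := hM.lipschitz_pathIntegral (max ‖a‖ ‖b‖ + 1)
  have h1 := hc.continuousOn (a, b) ⟨⟨ha, ?_⟩, hb, ?_⟩
  · refine h1.mono_of_mem_nhdsWithin ?_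
    have hball : Metric.closedBall (0 : Phase N) (max ‖a‖ ‖b‖ + 1) ×ˢ
        Metric.closedBall (0 : Phase N) (max ‖a‖ ‖b‖ + 1) ∈ 𝓝 (a, b) := by
      refine prod_mem_nhds ?_ ?_
      · exact mem_of_superset (Metric.isOpen_ball.mem_nhds (by
          rw [mem_ball_zero_iff]; linarith [le_max_left ‖a‖ ‖b‖])) Metric.ball_subset_closedBall
      · exact mem_of_superset (Metric.isOpen_ball.mem_nhds (by
          rw [mem_ball_zero_iff]; linarith [le_max_right ‖a‖ ‖b‖])) Metric.ball_subset_closedBall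
    filter_upwards [self_mem_nhdsWithin, mem_nhdsWithin_of_mem_nhds hball] with z hz hz'
    exact ⟨⟨hz.1, hz'.1⟩, hz.2, hz'.2⟩
  · rw [mem_closedBall_zero_iff]; linarith [le_max_left ‖a‖ ‖b‖]
  · rw [mem_closedBall_zero_iff]; linarith [le_max_right ‖a‖ ‖b‖]

/-- The path integral vanishes on the diagonal, so its Lipschitz constant bounds it by a multiple of
`‖b - a‖`; the same constant then bounds `A a`, which is its differential in the second variable at
`(a, a)`. The radius `R + 1` leaves room for perturbing `a`. -/
lemma IsPathConsistent.exists_pathBound (hM : IsPathConsistent Ω A Φ p q hp Mm Mp)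
    (hΩ : IsOpen Ω) (hA : ContinuousOn A Ω) (hΦ : IsDLMFamily Ω Φ) (R : ℝ) :
    ∃ c : ℝ≥0, PathBound Ω A Φ R c := by
  obtain ⟨c, hc⟩ := hM.lipschitz_pathIntegral (R + 1)
  have hP : ∀ a ∈ Ω, ‖a‖ ≤ R + 1 → ∀ b ∈ Ω, ‖b‖ ≤ R + 1 →
      ‖pathIntegral A Φ a b‖ ≤ c * ‖b - a‖ := by
    intro a ha ha' b hb hb'
    have := hc.dist_le_mul (a, b) ⟨⟨ha, by simpa⟩, hb, by simpa⟩
      (a, a) ⟨⟨ha, by simpa⟩, ha, by simpa⟩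
    simpa [pathIntegral_self hΦ ha, Prod.dist_eq, dist_eq_norm] using this
  refine ⟨c + 1, fun a ha ha' ↦ ?_, fun a ha ha' b hb hb' ↦ ?_⟩
  -- The first order expansion is used with error `1 * ‖z‖`, which accounts for the constant `c +
  -- 1`.
  · obtain ⟨δ, hδ, hδΩ, hδP⟩ := exists_pathIntegral_sub_le hΩ hA hΦ ha one_pos
    refine ContinuousLinearMap.opNorm_le_of_ball (ε := min δ 1) (by positivity) (by positivity)
      fun z hz ↦ ?_
    rw [mem_ball_zero_iff, lt_min_iff] at hz
    have hmem : a + z ∈ Metric.ball a δ := by simpa using hz.1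
    have h1 := hδP a (Metric.mem_ball_self hδ) (a + z) hmem
    have h2 := hP a ha (by linarith) (a + z) (hδΩ hmem) (by linarith [norm_add_le a z])
    rw [add_sub_cancel_left] at h1 h2
    calc ‖A a z‖ = ‖pathIntegral A Φ a (a + z) - (pathIntegral A Φ a (a + z) - A a z)‖ := by
          rw [sub_sub_cancel]
      _ ≤ c * ‖z‖ + 1 * ‖z‖ := (norm_sub_le _ _).trans (add_le_add h2 h1)
      _ = _ := by push_cast; ring
  · refine (hP a ha (by linarith) b hb (by linarith)).trans ?_
    gcongr
    simp

end Bounds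

/-! ### Interval functions and uniform grids -/

/-- The uniform grid with `n + 1` cells on `[a, b]`. -/
def grid (a b : ℝ) (n j : ℕ) : ℝ := a + (b - a) * (j / (n + 1))

lemma grid_zero (a b : ℝ) (n : ℕ) : grid a b n 0 = a := by simp [grid]

lemma grid_last (a b : ℝ) (n : ℕ) : grid a b n (n + 1) = b := by
  have : ((n : ℝ) + 1) ≠ 0 := by positivity
  simp [grid, this]

lemma monotone_grid {a b : ℝ} (hab : a ≤ b) (n : ℕ) : Monotone (grid a b n) := by
  intro i j hij
  unfold grid
  have : (0 : ℝ) ≤ b - a := sub_nonneg.2 hab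
  gcongr

lemma grid_succ_sub (a b : ℝ) (n j : ℕ) : grid a b n (j + 1) - grid a b n j = (b - a) / (n + 1) := by
  unfold grid; push_cast; ring

lemma grid_mem_Icc {a b : ℝ} (hab : a ≤ b) {n j : ℕ} (hj : j ≤ n + 1) :
    grid a b n j ∈ Icc a b :=
  ⟨by simpa [grid_zero] using monotone_grid hab n (Nat.zero_le j),
    by simpa [grid_last] using monotone_grid hab n hj⟩

lemma exists_mem_Ioc_grid {a b : ℝ} (n : ℕ) {x : ℝ} (hx : x ∈ Ioc a b) :
    ∃ j < n + 1, x ∈ Ioc (grid a b n j) (grid a b n (j + 1)) := by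
  have hex : ∃ j, x ≤ grid a b n j := ⟨n + 1, by rw [grid_last]; exact hx.2⟩
  classical
  have h1 := Nat.find_spec hex
  have h0 : Nat.find hex ≠ 0 := fun h ↦ by
    rw [h, grid_zero] at h1
    exact absurd hx.1 (not_lt.2 h1)
  obtain ⟨j, hj⟩ := Nat.exists_eq_succ_of_ne_zero h0
  refine ⟨j, ?_, ?_, by rw [hj] at h1; exact h1⟩
  · have : Nat.find hex ≤ n + 1 := Nat.find_min' hex (by rw [grid_last]; exact hx.2)
    omega
  · exact not_le.1 (Nat.find_min hex (m := j) (by omega))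

/-- If an interval function is dominated by the increments of `σ`, and is small with respect to
these increments on all small intervals around each point, then its sums over uniform grids
tend to zero. -/
lemma tendsto_sum_grid {E : Type*} [NormedAddCommGroup E] (σ : StieltjesFunction ℝ) (G : ℝ → ℝ → E)
    {a b C : ℝ} (hab : a ≤ b)
    (hC : ∀ x ∈ Icc a b, ∀ y ∈ Icc a b, x ≤ y → ‖G x y‖ ≤ C * (σ y - σ x))
    (hL : ∀ x₀ ∈ Ioc a b, ∀ ε > 0, ∃ δ > 0, ∀ x ∈ Icc a b, ∀ y ∈ Icc a b, x₀ - δ < x → x < x₀ →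
      x₀ ≤ y → y < x₀ + δ → ‖G x y‖ ≤ ε * (σ y - σ x)) :
    Tendsto (fun n : ℕ ↦ ∑ j ∈ Finset.range (n + 1), G (grid a b n j) (grid a b n (j + 1)))
      atTop (𝓝 0) := by
  -- The sum of the norms is the integral, against the Stieltjes measure of `σ`, of the step
  -- function `F n` whose value on each cell is the ratio of `‖G‖` to the increment of `σ`. Local
  -- smallness makes `F n` tend to zero pointwise, and `|C|` dominates it.
  set Q : ℕ → ℕ → ℝ := fun n j ↦ ‖G (grid a b n j) (grid a b n (j + 1))‖ /
    (σ (grid a b n (j + 1)) - σ (grid a b n j)) with hQ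
  set F : ℕ → ℝ → ℝ := fun n x ↦ ∑ j ∈ Finset.range (n + 1),
    (Ioc (grid a b n j) (grid a b n (j + 1))).indicator (fun _ ↦ Q n j) x with hF
  have hσ : ∀ n j, 0 ≤ σ (grid a b n (j + 1)) - σ (grid a b n j) := fun n j ↦
    sub_nonneg.2 (σ.mono (monotone_grid hab n j.le_succ))
  have hFv : ∀ n, ∀ x ∈ Ioc a b, ∃ j < n + 1, x ∈ Ioc (grid a b n j) (grid a b n (j + 1)) ∧
      F n x = Q n j := by
    intro n x hx
    obtain ⟨j, hj, hxj⟩ := exists_mem_Ioc_grid n hx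
    refine ⟨j, hj, hxj, ?_⟩
    simp only [hF]
    rw [Finset.sum_eq_single_of_mem j (Finset.mem_range.2 hj), indicator_of_mem hxj]
    intro i _ hij
    refine indicator_of_notMem (fun hxi ↦ ?_) _
    exact (Set.disjoint_left.1 ((monotone_grid hab n).pairwise_disjoint_on_Ioc_succ hij) hxi) hxj
  have hFint : ∀ n, ∫ x in Ioc a b, F n x ∂σ.measure =
      ∑ j ∈ Finset.range (n + 1), ‖G (grid a b n j) (grid a b n (j + 1))‖ := by
    intro n
    have hfin : ∀ u v, σ.measure (Ioc u v) ≠ ⊤ := fun u v ↦ by simp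
    rw [integral_finsetSum]
    · refine Finset.sum_congr rfl fun j hj ↦ ?_
      have hj' : j < n + 1 := Finset.mem_range.1 hj
      have hsub : Ioc (grid a b n j) (grid a b n (j + 1)) ⊆ Ioc a b :=
        Ioc_subset_Ioc (grid_mem_Icc hab hj'.le).1 (grid_mem_Icc hab hj').2
      rw [setIntegral_indicator measurableSet_Ioc, inter_eq_right.2 hsub, setIntegral_const,
        measureReal_def, σ.measure_Ioc, ENNReal.toReal_ofReal (hσ n j), smul_eq_mul, hQ]
      -- On a cell where `σ` does not grow the ratio is 0 by convention, which is harmless because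
      -- `hC` forces `G` to vanish there.
      rcases (hσ n j).eq_or_lt with h0 | h0
      · have := hC _ (grid_mem_Icc hab hj'.le) _ (grid_mem_Icc hab hj') (monotone_grid hab n j.le_succ)
        rw [← h0, mul_zero] at this
        rw [← h0, zero_mul]
        exact (le_antisymm this (norm_nonneg _)).symm
      · field_simp
    · intro j _
      refine ((integrable_indicator_iff measurableSet_Ioc).2 ?_).restrict
      exact integrableOn_const (hfin _ _)
  have hQC : ∀ n j, j < n + 1 → Q n j ≤ |C| := by
    intro n j hj
    have := hC _ (grid_mem_Icc hab hj.le) _ (grid_mem_Icc hab hj) (monotone_grid hab n j.le_succ)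
    refine div_le_of_le_mul₀ (hσ n j) (abs_nonneg C) (this.trans ?_)
    exact mul_le_mul_of_nonneg_right (le_abs_self C) (hσ n j)
  have hQ0 : ∀ n j, 0 ≤ Q n j := fun n j ↦ div_nonneg (norm_nonneg _) (hσ n j)
  have hlim : Tendsto (fun n ↦ ∫ x in Ioc a b, F n x ∂σ.measure) atTop
      (𝓝 (∫ x in Ioc a b, (0 : ℝ) ∂σ.measure)) := by
    refine tendsto_integral_of_dominated_convergence (fun _ ↦ |C|) (fun n ↦ ?_) ?_ (fun n ↦ ?_) ?_
    · refine (Finset.measurable_sum _ fun j _ ↦ ?_).aestronglyMeasurable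
      exact measurable_const.indicator measurableSet_Ioc
    · exact integrableOn_const (by simp)
    · filter_upwards [ae_restrict_mem measurableSet_Ioc] with x hx
      obtain ⟨j, hj, -, hxj⟩ := hFv n x hx
      rw [hxj, Real.norm_of_nonneg (hQ0 n j)]
      exact hQC n j hj
    · filter_upwards [ae_restrict_mem measurableSet_Ioc] with x hx
      rw [Metric.tendsto_atTop]
      intro ε hε
      obtain ⟨δ, hδ, hδ'⟩ := hL x hx (ε / 2) (by positivity)
      have hmesh : Tendsto (fun n : ℕ ↦ (b - a) / ((n : ℝ) + 1)) atTop (𝓝 0) :=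
        tendsto_const_nhds.div_atTop (tendsto_atTop_add_const_right _ _ tendsto_natCast_atTop_atTop)
      obtain ⟨n₀, hn₀⟩ := eventually_atTop.1 (hmesh.eventually_lt_const hδ)
      refine ⟨n₀, fun n hn ↦ ?_⟩
      obtain ⟨j, hj, hxj, hFj⟩ := hFv n x hx
      have hm := hn₀ n hn
      rw [← grid_succ_sub a b n j] at hm
      rw [hFj, dist_zero_right, Real.norm_of_nonneg (hQ0 n j)]
      refine lt_of_le_of_lt ?_ (half_lt_self hε)
      refine div_le_of_le_mul₀ (hσ n j) (by positivity) ?_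
      exact hδ' _ (grid_mem_Icc hab hj.le) _ (grid_mem_Icc hab hj) (by linarith [hxj.2])
        hxj.1 hxj.2 (by linarith [hxj.1])
  simp only [hFint, integral_zero] at hlim
  exact squeeze_zero_norm (fun n ↦ norm_sum_le _ _) hlim

/-- Two additive interval functions that are both approximated by the same interval function `S`
agree, and are limits of the sums of `S`. -/
lemma tendsto_sum_grid_of_additive {E : Type*} [NormedAddCommGroup E] (F S : ℝ → ℝ → E) {a b : ℝ}
    (hab : a ≤ b)
    (hadd : ∀ x ∈ Icc a b, ∀ y ∈ Icc a b, ∀ z ∈ Icc a b, x ≤ y → y ≤ z → F x z = F x y + F y z)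
    (hlim : Tendsto (fun n : ℕ ↦ ∑ j ∈ Finset.range (n + 1), (F (grid a b n j) (grid a b n (j + 1)) -
      S (grid a b n j) (grid a b n (j + 1)))) atTop (𝓝 0)) :
    Tendsto (fun n : ℕ ↦ ∑ j ∈ Finset.range (n + 1), S (grid a b n j) (grid a b n (j + 1)))
      atTop (𝓝 (F a b)) := by
  have hsum : ∀ n m : ℕ, m ≤ n + 1 →
      ∑ j ∈ Finset.range m, F (grid a b n j) (grid a b n (j + 1)) = F a (grid a b n m) := by
    intro n m
    induction m with
    | zero =>
      intro _
      -- Additivity on the degenerate interval forces `F a a = 0`.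
      have haa := hadd a ⟨le_rfl, hab⟩ a ⟨le_rfl, hab⟩ a ⟨le_rfl, hab⟩ le_rfl le_rfl
      rw [Finset.sum_range_zero, grid_zero]
      exact (left_eq_add.1 haa).symm
    | succ m ih =>
      intro hm
      rw [Finset.sum_range_succ, ih (by omega)]
      exact (hadd _ ⟨le_rfl, hab⟩ _ (grid_mem_Icc hab (by omega)) _ (grid_mem_Icc hab hm)
        (grid_mem_Icc hab (by omega)).1 (monotone_grid hab n m.le_succ)).symm
  have h2 : Tendsto (fun n : ℕ ↦ F a b - ∑ j ∈ Finset.range (n + 1),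
      (F (grid a b n j) (grid a b n (j + 1)) - S (grid a b n j) (grid a b n (j + 1)))) atTop
      (𝓝 (F a b - 0)) := tendsto_const_nhds.sub hlim
  rw [sub_zero] at h2
  refine h2.congr fun n ↦ ?_
  rw [Finset.sum_sub_distrib, hsum n (n + 1) le_rfl, grid_last]
  abel

/-! ### Graphs of right-continuous functions of bounded variation -/

/-- Right-continuous functions of bounded variation on `ℝ`. -/
structure IsRCBV (w : ℝ → Phase N) : Prop where
  bv : BoundedVariationOn w univ
  rightLim_eq : w.rightLim = w

namespace IsRCBV

variable {w : ℝ → Phase N}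

lemma eVariationOn_ne_top (hw : IsRCBV w) (s : Set ℝ) : eVariationOn w s ≠ ⊤ :=
  hw.bv.mono (subset_univ s)

lemma tendsto_left (hw : IsRCBV w) (x : ℝ) : Tendsto w (𝓝[<] x) (𝓝 (w.leftLim x)) :=
  hw.bv.tendsto_leftLim x

lemma tendsto_right (hw : IsRCBV w) (x : ℝ) : Tendsto w (𝓝[>] x) (𝓝 (w x)) := by
  have := hw.bv.tendsto_rightLim x
  rwa [hw.rightLim_eq] at this

lemma continuousWithinAt_Ici (hw : IsRCBV w) (x : ℝ) : ContinuousWithinAt w (Ici x) x := by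
  rw [← continuousWithinAt_Ioi_iff_Ici]
  exact hw.tendsto_right x

lemma continuousAt_of_leftLim_eq (hw : IsRCBV w) {x : ℝ} (h : w.leftLim x = w x) :
    ContinuousAt w x := by
  rw [continuousAt_iff_continuous_left'_right']
  refine ⟨?_, hw.tendsto_right x⟩
  have := hw.tendsto_left x
  rwa [h] at this

/-- The total variation on `ℝ`, as a real number. -/
def totalVar (w : ℝ → Phase N) : ℝ := (eVariationOn w univ).toReal

lemma graphLength_sub (hw : IsRCBV w) {x y : ℝ} (hxy : x ≤ y) :
    graphLength w y - graphLength w x = (y - x) + (eVariationOn w (Icc x y)).toReal := by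
  have h := eVariationOn.union w (s := Iic x) (t := Icc x y) (x := x) isGreatest_Iic
    (isLeast_Icc hxy)
  rw [Iic_union_Icc_eq_Iic hxy] at h
  unfold graphLength
  rw [hw.rightLim_eq, h, ENNReal.toReal_add (hw.eVariationOn_ne_top _) (hw.eVariationOn_ne_top _)]
  ring

lemma sub_le_graphLength_sub (hw : IsRCBV w) {x y : ℝ} (hxy : x ≤ y) :
    y - x ≤ graphLength w y - graphLength w x := by
  rw [hw.graphLength_sub hxy]
  linarith [ENNReal.toReal_nonneg (a := eVariationOn w (Icc x y))]

lemma norm_sub_le (hw : IsRCBV w) {x y : ℝ} (hxy : x ≤ y) :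
    ‖w y - w x‖ ≤ graphLength w y - graphLength w x := by
  rw [hw.graphLength_sub hxy, ← dist_eq_norm]
  have h := eVariationOn.edist_le w (s := Icc x y) (x := y) (y := x) ⟨hxy, le_rfl⟩ ⟨le_rfl, hxy⟩
  have h2 := ENNReal.toReal_mono (hw.eVariationOn_ne_top _) h
  rw [← dist_edist] at h2
  linarith

lemma graphLength_sub_le (hw : IsRCBV w) {x y : ℝ} (hxy : x ≤ y) :
    graphLength w y - graphLength w x ≤ y - x + totalVar w := by
  rw [hw.graphLength_sub hxy]
  gcongr
  exact ENNReal.toReal_mono (hw.eVariationOn_ne_top _) (eVariationOn.mono _ (subset_univ _))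

lemma strictMono_graphLength (hw : IsRCBV w) : StrictMono (graphLength w) := fun x y hxy ↦ by
  linarith [hw.sub_le_graphLength_sub hxy.le]

lemma le_graphLength (x : ℝ) : x ≤ graphLength w x := by
  unfold graphLength
  linarith [ENNReal.toReal_nonneg (a := eVariationOn w.rightLim (Iic x))]

lemma graphLength_le (hw : IsRCBV w) (x : ℝ) : graphLength w x ≤ x + totalVar w := by
  unfold graphLength
  rw [hw.rightLim_eq]
  gcongr
  exact ENNReal.toReal_mono (hw.eVariationOn_ne_top _) (eVariationOn.mono _ (subset_univ _))

/-- `graphLength w` as a Stieltjes function. -/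
def stieltjes (hw : IsRCBV w) : StieltjesFunction ℝ where
  toFun := graphLength w
  mono' := hw.strictMono_graphLength.monotone
  right_continuous' x := by
    -- Right-continuity of `w` makes its variation on `[x, y]` vanish as `y` decreases to `x`.
    have h := hw.bv.tendsto_eVariationOn_Icc_zero_right (x := x)
      (by simpa using hw.continuousWithinAt_Ici x)
    simp only [univ_inter, nhdsWithin_univ] at h
    have h2 : Tendsto (fun y ↦ graphLength w x + ((y - x) + (eVariationOn w (Icc x y)).toReal))
        (𝓝[≥] x) (𝓝 (graphLength w x + ((x - x) + (0 : ℝ≥0∞).toReal))) := by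
      refine tendsto_const_nhds.add (Tendsto.add ?_ ?_)
      · exact (tendsto_nhdsWithin_of_tendsto_nhds tendsto_id).sub tendsto_const_nhds
      · exact (ENNReal.tendsto_toReal ENNReal.zero_ne_top).comp (h.mono_left nhdsWithin_le_nhds)
    simp only [sub_self, ENNReal.toReal_zero, add_zero] at h2
    refine h2.congr' ?_
    filter_upwards [self_mem_nhdsWithin] with y hy
    rw [← hw.graphLength_sub hy]
    ring

lemma stieltjes_apply (hw : IsRCBV w) (x : ℝ) : hw.stieltjes x = graphLength w x := rfl

lemma tendsto_graphLength_left (hw : IsRCBV w) (x : ℝ) :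
    Tendsto (graphLength w) (𝓝[<] x) (𝓝 ((graphLength w).leftLim x)) :=
  hw.strictMono_graphLength.monotone.tendsto_leftLim x

lemma tendsto_graphLength_right (hw : IsRCBV w) (x : ℝ) :
    Tendsto (graphLength w) (𝓝[≥] x) (𝓝 (graphLength w x)) :=
  hw.stieltjes.right_continuous x

lemma norm_leftLim_sub_le (hw : IsRCBV w) {x y : ℝ} (hxy : x < y) :
    ‖w.leftLim y - w x‖ ≤ (graphLength w).leftLim y - graphLength w x := by
  refine le_of_tendsto_of_tendsto ((hw.tendsto_left y).sub_const _).norm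
    ((hw.tendsto_graphLength_left y).sub_const _) ?_
  filter_upwards [Ioo_mem_nhdsLT hxy] with z hz
  exact hw.norm_sub_le hz.1.le

lemma norm_sub_leftLim_le (hw : IsRCBV w) (x : ℝ) :
    ‖w x - w.leftLim x‖ ≤ graphLength w x - (graphLength w).leftLim x := by
  refine le_of_tendsto_of_tendsto ((hw.tendsto_left x).const_sub _).norm
    ((hw.tendsto_graphLength_left x).const_sub _) ?_
  filter_upwards [self_mem_nhdsWithin] with z hz
  exact hw.norm_sub_le (le_of_lt hz)

lemma graphLength_le_leftLim (hw : IsRCBV w) {x y : ℝ} (hxy : x < y) :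
    graphLength w x ≤ (graphLength w).leftLim y :=
  hw.strictMono_graphLength.monotone.le_leftLim hxy

lemma leftLim_le_graphLength (hw : IsRCBV w) (x : ℝ) :
    (graphLength w).leftLim x ≤ graphLength w x :=
  hw.strictMono_graphLength.monotone.leftLim_le le_rfl

/-- The abscissa is a generalized inverse of `graphLength w`. Right-continuity of `graphLength w`
means that the infimum is attained, whence an exact equivalence with non-strict inequalities. -/
lemma graphAbscissa_le_iff (hw : IsRCBV w) {s x : ℝ} : graphAbscissa w s ≤ x ↔ s ≤ graphLength w x := by
  have hbdd : BddBelow {x | s ≤ graphLength w x} := by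
    refine ⟨s - totalVar w, fun x hx ↦ ?_⟩
    have := hw.graphLength_le x
    rw [mem_ofPred_eq] at hx
    linarith
  have hne : {x | s ≤ graphLength w x}.Nonempty := ⟨s, le_graphLength s⟩
  refine ⟨fun h ↦ ?_, fun h ↦ csInf_le hbdd h⟩
  have hlt : ∀ y, x < y → s ≤ graphLength w y := by
    intro y hy
    obtain ⟨z, hz, hzy⟩ := exists_lt_of_csInf_lt hne (lt_of_le_of_lt h hy)
    exact hz.trans (hw.strictMono_graphLength.monotone hzy.le)
  have hr := (hw.tendsto_graphLength_right x).mono_left (nhdsWithin_mono x Ioi_subset_Ici_self)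
  refine ge_of_tendsto hr ?_
  filter_upwards [self_mem_nhdsWithin] with y hy using hlt y hy

lemma le_graphLength_abscissa (hw : IsRCBV w) (s : ℝ) : s ≤ graphLength w (graphAbscissa w s) :=
  hw.graphAbscissa_le_iff.1 le_rfl

lemma lt_graphAbscissa_iff (hw : IsRCBV w) {s x : ℝ} : x < graphAbscissa w s ↔ graphLength w x < s := by
  rw [← not_le, hw.graphAbscissa_le_iff, not_le]

lemma leftLim_abscissa_le (hw : IsRCBV w) (s : ℝ) :
    (graphLength w).leftLim (graphAbscissa w s) ≤ s := by
  refine le_of_tendsto (hw.tendsto_graphLength_left _) ?_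
  filter_upwards [self_mem_nhdsWithin] with x hx
  exact (hw.lt_graphAbscissa_iff.1 hx).le

lemma graphAbscissa_graphLength (hw : IsRCBV w) (x : ℝ) : graphAbscissa w (graphLength w x) = x := by
  refine le_antisymm (hw.graphAbscissa_le_iff.2 le_rfl) ?_
  exact hw.strictMono_graphLength.le_iff_le.1 (hw.le_graphLength_abscissa _)

lemma monotone_graphAbscissa (hw : IsRCBV w) : Monotone (graphAbscissa w) := fun _ s' h ↦
  hw.graphAbscissa_le_iff.2 (h.trans (hw.le_graphLength_abscissa s'))

lemma graphAbscissa_mem_Icc (hw : IsRCBV w) {a b s : ℝ}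
    (hs : s ∈ Icc (graphLength w a) (graphLength w b)) : graphAbscissa w s ∈ Icc a b := by
  refine ⟨?_, hw.graphAbscissa_le_iff.2 hs.2⟩
  rw [← hw.graphAbscissa_graphLength a]
  exact hw.monotone_graphAbscissa hs.1

/-- The graph length grows at least as fast as `x`, so its inverse is 1-Lipschitz. -/
lemma graphAbscissa_sub_le (hw : IsRCBV w) {s s' : ℝ} (h : s ≤ s') :
    graphAbscissa w s' - graphAbscissa w s ≤ s' - s := by
  rw [sub_le_iff_le_add', hw.graphAbscissa_le_iff]
  have h1 := hw.sub_le_graphLength_sub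
    (show graphAbscissa w s ≤ graphAbscissa w s + (s' - s) by linarith)
  linarith [hw.le_graphLength_abscissa s]

/-- The converse estimate: a parameter interval is longer than its projection on the x-axis by at
most the total variation. It bounds parameter lengths uniformly along a sequence of graphs, whatever
the reparametrizations. -/
lemma sub_le_graphAbscissa_sub (hw : IsRCBV w) {s s' : ℝ} (h : s ≤ s') :
    s' - s ≤ graphAbscissa w s' - graphAbscissa w s + totalVar w := by
  -- The graph length at the abscissa of `s` may exceed `s` because of a jump, so the estimate is
  -- made at points strictly to the left and then passed to the limit.
  have h1 : ∀ y < graphAbscissa w s, s' - s ≤ graphAbscissa w s' - y + totalVar w := by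
    intro y hy
    have h2 := hw.lt_graphAbscissa_iff.1 hy
    have h3 := hw.graphLength_sub_le (hy.le.trans (hw.monotone_graphAbscissa h))
    linarith [hw.le_graphLength_abscissa s']
  have h4 : Tendsto (fun y ↦ graphAbscissa w s' - y + totalVar w) (𝓝[<] (graphAbscissa w s))
      (𝓝 (graphAbscissa w s' - graphAbscissa w s + totalVar w)) :=
    tendsto_nhdsWithin_of_tendsto_nhds (by fun_prop : Continuous _).continuousAt
  refine ge_of_tendsto h4 ?_
  filter_upwards [self_mem_nhdsWithin] with y hy using h1 y hy

lemma continuous_graphAbscissa (hw : IsRCBV w) : Continuous (graphAbscissa w) := by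
  refine (LipschitzWith.of_dist_le_mul (K := 1) fun s s' ↦ ?_).continuous
  rw [NNReal.coe_one, one_mul, Real.dist_eq, Real.dist_eq]
  rcases le_total s s' with h | h
  · rw [abs_sub_comm, abs_sub_comm s, abs_of_nonneg (sub_nonneg.2 (hw.monotone_graphAbscissa h)),
      abs_of_nonneg (sub_nonneg.2 h)]
    exact hw.graphAbscissa_sub_le h
  · rw [abs_of_nonneg (sub_nonneg.2 (hw.monotone_graphAbscissa h)),
      abs_of_nonneg (sub_nonneg.2 h)]
    exact hw.graphAbscissa_sub_le h

/-- On a bounded interval, the values of a function of bounded variation whose one-sided limits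
lie in an open set stay in a compact subset of this set. -/
lemma exists_isCompact (hw : IsRCBV w) {Ω : Set (Phase N)} (hΩ : IsOpen Ω)
    (hl : ∀ x, w.leftLim x ∈ Ω) (hr : ∀ x, w x ∈ Ω) (a b : ℝ) :
    ∃ K ⊆ Ω, IsCompact K ∧ ∀ x ∈ Icc a b, w.leftLim x ∈ K ∧ w x ∈ K := by
  refine (isCompact_Icc (a := a) (b := b)).induction_on
    (p := fun S ↦ ∃ K ⊆ Ω, IsCompact K ∧ ∀ x ∈ S, w.leftLim x ∈ K ∧ w x ∈ K)
    ⟨∅, empty_subset _, isCompact_empty, by simp⟩ ?_ ?_ ?_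
  · rintro S T hST ⟨K, h1, h2, h3⟩
    exact ⟨K, h1, h2, fun x hx ↦ h3 x (hST hx)⟩
  · rintro S T ⟨K, h1, h2, h3⟩ ⟨K', h1', h2', h3'⟩
    refine ⟨K ∪ K', union_subset h1 h1', h2.union h2', ?_⟩
    rintro x (hx | hx)
    · exact ⟨Or.inl (h3 x hx).1, Or.inl (h3 x hx).2⟩
    · exact ⟨Or.inr (h3' x hx).1, Or.inr (h3' x hx).2⟩
  · intro x _
    obtain ⟨r₁, hr₁, hr₁Ω⟩ := Metric.nhds_basis_closedBall.mem_iff.1 (hΩ.mem_nhds (hl x))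
    obtain ⟨r₂, hr₂, hr₂Ω⟩ := Metric.nhds_basis_closedBall.mem_iff.1 (hΩ.mem_nhds (hr x))
    have e1 := hw.tendsto_left x (Metric.closedBall_mem_nhds _ hr₁)
    have e2 := hw.tendsto_right x (Metric.closedBall_mem_nhds _ hr₂)
    obtain ⟨u, hu, hu'⟩ := (mem_nhdsLT_iff_exists_Ioo_subset' (sub_one_lt x)).1 e1
    obtain ⟨v, hv, hv'⟩ := (mem_nhdsGT_iff_exists_Ioo_subset' (lt_add_one x)).1 e2
    set K := Metric.closedBall (w.leftLim x) r₁ ∪ Metric.closedBall (w x) r₂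
    have hKc : IsClosed K := Metric.isClosed_closedBall.union Metric.isClosed_closedBall
    have hwK : ∀ y ∈ Ioo u v, w y ∈ K := by
      intro y hy
      rcases lt_trichotomy y x with h | rfl | h
      · exact Or.inl (hu' ⟨hy.1, h⟩)
      · exact Or.inr (Metric.mem_closedBall_self hr₂.le)
      · exact Or.inr (hv' ⟨h, hy.2⟩)
    refine ⟨Ioo u v, mem_nhdsWithin_of_mem_nhds (Ioo_mem_nhds hu hv), K, union_subset hr₁Ω hr₂Ω,
      (isCompact_closedBall _ _).union (isCompact_closedBall _ _), fun y hy ↦ ⟨?_, hwK y hy⟩⟩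
    refine hKc.mem_of_tendsto (hw.tendsto_left y) ?_
    filter_upwards [Ioo_mem_nhdsLT hy.1] with z hz
    exact hwK z ⟨hz.1, hz.2.trans hy.2⟩

end IsRCBV

/-! ### Graph completions as Lipschitz curves -/

/-- The second component of the graph completion of `w`. -/
def graphValue (Φ : ℝ → Phase N → Phase N → Phase N) (w : ℝ → Phase N) (s : ℝ) : Phase N :=
  (graphCompletion Φ w s).2

/-- Standing properties of the coefficients: those needed to handle nonconservative products. -/
structure IsRegularData (Ω : Set (Phase N)) (A : Phase N → Phase N →L[ℝ] Phase N)
    (Φ : ℝ → Phase N → Phase N → Phase N) : Prop where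
  isOpen : IsOpen Ω
  continuousOn : ContinuousOn A Ω
  path : IsDLMFamily Ω Φ
  bound : ∀ R, ∃ c, PathBound Ω A Φ R c
  continuousOn_pathIntegral :
    ContinuousOn (fun z : Phase N × Phase N ↦ pathIntegral A Φ z.1 z.2) (Ω ×ˢ Ω)

/-- On `[a, b]`, the one-sided limits of `w` belong to the subset `K` of `Ω`, and the paths that
join points of `K` have speed at most `k`. -/
structure HasSpeedOn (Ω : Set (Phase N)) (Φ : ℝ → Phase N → Phase N → Phase N) (w : ℝ → Phase N)
    (K : Set (Phase N)) (k : ℝ≥0) (a b : ℝ) : Prop where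
  subset : K ⊆ Ω
  mem : ∀ x ∈ Icc a b, w.leftLim x ∈ K ∧ w x ∈ K
  lipschitz : ∀ c ∈ K, ∀ d ∈ K, LipschitzOnWith (k * ‖d - c‖₊) (fun s ↦ Φ s c d) (Icc 0 1)

section Curve

variable {Ω : Set (Phase N)} {A : Phase N → Phase N →L[ℝ] Phase N}
  {Φ : ℝ → Phase N → Phase N → Phase N} {w : ℝ → Phase N} {K : Set (Phase N)} {k : ℝ≥0} {a b : ℝ}

lemma HasSpeedOn.mono (h : HasSpeedOn Ω Φ w K k a b) {x y : ℝ} (hx : a ≤ x) (hy : y ≤ b) :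
    HasSpeedOn Ω Φ w K k x y :=
  ⟨h.subset, fun z hz ↦ h.mem z ⟨hx.trans hz.1, hz.2.trans hy⟩, h.lipschitz⟩

/-- The parameter of the path that is traversed by the graph completion. -/
def graphParam (w : ℝ → Phase N) (s : ℝ) : ℝ :=
  (s - (graphLength w).leftLim (graphAbscissa w s)) /
    (graphLength w (graphAbscissa w s) - (graphLength w).leftLim (graphAbscissa w s))

lemma graphValue_eq (hw : IsRCBV w) (s : ℝ) : graphValue Φ w s =
    Φ (graphParam w s) (w.leftLim (graphAbscissa w s)) (w (graphAbscissa w s)) := by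
  simp only [graphValue, graphCompletion, graphParam, hw.rightLim_eq]

lemma graphParam_mem (hw : IsRCBV w) (s : ℝ) : graphParam w s ∈ Icc (0 : ℝ) 1 := by
  have h1 := hw.leftLim_abscissa_le s
  have h2 := hw.le_graphLength_abscissa s
  exact ⟨div_nonneg (by linarith) (by linarith), div_le_one_of_le₀ (by linarith) (by linarith)⟩

lemma graphValue_mem (hΦ : IsDLMFamily Ω Φ) (hw : IsRCBV w) (h : HasSpeedOn Ω Φ w K k a b) {s : ℝ}
    (hs : graphAbscissa w s ∈ Icc a b) : graphValue Φ w s ∈ Ω := by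
  rw [graphValue_eq hw]
  exact hΦ.mapsTo _ (graphParam_mem hw s) _ (h.subset (h.mem _ hs).1) _ (h.subset (h.mem _ hs).2)

lemma norm_path_sub_le (h : HasSpeedOn Ω Φ w K k a b) {x θ θ' : ℝ} (hx : x ∈ Icc a b)
    (hθ : θ ∈ Icc (0 : ℝ) 1) (hθ' : θ' ∈ Icc (0 : ℝ) 1) :
    ‖Φ θ (w.leftLim x) (w x) - Φ θ' (w.leftLim x) (w x)‖ ≤ k * ‖w x - w.leftLim x‖ * |θ - θ'| := by
  have := (h.lipschitz _ (h.mem x hx).1 _ (h.mem x hx).2).dist_le_mul θ hθ θ' hθ'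
  rwa [dist_eq_norm, Real.dist_eq, NNReal.coe_mul, coe_nnnorm] at this

/-- A jump is no larger than the parameter interval inserted for it, so a path of speed `k` times
the jump, rescaled to that interval, has speed at most `k`. Without a jump, division by zero gives
0. -/
lemma norm_jump_mul_le (hw : IsRCBV w) {x d : ℝ} (hd : 0 ≤ d) :
    ‖w x - w.leftLim x‖ * (d / (graphLength w x - (graphLength w).leftLim x)) ≤ d := by
  have h1 := hw.norm_sub_leftLim_le x
  rcases (sub_nonneg.2 (hw.leftLim_le_graphLength x)).eq_or_lt with h0 | h0
  · rw [← h0, div_zero, mul_zero]; exact hd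
  · rw [← mul_div_assoc, div_le_iff₀ h0]
    nlinarith

lemma norm_graphValue_sub_leftLim_le (hΦ : IsDLMFamily Ω Φ) (hw : IsRCBV w)
    (h : HasSpeedOn Ω Φ w K k a b) {s : ℝ} (hs : graphAbscissa w s ∈ Icc a b) :
    ‖graphValue Φ w s - w.leftLim (graphAbscissa w s)‖ ≤
      k * (s - (graphLength w).leftLim (graphAbscissa w s)) := by
  have h0 := hΦ.left _ (h.subset (h.mem _ hs).1) _ (h.subset (h.mem _ hs).2)
  have hθ := graphParam_mem hw s
  have := norm_path_sub_le h hs hθ (show (0 : ℝ) ∈ Icc (0 : ℝ) 1 by simp)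
  rw [h0, ← graphValue_eq (Φ := Φ) hw, sub_zero, abs_of_nonneg hθ.1, mul_assoc] at this
  refine this.trans ?_
  gcongr
  exact norm_jump_mul_le hw (sub_nonneg.2 (hw.leftLim_abscissa_le s))

/-- This form keeps the size of the jump instead of the parameter length; it is what shows that the
completed graph remains near `w x₀` around a point of continuity. -/
lemma norm_sub_graphValue_le' (hΦ : IsDLMFamily Ω Φ) (hw : IsRCBV w)
    (h : HasSpeedOn Ω Φ w K k a b) {s : ℝ} (hs : graphAbscissa w s ∈ Icc a b) :
    ‖w (graphAbscissa w s) - graphValue Φ w s‖ ≤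
      k * ‖w (graphAbscissa w s) - w.leftLim (graphAbscissa w s)‖ * (1 - graphParam w s) := by
  have h0 := hΦ.right _ (h.subset (h.mem _ hs).1) _ (h.subset (h.mem _ hs).2)
  have hθ := graphParam_mem hw s
  have := norm_path_sub_le h hs (show (1 : ℝ) ∈ Icc (0 : ℝ) 1 by simp) hθ
  rwa [h0, ← graphValue_eq (Φ := Φ) hw, abs_of_nonneg (sub_nonneg.2 hθ.2)] at this

lemma norm_sub_graphValue_le (hΦ : IsDLMFamily Ω Φ) (hw : IsRCBV w)
    (h : HasSpeedOn Ω Φ w K k a b) {s : ℝ} (hs : graphAbscissa w s ∈ Icc a b) :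
    ‖w (graphAbscissa w s) - graphValue Φ w s‖ ≤ k * (graphLength w (graphAbscissa w s) - s) := by
  refine (norm_sub_graphValue_le' hΦ hw h hs).trans ?_
  rw [mul_assoc]
  gcongr
  set x := graphAbscissa w s
  have h1 := hw.norm_sub_leftLim_le x
  rcases (sub_nonneg.2 (hw.leftLim_le_graphLength x)).eq_or_lt with h0 | h0
  · rw [← h0] at h1
    rw [le_antisymm h1 (norm_nonneg _), zero_mul]
    exact sub_nonneg.2 (hw.le_graphLength_abscissa s)
  · have h2 : 1 - graphParam w s = (graphLength w x - s) /
        (graphLength w x - (graphLength w).leftLim x) := by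
      change 1 - (s - (graphLength w).leftLim x) /
        (graphLength w x - (graphLength w).leftLim x) = _
      field_simp
      ring
    rw [h2]
    exact norm_jump_mul_le hw (sub_nonneg.2 (hw.le_graphLength_abscissa s))

/-- Two parameters over the same abscissa lie on one path, of rescaled speed at most `k`. Otherwise
the increment passes through the value of `w` at the first abscissa and its left limit at the
second: the two path portions cost `k` and the increment of `w` costs 1 per unit of parameter. -/
lemma norm_graphValue_sub_le (hΦ : IsDLMFamily Ω Φ) (hw : IsRCBV w) (h : HasSpeedOn Ω Φ w K k a b)
    {s s' : ℝ} (hss' : s ≤ s') (hs : graphAbscissa w s ∈ Icc a b)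
    (hs' : graphAbscissa w s' ∈ Icc a b) :
    ‖graphValue Φ w s' - graphValue Φ w s‖ ≤ (k + 1) * (s' - s) := by
  rcases (hw.monotone_graphAbscissa hss').eq_or_lt with heq | hlt
  · have h1 := norm_path_sub_le h hs' (graphParam_mem hw s') (graphParam_mem hw s)
    have h2 : graphValue Φ w s = Φ (graphParam w s) (w.leftLim (graphAbscissa w s'))
      (w (graphAbscissa w s')) := by rw [graphValue_eq hw, heq]
    rw [← graphValue_eq (Φ := Φ) hw, ← h2] at h1
    refine h1.trans ?_
    have h3 : graphParam w s' - graphParam w s = (s' - s) / (graphLength w (graphAbscissa w s') -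
        (graphLength w).leftLim (graphAbscissa w s')) := by
      unfold graphParam
      rw [heq, ← sub_div]
      ring
    have h4 : 0 ≤ s' - s := sub_nonneg.2 hss'
    rw [h3, abs_of_nonneg (div_nonneg h4 (sub_nonneg.2 (hw.leftLim_le_graphLength _))), mul_assoc]
    have h5 := norm_jump_mul_le hw (x := graphAbscissa w s') h4
    have h6 : (k : ℝ) * _ ≤ k * (s' - s) := mul_le_mul_of_nonneg_left h5 k.coe_nonneg
    linarith
  · set x := graphAbscissa w s
    set x' := graphAbscissa w s'
    have h1 := norm_sub_graphValue_le hΦ hw h hs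
    have h2 := norm_graphValue_sub_leftLim_le hΦ hw h hs'
    have h3 := hw.norm_leftLim_sub_le hlt
    have h4 : graphValue Φ w s' - graphValue Φ w s = (graphValue Φ w s' - w.leftLim x') +
      (w.leftLim x' - w x) + (w x - graphValue Φ w s) := by abel
    have h5 := norm_add₃_le (a := graphValue Φ w s' - w.leftLim x') (b := w.leftLim x' - w x)
      (c := w x - graphValue Φ w s)
    rw [h4]
    have h6 := hw.le_graphLength_abscissa s
    have h7 := hw.leftLim_abscissa_le s'
    have h8 := hw.graphLength_le_leftLim hlt
    nlinarith [k.coe_nonneg]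

lemma lipschitzOn_graphValue_of_abscissa (hΦ : IsDLMFamily Ω Φ) (hw : IsRCBV w)
    (h : HasSpeedOn Ω Φ w K k a b) :
    LipschitzOnWith (k + 1) (graphValue Φ w) (graphAbscissa w ⁻¹' Icc a b) := by
  refine LipschitzOnWith.of_dist_le_mul fun s hs s' hs' ↦ ?_
  rw [dist_eq_norm, Real.dist_eq]
  push_cast
  rcases le_total s s' with hss | hss
  · rw [norm_sub_rev, abs_sub_comm, abs_of_nonneg (sub_nonneg.2 hss)]
    exact norm_graphValue_sub_le hΦ hw h hss hs hs'
  · rw [abs_of_nonneg (sub_nonneg.2 hss)]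
    exact norm_graphValue_sub_le hΦ hw h hss hs' hs

lemma lipschitzOn_graphValue (hΦ : IsDLMFamily Ω Φ) (hw : IsRCBV w)
    (h : HasSpeedOn Ω Φ w K k a b) {x y : ℝ} (hx : a ≤ x) (hy : y ≤ b) :
    LipschitzOnWith (k + 1) (graphValue Φ w) (Icc (graphLength w x) (graphLength w y)) :=
  (lipschitzOn_graphValue_of_abscissa hΦ hw h).mono fun s hs ↦ by
    have := hw.graphAbscissa_mem_Icc hs
    exact ⟨hx.trans this.1, this.2.trans hy⟩

/-- The parameter `graphLength w x` is the right end of the interval inserted at `x`, where the path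
has reached its end point. Without a jump the path parameter is 0, and both end points coincide. -/
lemma graphValue_graphLength (hΦ : IsDLMFamily Ω Φ) (hw : IsRCBV w) {x : ℝ}
    (hl : w.leftLim x ∈ Ω) (hr : w x ∈ Ω) : graphValue Φ w (graphLength w x) = w x := by
  rw [graphValue_eq hw]
  unfold graphParam
  rw [hw.graphAbscissa_graphLength]
  have h1 := hw.norm_sub_leftLim_le x
  rcases (sub_nonneg.2 (hw.leftLim_le_graphLength x)).eq_or_lt with h0 | h0
  · rw [← h0] at h1 ⊢
    have h2 : w x = w.leftLim x := sub_eq_zero.1 (norm_eq_zero.1 (le_antisymm h1 (norm_nonneg _)))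
    rw [div_zero, hΦ.left _ hl _ hr, ← h2]
  · rw [div_self h0.ne', hΦ.right _ hl _ hr]

/-- The integral of `A` along the part of the graph completion over `(x, y]`. -/
def curveIntegral (A : Phase N → Phase N →L[ℝ] Phase N) (Φ : ℝ → Phase N → Phase N → Phase N)
    (w : ℝ → Phase N) (x y : ℝ) : Phase N :=
  ∫ s in graphLength w x..graphLength w y, A (graphValue Φ w s) (deriv (graphValue Φ w) s)

lemma continuousOn_comp_graphValue (hD : IsRegularData Ω A Φ) (hw : IsRCBV w)
    (h : HasSpeedOn Ω Φ w K k a b) {x y : ℝ} (hx : a ≤ x) (hy : y ≤ b) :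
    ContinuousOn (fun s ↦ A (graphValue Φ w s)) (Icc (graphLength w x) (graphLength w y)) := by
  refine hD.continuousOn.comp (lipschitzOn_graphValue hD.path hw h hx hy).continuousOn fun s hs ↦ ?_
  have := hw.graphAbscissa_mem_Icc hs
  exact graphValue_mem hD.path hw h ⟨hx.trans this.1, this.2.trans hy⟩

lemma intervalIntegrable_curve (hD : IsRegularData Ω A Φ) (hw : IsRCBV w)
    (h : HasSpeedOn Ω Φ w K k a b) {x y : ℝ} (hx : a ≤ x) (hxy : x ≤ y) (hy : y ≤ b) :
    IntervalIntegrable (fun s ↦ A (graphValue Φ w s) (deriv (graphValue Φ w) s)) volume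
      (graphLength w x) (graphLength w y) :=
  intervalIntegrable_clm_deriv (hw.strictMono_graphLength.monotone hxy)
    (lipschitzOn_graphValue hD.path hw h hx hy) (continuousOn_comp_graphValue hD hw h hx hy)

lemma curveIntegral_add (hD : IsRegularData Ω A Φ) (hw : IsRCBV w)
    (h : HasSpeedOn Ω Φ w K k a b) {x y z : ℝ} (hx : a ≤ x) (hxy : x ≤ y) (hyz : y ≤ z)
    (hz : z ≤ b) :
    curveIntegral A Φ w x z = curveIntegral A Φ w x y + curveIntegral A Φ w y z :=
  (intervalIntegral.integral_add_adjacent_intervals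
    (intervalIntegrable_curve hD hw h hx hxy (hyz.trans hz))
    (intervalIntegrable_curve hD hw h (hx.trans hxy) hyz hz)).symm

/-- The integral of `A` along the part of the graph completion over a jump point. -/
lemma integral_jump (hw : IsRCBV w) (x : ℝ)
    (hlt : (graphLength w).leftLim x < graphLength w x) :
    ∫ s in (graphLength w).leftLim x..graphLength w x,
      A (graphValue Φ w s) (deriv (graphValue Φ w) s) = pathIntegral A Φ (w.leftLim x) (w x) := by
  set l := (graphLength w).leftLim x
  set r := graphLength w x
  have hD : 0 < r - l := sub_pos.2 hlt
  set φ : ℝ → Phase N := fun θ ↦ Φ θ (w.leftLim x) (w x) with hφ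
  have hX : ∀ s ∈ Ioc l r, graphAbscissa w s = x := by
    intro s hs
    refine le_antisymm (hw.graphAbscissa_le_iff.2 hs.2) (le_of_not_gt fun hlt ↦ ?_)
    have h1 := hw.le_graphLength_abscissa s
    have h2 := hw.graphLength_le_leftLim hlt
    exact absurd hs.1 (not_lt.2 (h1.trans h2))
  have hW : ∀ s ∈ Ioc l r, graphValue Φ w s = φ ((r - l)⁻¹ * s + -((r - l)⁻¹ * l)) := by
    intro s hs
    rw [graphValue_eq hw]
    unfold graphParam
    rw [hX s hs, hφ]
    change Φ ((s - l) / (r - l)) _ _ = _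
    congr 1
    ring
  -- Two-sided derivatives are compared in the open interval only; the end point `r` is removed as a
  -- null set afterwards.
  have hderiv : ∀ s ∈ Ioo l r, deriv (graphValue Φ w) s =
      (r - l)⁻¹ • deriv φ ((r - l)⁻¹ * s + -((r - l)⁻¹ * l)) := by
    intro s hs
    have heq : graphValue Φ w =ᶠ[𝓝 s] fun s ↦ φ ((r - l)⁻¹ * s + -((r - l)⁻¹ * l)) := by
      filter_upwards [Ioo_mem_nhds hs.1 hs.2] with t ht using hW t ⟨ht.1, ht.2.le⟩
    rw [heq.deriv_eq]
    have := deriv_comp_mul_left (r - l)⁻¹ (fun t ↦ φ (t + -((r - l)⁻¹ * l))) s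
    rw [this, deriv_comp_add_const]
  have hne : ∀ᵐ s : ℝ, s ≠ r := by simp [ae_iff, measure_singleton]
  have hcongr : ∫ s in l..r, A (graphValue Φ w s) (deriv (graphValue Φ w) s) =
      ∫ s in l..r, (r - l)⁻¹ • (fun θ ↦ A (φ θ) (deriv φ θ)) ((r - l)⁻¹ * s + -((r - l)⁻¹ * l)) := by
    refine intervalIntegral.integral_congr_ae ?_
    filter_upwards [hne] with s hsr hs
    rw [uIoc_of_le hlt.le] at hs
    rw [hderiv s ⟨hs.1, lt_of_le_of_ne hs.2 hsr⟩, hW s hs, map_smul]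
  rw [hcongr, intervalIntegral.integral_smul,
    intervalIntegral.integral_comp_mul_add (fun θ ↦ A (φ θ) (deriv φ θ)) (inv_ne_zero hD.ne'), inv_inv, smul_smul,
    inv_mul_cancel₀ hD.ne', one_smul]
  have e1 : (r - l)⁻¹ * l + -((r - l)⁻¹ * l) = 0 := by ring
  have e2 : (r - l)⁻¹ * r + -((r - l)⁻¹ * l) = 1 := by field_simp; ring
  rw [e1, e2]
  rfl

end Curve

/-! ### Local behaviour near continuity and jump points, and limits of grid sums. -/

section Local

variable {Ω : Set (Phase N)} {A : Phase N → Phase N →L[ℝ] Phase N}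
  {Φ : ℝ → Phase N → Phase N → Phase N} {w : ℝ → Phase N} {K : Set (Phase N)} {k : ℝ≥0} {a b : ℝ}

/-- Around a point of continuity, `w` and its left limits are close to the value at this point. -/
lemma IsRCBV.exists_close (hw : IsRCBV w) {x₀ : ℝ} (h : w.leftLim x₀ = w x₀) {η : ℝ} (hη : 0 < η) :
    ∃ δ > 0, ∀ x, x₀ - δ < x → x < x₀ + δ → ‖w x - w x₀‖ < η ∧ ‖w.leftLim x - w x₀‖ ≤ η := by
  obtain ⟨δ, hδ, hδ'⟩ := Metric.continuousAt_iff.1 (hw.continuousAt_of_leftLim_eq h) η hη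
  have h1 : ∀ x, x₀ - δ < x → x < x₀ + δ → ‖w x - w x₀‖ < η := by
    intro x hx hx'
    rw [← dist_eq_norm]
    exact hδ' (by rw [Real.dist_eq, abs_lt]; constructor <;> linarith)
  refine ⟨δ, hδ, fun x hx hx' ↦ ⟨h1 x hx hx', ?_⟩⟩
  refine le_of_tendsto ((hw.tendsto_left x).sub_const _).norm ?_
  filter_upwards [Ioo_mem_nhdsLT hx] with z hz
  exact (h1 z hz.1 (hz.2.trans hx')).le

/-- An additive interval function that behaves like `A(w) dw` near the points of continuity of `w`
and like the integral along the path at the jump points is the limit of the sums of the integrals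
along the paths that join the values of `w` at the points of uniform grids. -/
lemma tendsto_sum_pathIntegral (hD : IsRegularData Ω A Φ) (hw : IsRCBV w) (hab : a ≤ b)
    (hmem : ∀ x ∈ Icc a b, w.leftLim x ∈ Ω ∧ w x ∈ Ω) {R : ℝ} (hR : ∀ x ∈ Icc a b, ‖w x‖ ≤ R)
    (F : ℝ → ℝ → Phase N) {C : ℝ}
    (hadd : ∀ x ∈ Icc a b, ∀ y ∈ Icc a b, ∀ z ∈ Icc a b, x ≤ y → y ≤ z → F x z = F x y + F y z)
    (hF : ∀ x ∈ Icc a b, ∀ y ∈ Icc a b, x ≤ y →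
      ‖F x y‖ ≤ C * (graphLength w y - graphLength w x))
    (hcont : ∀ x₀ ∈ Ioc a b, w.leftLim x₀ = w x₀ → ∀ ε > 0, ∃ δ > 0, ∀ x ∈ Icc a b, ∀ y ∈ Icc a b,
      x₀ - δ < x → x < x₀ → x₀ ≤ y → y < x₀ + δ →
      ‖F x y - A (w x₀) (w y - w x)‖ ≤ ε * (graphLength w y - graphLength w x))
    (hjump : ∀ x₀ ∈ Ioc a b, w.leftLim x₀ ≠ w x₀ → ∀ ε > 0, ∃ δ > 0, ∀ x ∈ Icc a b, ∀ y ∈ Icc a b,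
      x₀ - δ < x → x < x₀ → x₀ ≤ y → y < x₀ + δ →
      ‖F x y - pathIntegral A Φ (w.leftLim x₀) (w x₀)‖ ≤ ε) :
    Tendsto (fun n : ℕ ↦ ∑ j ∈ Finset.range (n + 1),
      pathIntegral A Φ (w (grid a b n j)) (w (grid a b n (j + 1)))) atTop (𝓝 (F a b)) := by
  refine tendsto_sum_grid_of_additive F (fun x y ↦ pathIntegral A Φ (w x) (w y)) hab hadd ?_
  obtain ⟨c, hc⟩ := hD.bound R
  refine tendsto_sum_grid hw.stieltjes (fun x y ↦ F x y - pathIntegral A Φ (w x) (w y))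
    (C := C + c) hab ?_ ?_
  · intro x hx y hy hxy
    simp only [hw.stieltjes_apply]
    have h1 := hc.norm_pathIntegral_le _ (hmem x hx).2 (hR x hx) _ (hmem y hy).2 (hR y hy)
    have h2 := hw.norm_sub_le hxy
    rw [add_mul]
    exact (norm_sub_le _ _).trans (add_le_add (hF x hx y hy hxy) (h1.trans (by gcongr)))
  · intro x₀ hx₀ ε hε
    simp only [hw.stieltjes_apply]
    have hx₀' : x₀ ∈ Icc a b := Ioc_subset_Icc_self hx₀
    by_cases heq : w.leftLim x₀ = w x₀
    -- At a point of continuity both interval functions equal `A (w x₀) (w y - w x)` up to a small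
    -- multiple of the increment of the graph length.
    · obtain ⟨δ₁, hδ₁, h₁⟩ := hcont x₀ hx₀ heq (ε / 2) (by positivity)
      obtain ⟨η, hη, -, h₂⟩ := exists_pathIntegral_sub_le hD.isOpen hD.continuousOn hD.path
        (hmem x₀ hx₀').2 (half_pos hε)
      obtain ⟨δ₂, hδ₂, h₃⟩ := hw.exists_close heq hη
      refine ⟨min δ₁ δ₂, lt_min hδ₁ hδ₂, fun x hx y hy hx1 hx2 hy1 hy2 ↦ ?_⟩
      have m1 := min_le_left δ₁ δ₂
      have m2 := min_le_right δ₁ δ₂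
      have e1 := h₁ x hx y hy (by linarith) hx2 hy1 (by linarith)
      have e2 := h₂ (w x) (by rw [mem_ball_iff_norm]; exact (h₃ x (by linarith) (by linarith)).1)
        (w y) (by rw [mem_ball_iff_norm]; exact (h₃ y (by linarith) (by linarith)).1)
      have e3 := hw.norm_sub_le (hx2.le.trans hy1)
      calc ‖F x y - pathIntegral A Φ (w x) (w y)‖
          = ‖(F x y - A (w x₀) (w y - w x)) -
            (pathIntegral A Φ (w x) (w y) - A (w x₀) (w y - w x))‖ := by
            rw [sub_sub_sub_cancel_right]
        _ ≤ ε / 2 * (graphLength w y - graphLength w x) + ε / 2 * ‖w y - w x‖ :=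
            (norm_sub_le _ _).trans (add_le_add e1 e2)
        _ ≤ ε / 2 * (graphLength w y - graphLength w x) +
            ε / 2 * (graphLength w y - graphLength w x) := by gcongr
        _ = _ := by ring
    -- At a jump both interval functions are within `ε * J / 2` of the same path integral. An
    -- absolute error `ε * J` is also a relative one, because the graph length increases by at least
    -- `J` across the jump.
    · set J := ‖w x₀ - w.leftLim x₀‖ with hJ
      have hJ0 : 0 < J := norm_pos_iff.2 (sub_ne_zero.2 (Ne.symm heq))
      obtain ⟨δ₁, hδ₁, h₁⟩ := hjump x₀ hx₀ heq (ε * J / 2) (by positivity)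
      have hP := hD.continuousOn_pathIntegral.continuousAt
        ((hD.isOpen.prod hD.isOpen).mem_nhds (Set.mk_mem_prod (hmem x₀ hx₀').1 (hmem x₀ hx₀').2))
      obtain ⟨η, hη, h₂⟩ := Metric.continuousAt_iff.1 hP (ε * J / 2) (by positivity)
      obtain ⟨u, hu, hu'⟩ := (mem_nhdsLT_iff_exists_Ioo_subset' (sub_one_lt x₀)).1
        (hw.tendsto_left x₀ (Metric.ball_mem_nhds _ hη))
      obtain ⟨v, hv, hv'⟩ := (mem_nhdsGT_iff_exists_Ioo_subset' (lt_add_one x₀)).1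
        (hw.tendsto_right x₀ (Metric.ball_mem_nhds _ hη))
      have hu0 : 0 < x₀ - u := sub_pos.2 hu
      have hv0 : 0 < v - x₀ := sub_pos.2 hv
      refine ⟨min δ₁ (min (x₀ - u) (v - x₀)), by positivity, fun x hx y hy hx1 hx2 hy1 hy2 ↦ ?_⟩
      have m1 := min_le_left δ₁ (min (x₀ - u) (v - x₀))
      have m2 := (min_le_right δ₁ (min (x₀ - u) (v - x₀))).trans (min_le_left _ _)
      have m3 := (min_le_right δ₁ (min (x₀ - u) (v - x₀))).trans (min_le_right _ _)
      have e1 := h₁ x hx y hy (by linarith) hx2 hy1 (by linarith)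
      have ex : dist (w x) (w.leftLim x₀) < η := hu' ⟨by linarith, hx2⟩
      have ey : dist (w y) (w x₀) < η := by
        rcases hy1.eq_or_lt with h | h
        · rw [← h, dist_self]; exact hη
        · exact hv' ⟨h, by linarith⟩
      have e2 := h₂ (x := (w x, w y)) (by rw [Prod.dist_eq]; exact max_lt ex ey)
      rw [dist_eq_norm] at e2
      have e3 : J ≤ graphLength w y - graphLength w x := by
        have h3 := hw.norm_sub_leftLim_le x₀
        have h4 := hw.graphLength_le_leftLim hx2
        have h5 := hw.strictMono_graphLength.monotone hy1
        linarith
      calc ‖F x y - pathIntegral A Φ (w x) (w y)‖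
          = ‖(F x y - pathIntegral A Φ (w.leftLim x₀) (w x₀)) -
            (pathIntegral A Φ (w x) (w y) - pathIntegral A Φ (w.leftLim x₀) (w x₀))‖ := by
            rw [sub_sub_sub_cancel_right]
        _ ≤ ε * J / 2 + ε * J / 2 := (norm_sub_le _ _).trans (add_le_add e1 e2.le)
        _ = ε * J := by ring
        _ ≤ _ := by gcongr

/-- The integral along the graph completion is the limit of the sums of the integrals along the
paths that join the values of `w` at the points of uniform grids. -/
lemma tendsto_sum_curveIntegral (hD : IsRegularData Ω A Φ) (hw : IsRCBV w)
    (h : HasSpeedOn Ω Φ w K k a b) (hK : IsCompact K) (hab : a ≤ b) :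
    Tendsto (fun n : ℕ ↦ ∑ j ∈ Finset.range (n + 1),
      pathIntegral A Φ (w (grid a b n j)) (w (grid a b n (j + 1)))) atTop
      (𝓝 (curveIntegral A Φ w a b)) := by
  have hmem : ∀ x ∈ Icc a b, w.leftLim x ∈ Ω ∧ w x ∈ Ω := fun x hx ↦
    ⟨h.subset (h.mem x hx).1, h.subset (h.mem x hx).2⟩
  obtain ⟨R, hR⟩ := hK.isBounded.exists_norm_le
  have hσ := hw.strictMono_graphLength.monotone
  obtain ⟨c, hc⟩ := isCompact_Icc.exists_bound_of_continuousOn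
    (continuousOn_comp_graphValue hD hw h le_rfl le_rfl)
  have hc' : ∀ s t, graphLength w a ≤ s → s ≤ t → t ≤ graphLength w b →
      ‖∫ s in s..t, A (graphValue Φ w s) (deriv (graphValue Φ w) s)‖ ≤ c * (k + 1) * (t - s) := by
    intro s t hs hst ht
    have hsub : Icc s t ⊆ Icc (graphLength w a) (graphLength w b) := Icc_subset_Icc hs ht
    have := norm_integral_clm_deriv_sub_le hst
      ((lipschitzOn_graphValue hD.path hw h le_rfl le_rfl).mono hsub)
      ((continuousOn_comp_graphValue hD hw h le_rfl le_rfl).mono hsub) 0 (ε := c)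
      fun r hr ↦ by rw [sub_zero]; exact hc r (hsub hr)
    simpa using this
  refine tendsto_sum_pathIntegral hD hw hab hmem (R := R) (fun x hx ↦ hR _ (h.mem x hx).2)
    (curveIntegral A Φ w) (C := c * (k + 1)) ?_ ?_ ?_ ?_
  · intro x hx y hy z hz hxy hyz
    exact curveIntegral_add hD hw h hx.1 hxy hyz hz.2
  · intro x hx y hy hxy
    exact hc' _ _ (hσ hx.1) (hσ hxy) (hσ hy.2)
  · intro x₀ hx₀ heq ε hε
    have hx₀' : x₀ ∈ Icc a b := Ioc_subset_Icc_self hx₀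
    have hAe : ContinuousAt A (w x₀) :=
      hD.continuousOn.continuousAt (hD.isOpen.mem_nhds (hmem x₀ hx₀').2)
    obtain ⟨η, hη, hη'⟩ := Metric.continuousAt_iff.1 hAe (ε / (k + 1)) (by positivity)
    -- Nearby jumps are at most `2 * (η / (2 + 2 * k))`, and the inserted paths stray from `w` by at
    -- most `k` times that; the sum `(1 + 2 * k) * η / (2 + 2 * k)` stays below `η`.
    obtain ⟨δ, hδ, hδ'⟩ := hw.exists_close heq (η := η / (2 + 2 * k)) (by positivity)
    refine ⟨δ, hδ, fun x hx y hy hx1 hx2 hy1 hy2 ↦ ?_⟩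
    have hxy := hx2.le.trans hy1
    have := norm_integral_clm_deriv_sub_le (hσ hxy)
      (lipschitzOn_graphValue hD.path hw h hx.1 hy.2)
      (continuousOn_comp_graphValue hD hw h hx.1 hy.2) (A (w x₀)) (ε := ε / (k + 1)) ?_
    · rw [graphValue_graphLength hD.path hw (hmem x hx).1 (hmem x hx).2,
        graphValue_graphLength hD.path hw (hmem y hy).1 (hmem y hy).2] at this
      refine this.trans (le_of_eq ?_)
      push_cast
      field_simp
    · intro s hs
      have hX := hw.graphAbscissa_mem_Icc hs
      set z := graphAbscissa w s with hz
      obtain ⟨h1, h2⟩ := hδ' z (by linarith [hX.1]) (by linarith [hX.2])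
      have h3 := norm_sub_graphValue_le' hD.path hw h (s := s) ⟨hx.1.trans hX.1, hX.2.trans hy.2⟩
      have hθ := graphParam_mem hw s
      have h4 : ‖w z - w.leftLim z‖ ≤ 2 * (η / (2 + 2 * k)) := by
        calc ‖w z - w.leftLim z‖ = ‖(w z - w x₀) - (w.leftLim z - w x₀)‖ := by
              rw [sub_sub_sub_cancel_right]
          _ ≤ _ := by linarith [norm_sub_le (w z - w x₀) (w.leftLim z - w x₀)]
      have h5 : ‖w z - graphValue Φ w s‖ ≤ k * (2 * (η / (2 + 2 * k))) := by
        refine h3.trans ?_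
        calc k * ‖w z - w.leftLim z‖ * (1 - graphParam w s) ≤ k * ‖w z - w.leftLim z‖ * 1 := by
              gcongr
              linarith [hθ.1]
          _ ≤ _ := by rw [mul_one]; gcongr
      rw [← dist_eq_norm]
      refine (hη' ?_).le
      rw [dist_eq_norm]
      calc ‖graphValue Φ w s - w x₀‖ = ‖(w z - w x₀) - (w z - graphValue Φ w s)‖ := by
            rw [sub_sub_sub_cancel_left]
        _ ≤ ‖w z - w x₀‖ + ‖w z - graphValue Φ w s‖ := norm_sub_le _ _
        _ < η / (2 + 2 * k) + k * (2 * (η / (2 + 2 * k))) := by linarith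
        _ = η * ((1 + 2 * k) / (2 + 2 * k)) := by field_simp
        _ ≤ η * 1 := by
            gcongr
            rw [div_le_one (by positivity)]
            linarith
        _ = η := mul_one η
  · intro x₀ hx₀ hne ε hε
    set l := (graphLength w).leftLim x₀
    set r := graphLength w x₀
    have hlr : l < r := by
      have h1 := hw.norm_sub_leftLim_le x₀
      have h2 : 0 < ‖w x₀ - w.leftLim x₀‖ := norm_pos_iff.2 (sub_ne_zero.2 (Ne.symm hne))
      linarith
    have hcnn : 0 ≤ c := (norm_nonneg _).trans (hc _ ⟨le_rfl, hσ hab⟩)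
    -- The pieces of the curve on either side of the jump have parameter length less than `η`; with
    -- `A` bounded by `c` and speed at most `k + 1`, each contributes at most `ε / 2`.
    set η := ε / (2 * (c * (k + 1) + 1)) with hη
    have hη0 : 0 < η := by positivity
    obtain ⟨u, hu, hu'⟩ := (mem_nhdsLT_iff_exists_Ioo_subset' (sub_one_lt x₀)).1
        (hw.tendsto_graphLength_left x₀ (Ioi_mem_nhds (show l - η < l by linarith)))
    obtain ⟨v, hv, hv'⟩ := (mem_nhdsGE_iff_exists_Ico_subset' (lt_add_one x₀)).1
        (hw.tendsto_graphLength_right x₀ (Iio_mem_nhds (show r < r + η by linarith)))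
    have hu0 : 0 < x₀ - u := sub_pos.2 hu
    have hv0 : 0 < v - x₀ := sub_pos.2 hv
    refine ⟨min (x₀ - u) (v - x₀), by positivity, fun x hx y hy hx1 hx2 hy1 hy2 ↦ ?_⟩
    have m1 := min_le_left (x₀ - u) (v - x₀)
    have m2 := min_le_right (x₀ - u) (v - x₀)
    have e1 : l - η < graphLength w x := hu' ⟨by linarith, hx2⟩
    have e2 : graphLength w y < r + η := hv' ⟨hy1, by linarith⟩
    have hxl : graphLength w x ≤ l := hw.graphLength_le_leftLim hx2
    have hry : r ≤ graphLength w y := hσ hy1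
    have hax := hσ hx.1
    have hyb := hσ hy.2
    have hint : ∀ s t, graphLength w a ≤ s → s ≤ t → t ≤ graphLength w b →
        IntervalIntegrable (fun s ↦ A (graphValue Φ w s) (deriv (graphValue Φ w) s)) volume s t := by
      intro s t hs hst ht
      exact (intervalIntegrable_curve hD hw h le_rfl hab le_rfl).mono_set (by
        rw [uIcc_of_le hst, uIcc_of_le (hσ hab)]; exact Icc_subset_Icc hs ht)
    have hsplit : curveIntegral A Φ w x y =
        (∫ s in graphLength w x..l, A (graphValue Φ w s) (deriv (graphValue Φ w) s)) +
        pathIntegral A Φ (w.leftLim x₀) (w x₀) +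
        ∫ s in r..graphLength w y, A (graphValue Φ w s) (deriv (graphValue Φ w) s) := by
      rw [← integral_jump hw x₀ hlr, intervalIntegral.integral_add_adjacent_intervals
        (hint _ _ hax hxl (by linarith)) (hint _ _ (by linarith) hlr.le (by linarith)),
        intervalIntegral.integral_add_adjacent_intervals
        (hint _ _ hax (by linarith) (by linarith)) (hint _ _ (by linarith) hry hyb)]
      rfl
    have f1 := hc' _ _ hax hxl (by linarith)
    have f2 := hc' _ _ (by linarith) hry hyb
    have f3 : ∀ d, d ≤ η → c * (k + 1) * d ≤ ε / 2 := by
      intro d hd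
      calc c * (k + 1) * d ≤ c * (k + 1) * η := by gcongr
        _ ≤ (c * (k + 1) + 1) * η := by gcongr; linarith
        _ = ε / 2 := by rw [hη]; field_simp
    calc ‖curveIntegral A Φ w x y - pathIntegral A Φ (w.leftLim x₀) (w x₀)‖
        = ‖(∫ s in graphLength w x..l, A (graphValue Φ w s) (deriv (graphValue Φ w) s)) +
          ∫ s in r..graphLength w y, A (graphValue Φ w s) (deriv (graphValue Φ w) s)‖ := by
          rw [hsplit]; congr 1; abel
      _ ≤ ε / 2 + ε / 2 := (norm_add_le _ _).trans (add_le_add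
          (f1.trans (f3 _ (by linarith))) (f2.trans (f3 _ (by linarith))))
      _ = ε := by ring

end Local

/-! ### The derivative of a function of bounded variation -/

namespace IsRCBV

variable {w : ℝ → Phase N}

/-- By right-continuity `w` is the pointwise limit of its samples at the first grid point strictly
to the right of `x`, and these depend on `x` through an integer part only. -/
lemma measurable (hw : IsRCBV w) : Measurable w := by
  refine measurable_of_tendsto_metrizable
    (f := fun (n : ℕ) x ↦ w ((⌊((n : ℝ) + 1) * x⌋ + 1) / ((n : ℝ) + 1))) (fun n ↦ ?_) ?_
  · exact (measurable_from_top (f := fun j : ℤ ↦ w (((j : ℝ) + 1) / ((n : ℝ) + 1)))).comp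
      (Int.measurable_floor.comp (measurable_const_mul _))
  · rw [tendsto_pi_nhds]
    intro x
    refine (hw.tendsto_right x).comp (tendsto_nhdsWithin_iff.2 ⟨?_, Eventually.of_forall fun n ↦ ?_⟩)
    · have h1 : Tendsto (fun n : ℕ ↦ x + 1 / ((n : ℝ) + 1)) atTop (𝓝 (x + 0)) :=
        tendsto_const_nhds.add tendsto_one_div_add_atTop_nhds_zero_nat
      rw [add_zero] at h1
      refine tendsto_of_tendsto_of_tendsto_of_le_of_le tendsto_const_nhds h1 (fun n ↦ ?_) fun n ↦ ?_
      · have hn : (0 : ℝ) < n + 1 := by positivity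
        rw [le_div_iff₀ hn]
        linarith [Int.lt_floor_add_one (((n : ℝ) + 1) * x)]
      · have hn : (0 : ℝ) < n + 1 := by positivity
        have h2 := Int.floor_le (((n : ℝ) + 1) * x)
        rw [div_le_iff₀ hn]
        field_simp
        linarith
    · have hn : (0 : ℝ) < n + 1 := by positivity
      rw [mem_Ioi, lt_div_iff₀ hn]
      linarith [Int.lt_floor_add_one (((n : ℝ) + 1) * x)]

/-- The variation of `w` on `(-∞, x]`, as a Stieltjes function. -/
def varStieltjes (hw : IsRCBV w) : StieltjesFunction ℝ where
  toFun x := graphLength w x - x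
  mono' x y hxy := by
    have := hw.sub_le_graphLength_sub hxy
    linarith
  right_continuous' x := ContinuousWithinAt.sub (hw.stieltjes.right_continuous x)
    continuousWithinAt_id

lemma varStieltjes_apply (hw : IsRCBV w) (x : ℝ) : hw.varStieltjes x = graphLength w x - x := rfl

lemma varStieltjes_sub (hw : IsRCBV w) {x y : ℝ} (hxy : x ≤ y) :
    hw.varStieltjes y - hw.varStieltjes x = (eVariationOn w (Icc x y)).toReal := by
  rw [varStieltjes_apply, varStieltjes_apply]
  linarith [hw.graphLength_sub hxy]

lemma varStieltjes_nonneg (hw : IsRCBV w) (x : ℝ) : 0 ≤ hw.varStieltjes x := by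
  rw [varStieltjes_apply]
  linarith [le_graphLength (w := w) x]

lemma varStieltjes_le (hw : IsRCBV w) (x : ℝ) : hw.varStieltjes x ≤ totalVar w := by
  rw [varStieltjes_apply]
  linarith [hw.graphLength_le x]

lemma measure_univ_le (hw : IsRCBV w) : hw.varStieltjes.measure univ ≤ eVariationOn w univ := by
  have hb : BddBelow (range hw.varStieltjes) := ⟨0, by rintro _ ⟨x, rfl⟩; exact hw.varStieltjes_nonneg x⟩
  have ha : BddAbove (range hw.varStieltjes) :=
    ⟨totalVar w, by rintro _ ⟨x, rfl⟩; exact hw.varStieltjes_le x⟩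
  rw [hw.varStieltjes.measure_univ (tendsto_atBot_ciInf hw.varStieltjes.mono hb)
    (tendsto_atTop_ciSup hw.varStieltjes.mono ha)]
  rw [← ENNReal.ofReal_toReal (hw.eVariationOn_ne_top univ)]
  refine ENNReal.ofReal_le_ofReal ?_
  have h1 : ⨆ x, hw.varStieltjes x ≤ totalVar w := ciSup_le hw.varStieltjes_le
  have h2 : 0 ≤ ⨅ x, hw.varStieltjes x := le_ciInf hw.varStieltjes_nonneg
  change _ ≤ totalVar w
  linarith

instance (hw : IsRCBV w) : IsFiniteMeasure hw.varStieltjes.measure :=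
  ⟨lt_of_le_of_lt hw.measure_univ_le (lt_top_iff_ne_top.2 (hw.eVariationOn_ne_top univ))⟩

lemma vectorMeasure_Ioc (hw : IsRCBV w) {x y : ℝ} (hxy : x ≤ y) :
    hw.bv.vectorMeasure (Ioc x y) = w y - w x := by
  rw [hw.bv.vectorMeasure_Ioc hxy, hw.rightLim_eq]

/-- The inequality is clear on half-open intervals. A content on intervals dominated by a finite
measure extends to a vector measure with the same domination on all sets, and by uniqueness this
extension is the derivative of `w`. -/
lemma enorm_vectorMeasure_le (hw : IsRCBV w) (s : Set ℝ) :
    ‖hw.bv.vectorMeasure s‖ₑ ≤ hw.varStieltjes.measure s := by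
  have hgen : borel ℝ = MeasurableSpace.generateFrom {s | ∃ u v, u ≤ v ∧ s = Ioc u v} := by
    convert! borel_eq_generateFrom_Ioc_le ℝ using 2
    grind only
  obtain ⟨m', hm', hb⟩ := VectorMeasure.exists_extension_of_isSetSemiring_of_le_measure_of_generateFrom
    (μ := hw.varStieltjes.measure) (m := AddContent.onIoc w) IsSetSemiring.Ioc (by
      rintro s ⟨u, v, huv, rfl⟩
      rw [AddContent.onIoc_apply huv, hw.varStieltjes.measure_Ioc, hw.varStieltjes_sub huv,
        ENNReal.ofReal_toReal (hw.eVariationOn_ne_top _), ← edist_eq_enorm_sub]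
      exact eVariationOn.edist_le _ ⟨huv, le_rfl⟩ ⟨le_rfl, huv⟩)
    ((BorelSpace.measurable_eq (α := ℝ)).trans hgen)
  have hIoc : ∀ u v, u ≤ v → m' (Ioc u v) = hw.bv.vectorMeasure (Ioc u v) := by
    intro u v huv
    rw [hm' _ ⟨u, v, huv, rfl⟩, AddContent.onIoc_apply huv, hw.vectorMeasure_Ioc huv]
  have heq : m' = hw.bv.vectorMeasure := by
    refine VectorMeasure.ext_of_generateFrom {s | ∃ u v, u ≤ v ∧ s = Ioc u v} ?_
      ((BorelSpace.measurable_eq (α := ℝ)).trans hgen) IsSetSemiring.Ioc.isPiSystem ?_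
    · rintro _ ⟨u, v, huv, rfl⟩
      exact hIoc u v huv
    -- Uniqueness from a π-system also requires agreement on the whole line, which is exhausted by
    -- bounded intervals.
    · have hU : (univ : Set ℝ) = ⋃ n : ℕ, Ioc (-(n : ℝ)) n := by
        refine (eq_univ_of_forall fun x ↦ mem_iUnion.2 ?_).symm
        obtain ⟨n, hn⟩ := exists_nat_gt |x|
        exact ⟨n, by linarith [neg_abs_le x], by linarith [le_abs_self x]⟩
      have hmono : Monotone fun n : ℕ ↦ Ioc (-(n : ℝ)) n := fun m n hmn ↦ by
        have : (m : ℝ) ≤ n := by exact_mod_cast hmn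
        exact Ioc_subset_Ioc (by linarith) this
      have t1 := m'.tendsto_vectorMeasure_iUnion_atTop_nat hmono fun n ↦ measurableSet_Ioc
      have t2 := hw.bv.vectorMeasure.tendsto_vectorMeasure_iUnion_atTop_nat hmono
        fun n ↦ measurableSet_Ioc
      rw [← hU] at t1 t2
      refine tendsto_nhds_unique t1 (t2.congr fun n ↦ (hIoc _ _ ?_).symm)
      linarith [n.cast_nonneg (α := ℝ)]
  rw [← heq]
  exact hb s

lemma variation_vectorMeasure_le (hw : IsRCBV w) :
    hw.bv.vectorMeasure.variation ≤ hw.varStieltjes.measure :=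
  VectorMeasure.variation_le_of_forall_enorm_le fun s _ ↦ hw.enorm_vectorMeasure_le s

lemma mem_jumpSet (hw : IsRCBV w) {x : ℝ} : x ∈ jumpSet w ↔ w.leftLim x ≠ w x := by
  simp [jumpSet, hw.rightLim_eq]

/-- A jump of `w` is a discontinuity of the monotone function `graphLength w`. -/
lemma countable_jumpSet (hw : IsRCBV w) : (jumpSet w).Countable := by
  refine hw.strictMono_graphLength.monotone.countable_not_continuousAt.mono fun x hx ↦ ?_
  intro hc
  rw [hw.mem_jumpSet] at hx
  have h1 := hw.norm_sub_leftLim_le x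
  have h2 : (graphLength w).leftLim x = graphLength w x :=
    tendsto_nhds_unique (hw.tendsto_graphLength_left x) (hc.tendsto.mono_left nhdsWithin_le_nhds)
  rw [h2, sub_self] at h1
  exact hx (sub_eq_zero.1 (norm_eq_zero.1 (le_antisymm h1 (norm_nonneg _)))).symm

lemma vectorMeasure_singleton (hw : IsRCBV w) (x : ℝ) :
    hw.bv.vectorMeasure {x} = w x - w.leftLim x := by
  rw [hw.bv.vectorMeasure_singleton, hw.rightLim_eq]

lemma enorm_jump_le (hw : IsRCBV w) (x : ℝ) :
    ‖w x - w.leftLim x‖ₑ ≤ hw.varStieltjes.measure {x} := by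
  rw [← hw.vectorMeasure_singleton]
  exact hw.enorm_vectorMeasure_le _

/-- A function dominated by the jumps of `w` is summable over the jump set. -/
lemma lintegral_count_le (hw : IsRCBV w) {g : ℝ → Phase N} {c : ℝ≥0} {B : Set ℝ}
    (hB : B ⊆ jumpSet w) (hg : ∀ x ∈ B, ‖g x‖ ≤ c * ‖w x - w.leftLim x‖) :
    ∫⁻ x in B, ‖g x‖ₑ ∂Measure.count ≤ c * hw.varStieltjes.measure B := by
  have hBc : B.Countable := hw.countable_jumpSet.mono hB
  calc ∫⁻ x in B, ‖g x‖ₑ ∂Measure.count = ∑' x : B, ‖g x‖ₑ := by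
        rw [lintegral_countable _ hBc]
        simp
    _ ≤ ∑' x : B, c * hw.varStieltjes.measure {(x : ℝ)} := by
        refine ENNReal.tsum_le_tsum fun x ↦ ?_
        have h1 : ‖g x‖ₑ ≤ c * ‖w x - w.leftLim x‖ₑ := by
          have := hg x x.2
          rw [← coe_nnnorm, ← coe_nnnorm, ← NNReal.coe_mul, NNReal.coe_le_coe] at this
          rw [enorm_eq_nnnorm, enorm_eq_nnnorm]
          exact_mod_cast this
        exact h1.trans (mul_le_mul_right (hw.enorm_jump_le x) _)
    _ = c * hw.varStieltjes.measure B := by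
        rw [ENNReal.tsum_mul_left]
        congr 1
        have := hBc.to_subtype
        rw [← measure_iUnion (fun x y hxy ↦ by simpa [Subtype.ext_iff] using hxy)
          fun x ↦ measurableSet_singleton _]
        congr 1
        ext x
        simp

lemma integrableOn_count (hw : IsRCBV w) {g : ℝ → Phase N} {c : ℝ≥0} {B : Set ℝ}
    (hB : B ⊆ jumpSet w) (hg : ∀ x ∈ B, ‖g x‖ ≤ c * ‖w x - w.leftLim x‖) :
    IntegrableOn g B Measure.count := by
  refine ⟨?_, ?_⟩
  · have hBc : B.Countable := hw.countable_jumpSet.mono hB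
    -- Nothing is known about `g` outside `B`, but any function vanishing off a countable set is
    -- Borel, and the restricted measure does not see the difference.
    have hmeas : AEMeasurable g (Measure.count.restrict B) := by
      refine ⟨B.indicator g, measurable_of_measurable_on_compl_countable B hBc ?_, ?_⟩
      · have : Bᶜ.domRestrict (B.indicator g) = fun _ ↦ 0 := by
          ext1 x
          exact indicator_of_notMem x.2 g
        rw [this]
        exact measurable_const
      · exact (indicator_ae_eq_restrict hBc.measurableSet).symm
    exact hmeas.aestronglyMeasurable
  · exact lt_of_le_of_lt (hw.lintegral_count_le hB hg)
      (ENNReal.mul_lt_top ENNReal.coe_lt_top (measure_lt_top _ _))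

lemma vectorMeasure_of_subset_jumpSet (hw : IsRCBV w) {B : Set ℝ} (hB : B ⊆ jumpSet w) :
    hw.bv.vectorMeasure B = ∫ x in B, (w x - w.leftLim x) ∂Measure.count := by
  have hBc : B.Countable := hw.countable_jumpSet.mono hB
  have := hBc.to_subtype
  have hint : IntegrableOn (fun x ↦ w x - w.leftLim x) B Measure.count :=
    hw.integrableOn_count hB (c := 1) fun x _ ↦ by simp
  have h1 := hw.bv.vectorMeasure.hasSum_of_disjoint_iUnion (f := fun x : B ↦ {(x : ℝ)})
    (fun x ↦ measurableSet_singleton _) (fun x y hxy ↦ by simpa [Subtype.ext_iff] using hxy)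
  have hU : ⋃ x : B, {(x : ℝ)} = B := by ext x; simp
  have h2 := integral_iUnion (f := fun x ↦ w x - w.leftLim x) (μ := Measure.count)
    (s := fun x : B ↦ {(x : ℝ)}) (fun x ↦ measurableSet_singleton _)
    (fun x y hxy ↦ by simpa [Subtype.ext_iff] using hxy) (by rwa [hU])
  rw [hU] at h1 h2
  rw [h2, ← h1.tsum_eq]
  refine tsum_congr fun x ↦ ?_
  rw [hw.vectorMeasure_singleton, integral_singleton, measureReal_def, Measure.count_singleton,
    ENNReal.toReal_one, one_smul]

end IsRCBV

/-! ### Estimates of nonconservative products -/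

section Product

variable {Ω : Set (Phase N)} {A : Phase N → Phase N →L[ℝ] Phase N}
  {Φ : ℝ → Phase N → Phase N → Phase N} {w : ℝ → Phase N} {K : Set (Phase N)} {k c : ℝ≥0}
  {R a b : ℝ}

/-- A right-continuous function of bounded variation with one-sided limits in `Ω`, bounded by `R`. -/
structure IsAdmissible (Ω : Set (Phase N)) (R : ℝ) (w : ℝ → Phase N) : Prop extends IsRCBV w where
  leftLim_mem : ∀ x, w.leftLim x ∈ Ω
  mem : ∀ x, w x ∈ Ω
  norm_le : ∀ x, ‖w x‖ ≤ R

lemma IsAdmissible.norm_leftLim_le (hw : IsAdmissible Ω R w) (x : ℝ) : ‖w.leftLim x‖ ≤ R :=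
  le_of_tendsto (hw.tendsto_left x).norm (Eventually.of_forall hw.norm_le)

lemma nonconsProduct_eq (hw : IsRCBV w) : nonconsProduct A Φ w =
    (hw.bv.vectorMeasure.restrict (jumpSet w)ᶜ).withDensity (fun x ↦ A (w x))
        (ContinuousLinearMap.id ℝ (Phase N →L[ℝ] Phase N))
      + (Measure.count.restrict (jumpSet w)).withDensityᵥ
        (fun x ↦ pathIntegral A Φ (w.leftLim x) (w x)) := by
  rw [nonconsProduct, dif_pos hw.bv]
  simp only [hw.rightLim_eq]

lemma aestronglyMeasurable_comp (hA : ContinuousOn A Ω) (hΩ : IsOpen Ω) (hw : IsRCBV w)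
    (hmem : ∀ x, w x ∈ Ω) (μ : Measure ℝ) : AEStronglyMeasurable (fun x ↦ A (w x)) μ := by
  classical
  -- `A` is continuous on `Ω` only. Its extension by zero is Borel, and `w` never leaves `Ω`.
  have h1 : Measurable (Ω.piecewise A fun _ ↦ 0) :=
    hA.measurable_piecewise continuousOn_const hΩ.measurableSet
  have h2 : (fun x ↦ A (w x)) = (Ω.piecewise A fun _ ↦ 0) ∘ w := by
    ext1 x
    simp [hmem x]
  rw [h2]
  exact (h1.comp hw.measurable).aestronglyMeasurable

lemma integrable_density (hD : IsRegularData Ω A Φ) (hc : PathBound Ω A Φ R c)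
    (hw : IsAdmissible Ω R w) (μ : Measure ℝ) [IsFiniteMeasure μ] :
    Integrable (fun x ↦ A (w x)) μ :=
  Integrable.of_bound (aestronglyMeasurable_comp hD.continuousOn hD.isOpen hw.toIsRCBV hw.mem _) c
    (Eventually.of_forall fun x ↦ hc.norm_le _ (hw.mem x) (hw.norm_le x))

lemma nonconsProduct_apply (hD : IsRegularData Ω A Φ) (hc : PathBound Ω A Φ R c)
    (hw : IsAdmissible Ω R w) {B : Set ℝ} (hB : MeasurableSet B) : nonconsProduct A Φ w B =
    ((hw.bv.vectorMeasure.restrict (jumpSet w)ᶜ).restrict B).integral (fun x ↦ A (w x))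
        (ContinuousLinearMap.id ℝ (Phase N →L[ℝ] Phase N))
      + ∫ x in B ∩ jumpSet w, pathIntegral A Φ (w.leftLim x) (w x) ∂Measure.count := by
  have hi : IntegrableOn (fun x ↦ pathIntegral A Φ (w.leftLim x) (w x)) (jumpSet w)
      Measure.count := hw.integrableOn_count le_rfl fun x _ ↦
    hc.norm_pathIntegral_le _ (hw.leftLim_mem x) (hw.norm_leftLim_le x) _ (hw.mem x) (hw.norm_le x)
  have hf : IsFiniteMeasure hw.bv.vectorMeasure.variation :=
    isFiniteMeasure_of_le _ hw.variation_vectorMeasure_le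
  have hf' : IsFiniteMeasure (hw.bv.vectorMeasure.restrict (jumpSet w)ᶜ).variation := by
    rw [VectorMeasure.variation_restrict hw.countable_jumpSet.measurableSet.compl]
    infer_instance
  rw [nonconsProduct_eq hw.toIsRCBV, _root_.add_apply, VectorMeasure.withDensity_apply
    (integrable_density hD hc hw _), withDensityᵥ_apply hi hB, Measure.restrict_restrict hB]

/-- On a set where `A(w)` is close to `T`, the nonconservative product is close to `T dw/dx`. -/
lemma enorm_nonconsProduct_sub_le (hD : IsRegularData Ω A Φ) (hc : PathBound Ω A Φ R c)
    (hw : IsAdmissible Ω R w) {B : Set ℝ} (hB : MeasurableSet B) (T : Phase N →L[ℝ] Phase N)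
    {ε : ℝ≥0} (h₁ : ∀ x ∈ B, ‖A (w x) - T‖ ≤ ε)
    (h₂ : ∀ x ∈ B, ‖pathIntegral A Φ (w.leftLim x) (w x) - T (w x - w.leftLim x)‖ ≤
      ε * ‖w x - w.leftLim x‖) :
    ‖nonconsProduct A Φ w B - T (hw.bv.vectorMeasure B)‖ₑ ≤ ε * hw.varStieltjes.measure B := by
  set J := jumpSet w
  have hJ : MeasurableSet J := hw.countable_jumpSet.measurableSet
  set D := hw.bv.vectorMeasure
  set μ := hw.varStieltjes.measure
  set D' := (D.restrict Jᶜ).restrict B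
  have hDvar : D'.variation ≤ μ.restrict (B ∩ Jᶜ) := by
    simp only [D']
    rw [VectorMeasure.variation_restrict hB, VectorMeasure.variation_restrict hJ.compl,
      Measure.restrict_restrict hB]
    exact Measure.restrict_mono le_rfl hw.variation_vectorMeasure_le
  have hf : IsFiniteMeasure D'.variation := isFiniteMeasure_of_le _ hDvar
  have hsplit : D B = D (B ∩ Jᶜ) + D (B ∩ J) := by
    rw [← VectorMeasure.of_union (by
      exact disjoint_compl_left.mono inter_subset_right inter_subset_right)
      (hB.inter hJ.compl) (hB.inter hJ), ← inter_union_distrib_left, compl_union_self, inter_univ]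
  have hP : ∀ x, ‖pathIntegral A Φ (w.leftLim x) (w x)‖ ≤ c * ‖w x - w.leftLim x‖ := fun x ↦
    hc.norm_pathIntegral_le _ (hw.leftLim_mem x) (hw.norm_leftLim_le x) _ (hw.mem x) (hw.norm_le x)
  have hi1 : IntegrableOn (fun x ↦ pathIntegral A Φ (w.leftLim x) (w x)) (B ∩ J) Measure.count :=
    hw.integrableOn_count inter_subset_right fun x _ ↦ hP x
  have hi2 : IntegrableOn (fun x ↦ w x - w.leftLim x) (B ∩ J) Measure.count :=
    hw.integrableOn_count inter_subset_right (c := 1) fun x _ ↦ by simp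
  have e1 : T (D (B ∩ Jᶜ)) = D'.integral (fun _ ↦ T)
      (ContinuousLinearMap.id ℝ (Phase N →L[ℝ] Phase N)) := by
    rw [VectorMeasure.integral_const]
    simp only [D']
    rw [VectorMeasure.restrict_apply _ hB MeasurableSet.univ, univ_inter,
      VectorMeasure.restrict_apply _ hJ.compl hB]
    rfl
  have e2 : T (D (B ∩ J)) = ∫ x in B ∩ J, T (w x - w.leftLim x) ∂Measure.count := by
    rw [hw.vectorMeasure_of_subset_jumpSet inter_subset_right]
    exact (T.integral_comp_comm hi2).symm
  -- The derivative splits into its part off the jump set and its atoms. On the former the error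
  -- density is `A (w x) - T`; at an atom the error is that of the path integral. Both are at most
  -- `ε` times the corresponding mass of the variation measure.
  have hdiff : nonconsProduct A Φ w B - T (D B) =
      D'.integral (fun x ↦ A (w x) - T) (ContinuousLinearMap.id ℝ (Phase N →L[ℝ] Phase N)) +
      ∫ x in B ∩ J, (pathIntegral A Φ (w.leftLim x) (w x) - T (w x - w.leftLim x))
        ∂Measure.count := by
    rw [nonconsProduct_apply hD hc hw hB, hsplit, map_add, e1, e2,
      VectorMeasure.integral_fun_sub (integrable_density hD hc hw _) (integrable_const T),
      integral_sub hi1 (T.integrable_comp hi2)]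
    abel
  rw [hdiff]
  have b1 : ‖D'.integral (fun x ↦ A (w x) - T)
      (ContinuousLinearMap.id ℝ (Phase N →L[ℝ] Phase N))‖ₑ ≤ ε * μ (B ∩ Jᶜ) := by
    refine VectorMeasure.enorm_integral_le_lintegral_enorm.trans ?_
    have hid : ‖ContinuousLinearMap.id ℝ (Phase N →L[ℝ] Phase N)‖ₑ ≤ 1 := by
      rw [enorm_eq_nnnorm]
      exact_mod_cast ContinuousLinearMap.norm_id_le
    calc _ ≤ 1 * ∫⁻ x, ‖A (w x) - T‖ₑ ∂μ.restrict (B ∩ Jᶜ) :=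
          mul_le_mul' hid (lintegral_mono' hDvar le_rfl)
      _ ≤ ∫⁻ x in B ∩ Jᶜ, ε ∂μ := by
          rw [one_mul]
          refine setLIntegral_mono' (hB.inter hJ.compl) fun x hx ↦ ?_
          rw [enorm_eq_nnnorm]
          exact_mod_cast h₁ x hx.1
      _ = ε * μ (B ∩ Jᶜ) := setLIntegral_const _ _
  have b2 : ‖∫ x in B ∩ J, (pathIntegral A Φ (w.leftLim x) (w x) - T (w x - w.leftLim x))
      ∂Measure.count‖ₑ ≤ ε * μ (B ∩ J) :=
    (enorm_integral_le_lintegral_enorm _).trans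
      (hw.lintegral_count_le inter_subset_right fun x hx ↦ h₂ x hx.1)
  refine (enorm_add_le _ _).trans ((add_le_add b1 b2).trans (le_of_eq ?_))
  rw [← mul_add, add_comm, ← sdiff_eq, measure_inter_add_sdiff₀ B hJ.nullMeasurableSet]

/-- This is the comparison estimate with `T = 0`, for which both smallness conditions are the bounds
provided by `PathBound`. -/
lemma enorm_nonconsProduct_le (hD : IsRegularData Ω A Φ) (hc : PathBound Ω A Φ R c)
    (hw : IsAdmissible Ω R w) {B : Set ℝ} (hB : MeasurableSet B) :
    ‖nonconsProduct A Φ w B‖ₑ ≤ c * hw.varStieltjes.measure B := by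
  have := enorm_nonconsProduct_sub_le hD hc hw hB 0 (ε := c)
    (fun x _ ↦ by rw [sub_zero]; exact hc.norm_le _ (hw.mem x) (hw.norm_le x))
    (fun x _ ↦ by
      rw [_root_.zero_apply, sub_zero]
      exact hc.norm_pathIntegral_le _ (hw.leftLim_mem x) (hw.norm_leftLim_le x) _ (hw.mem x)
        (hw.norm_le x))
  simpa using this

lemma variation_nonconsProduct_le (hD : IsRegularData Ω A Φ) (hc : PathBound Ω A Φ R c)
    (hw : IsAdmissible Ω R w) :
    (nonconsProduct A Φ w).variation ≤ c • hw.varStieltjes.measure :=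
  VectorMeasure.variation_le_of_forall_enorm_le fun _ hE ↦ by
    rw [Measure.smul_apply]
    exact enorm_nonconsProduct_le hD hc hw hE

lemma IsRCBV.measure_Ioc_le (hw : IsRCBV w) {x y : ℝ} (hxy : x ≤ y) :
    hw.varStieltjes.measure (Ioc x y) ≤ ENNReal.ofReal (graphLength w y - graphLength w x) := by
  rw [hw.varStieltjes.measure_Ioc, hw.varStieltjes_apply, hw.varStieltjes_apply]
  exact ENNReal.ofReal_le_ofReal (by linarith)

lemma norm_nonconsProduct_Ioc_le (hD : IsRegularData Ω A Φ) (hc : PathBound Ω A Φ R c)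
    (hw : IsAdmissible Ω R w) {x y : ℝ} (hxy : x ≤ y) :
    ‖nonconsProduct A Φ w (Ioc x y)‖ ≤ c * (graphLength w y - graphLength w x) := by
  have h0 : 0 ≤ graphLength w y - graphLength w x :=
    sub_nonneg.2 (hw.strictMono_graphLength.monotone hxy)
  have h := (enorm_nonconsProduct_le hD hc hw measurableSet_Ioc).trans
    (mul_le_mul_right (hw.measure_Ioc_le hxy) (c : ℝ≥0∞))
  have h2 := ENNReal.toReal_mono (by finiteness) h
  rwa [toReal_enorm, ENNReal.toReal_mul, ENNReal.toReal_ofReal h0] at h2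

lemma nonconsProduct_singleton (hD : IsRegularData Ω A Φ) (hc : PathBound Ω A Φ R c)
    (hw : IsAdmissible Ω R w) {x : ℝ} (hx : w.leftLim x ≠ w x) :
    nonconsProduct A Φ w {x} = pathIntegral A Φ (w.leftLim x) (w x) := by
  have hxJ : x ∈ jumpSet w := hw.mem_jumpSet.2 hx
  have hJ : MeasurableSet (jumpSet w) := hw.countable_jumpSet.measurableSet
  have h0 : (hw.bv.vectorMeasure.restrict (jumpSet w)ᶜ).restrict {x} = 0 := by
    rw [VectorMeasure.restrict_restrict _ (measurableSet_singleton x) hJ.compl]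
    have : {x} ∩ (jumpSet w)ᶜ = ∅ := by
      rw [singleton_inter_eq_empty, mem_compl_iff, not_not]; exact hxJ
    rw [this, VectorMeasure.restrict_empty]
  rw [nonconsProduct_apply hD hc hw (measurableSet_singleton x), h0,
    VectorMeasure.integral_zero_vectorMeasure, zero_add, inter_eq_left.2 (singleton_subset_iff.2 hxJ),
    integral_singleton, measureReal_def, Measure.count_singleton, ENNReal.toReal_one, one_smul]

/-- The nonconservative product of an interval is the limit of the sums of the integrals along the
paths that join the values of `w` at the points of uniform grids. -/
lemma tendsto_sum_nonconsProduct (hD : IsRegularData Ω A Φ) (hw : IsAdmissible Ω R w)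
    (hab : a ≤ b) :
    Tendsto (fun n : ℕ ↦ ∑ j ∈ Finset.range (n + 1),
      pathIntegral A Φ (w (grid a b n j)) (w (grid a b n (j + 1)))) atTop
      (𝓝 (nonconsProduct A Φ w (Ioc a b))) := by
  obtain ⟨c, hc⟩ := hD.bound R
  refine tendsto_sum_pathIntegral hD hw.toIsRCBV hab (fun x _ ↦ ⟨hw.leftLim_mem x, hw.mem x⟩)
    (fun x _ ↦ hw.norm_le x) (fun x y ↦ nonconsProduct A Φ w (Ioc x y)) (C := c) ?_ ?_ ?_ ?_
  · intro x _ y _ z _ hxy hyz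
    rw [← VectorMeasure.of_union (Ioc_disjoint_Ioc_of_le le_rfl) measurableSet_Ioc
      measurableSet_Ioc, Ioc_union_Ioc_eq_Ioc hxy hyz]
  · intro x _ y _ hxy
    exact norm_nonconsProduct_Ioc_le hD hc hw hxy
  · intro x₀ _ heq ε hε
    have hAe : ContinuousAt A (w x₀) :=
      hD.continuousOn.continuousAt (hD.isOpen.mem_nhds (hw.mem x₀))
    obtain ⟨η₁, hη₁, h₁⟩ := Metric.continuousAt_iff.1 hAe ε hε
    obtain ⟨η₂, hη₂, -, h₂⟩ := exists_pathIntegral_sub_le hD.isOpen hD.continuousOn hD.path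
        (hw.mem x₀) hε
    -- Left limits near `x₀` satisfy only a non-strict inequality; halving the radius restores the
    -- strict one required by the open balls.
    have hη : 0 < min η₁ η₂ / 2 := by positivity
    obtain ⟨δ, hδ, h₃⟩ := hw.exists_close heq hη
    have hlt : min η₁ η₂ / 2 < min η₁ η₂ := half_lt_self (lt_min hη₁ hη₂)
    refine ⟨δ, hδ, fun x _ y _ hx1 hx2 hy1 hy2 ↦ ?_⟩
    have hxy := hx2.le.trans hy1
    have h := enorm_nonconsProduct_sub_le hD hc hw (measurableSet_Ioc (a := x) (b := y)) (A (w x₀))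
      (ε := ⟨ε, hε.le⟩) ?_ ?_
    · rw [hw.vectorMeasure_Ioc hxy] at h
      have h0 : 0 ≤ graphLength w y - graphLength w x :=
        sub_nonneg.2 (hw.strictMono_graphLength.monotone hxy)
      have h4 := h.trans (mul_le_mul_right (hw.measure_Ioc_le hxy) _)
      have h5 := ENNReal.toReal_mono (by finiteness) h4
      rwa [toReal_enorm, ENNReal.toReal_mul, ENNReal.toReal_ofReal h0] at h5
    · intro z hz
      rw [← dist_eq_norm]
      refine (h₁ ?_).le
      rw [dist_eq_norm]
      exact (h₃ z (by linarith [hz.1]) (by linarith [hz.2])).1.trans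
        (hlt.trans_le (min_le_left _ _))
    · intro z hz
      have h4 := h₃ z (by linarith [hz.1]) (by linarith [hz.2])
      refine h₂ _ ?_ _ ?_
      · rw [mem_ball_iff_norm]
        exact h4.2.trans_lt (hlt.trans_le (min_le_right _ _))
      · rw [mem_ball_iff_norm]
        exact h4.1.trans (hlt.trans_le (min_le_right _ _))
  · intro x₀ _ hne ε hε
    set μ := hw.varStieltjes.measure
    have hc0 : 0 < ε / (c + 1) := by positivity
    set l := (graphLength w).leftLim x₀
    set r := graphLength w x₀
    -- Close to `x₀` the graph length varies by less than `η` on each side of the jump, so each side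
    -- has product at most `c * η`, hence at most `ε / 2`.
    set η := ε / (2 * (c + 1)) with hη
    have hη0 : 0 < η := by positivity
    obtain ⟨u, hu, hu'⟩ := (mem_nhdsLT_iff_exists_Ioo_subset' (sub_one_lt x₀)).1
        (hw.tendsto_graphLength_left x₀ (Ioi_mem_nhds (show l - η < l by linarith)))
    obtain ⟨v, hv, hv'⟩ := (mem_nhdsGE_iff_exists_Ico_subset' (lt_add_one x₀)).1
        (hw.tendsto_graphLength_right x₀ (Iio_mem_nhds (show r < r + η by linarith)))
    have hu0 : 0 < x₀ - u := sub_pos.2 hu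
    have hv0 : 0 < v - x₀ := sub_pos.2 hv
    refine ⟨min (x₀ - u) (v - x₀), by positivity, fun x _ y _ hx1 hx2 hy1 hy2 ↦ ?_⟩
    have m1 := min_le_left (x₀ - u) (v - x₀)
    have m2 := min_le_right (x₀ - u) (v - x₀)
    have e1 : l - η < graphLength w x := hu' ⟨by linarith, hx2⟩
    have e2 : graphLength w y < r + η := hv' ⟨hy1, by linarith⟩
    -- The atom at `x₀` carries exactly the path integral; the two remaining intervals are the
    -- error.
    have hsplit : Ioc x y = Ioo x x₀ ∪ ({x₀} ∪ Ioc x₀ y) := by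
      ext z
      simp only [mem_Ioc, mem_union, mem_Ioo, mem_singleton_iff]
      grind
    have hleft : ‖nonconsProduct A Φ w (Ioo x x₀)‖ ≤ c * η := by
      have h1 : μ (Ioo x x₀) ≤ ENNReal.ofReal η := by
        rw [hw.varStieltjes.measure_Ioo]
        refine ENNReal.ofReal_le_ofReal ?_
        have h3 : Function.leftLim hw.varStieltjes x₀ ≤ l - x₀ := by
          refine le_of_tendsto_of_tendsto (hw.varStieltjes.mono.tendsto_leftLim x₀)
            ((hw.tendsto_graphLength_left x₀).sub
              (tendsto_nhdsWithin_of_tendsto_nhds tendsto_id)) (Eventually.of_forall fun z ↦ le_rfl)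
        rw [hw.varStieltjes_apply]
        linarith
      have h2 := (enorm_nonconsProduct_le hD hc hw measurableSet_Ioo).trans
        (mul_le_mul_right h1 (c : ℝ≥0∞))
      have h3 := ENNReal.toReal_mono (by finiteness) h2
      rwa [toReal_enorm, ENNReal.toReal_mul, ENNReal.toReal_ofReal hη0.le] at h3
    have hright := norm_nonconsProduct_Ioc_le hD hc hw hy1
    have heta : c * η ≤ ε / 2 := by
      rw [hη]
      rw [mul_div_assoc', div_le_div_iff₀ (by positivity) (by positivity)]
      nlinarith [c.coe_nonneg]
    have hright' : c * (graphLength w y - graphLength w x₀) ≤ c * η := by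
      gcongr
      linarith
    rw [hsplit, VectorMeasure.of_union ?_ measurableSet_Ioo
      ((measurableSet_singleton x₀).union measurableSet_Ioc),
      VectorMeasure.of_union (by simp) (measurableSet_singleton x₀) measurableSet_Ioc,
      nonconsProduct_singleton hD hc hw hne]
    · calc _ = ‖nonconsProduct A Φ w (Ioo x x₀) + nonconsProduct A Φ w (Ioc x₀ y)‖ := by
            congr 1; abel
        _ ≤ ε / 2 + ε / 2 := (norm_add_le _ _).trans
            (add_le_add (hleft.trans heta) (hright.trans (hright'.trans heta)))
        _ = ε := by ring
    · rw [disjoint_left]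
      rintro z hz (hz' | hz')
      · exact absurd hz.2 (by rw [mem_singleton_iff.1 hz']; exact lt_irrefl _)
      · exact absurd hz.2 (not_lt.2 hz'.1.le)

/-- The nonconservative product is the image of the integral of `A` along the graph completion. -/
lemma nonconsProduct_Ioc_eq_curveIntegral (hD : IsRegularData Ω A Φ) (hw : IsAdmissible Ω R w)
    (h : HasSpeedOn Ω Φ w K k a b) (hK : IsCompact K) (hab : a ≤ b) :
    nonconsProduct A Φ w (Ioc a b) = curveIntegral A Φ w a b :=
  tendsto_nhds_unique (tendsto_sum_nonconsProduct hD hw hab)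
    (tendsto_sum_curveIntegral hD hw.toIsRCBV h hK hab)

end Product

/-! ### Step functions and integrals against vector measures -/

section StepFunction

variable {φ : ℝ → ℝ} {a b ε : ℝ} {n : ℕ}

/-- The step function that equals `φ` at the left end points of the cells of a uniform grid. -/
def stepFun (φ : ℝ → ℝ) (a b : ℝ) (n : ℕ) (x : ℝ) : ℝ :=
  ∑ j ∈ Finset.range (n + 1),
    (Ioc (grid a b n j) (grid a b n (j + 1))).indicator (fun _ ↦ φ (grid a b n j)) x

lemma stepFun_of_mem (hab : a ≤ b) {j : ℕ} (hj : j < n + 1) {x : ℝ}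
    (hx : x ∈ Ioc (grid a b n j) (grid a b n (j + 1))) : stepFun φ a b n x = φ (grid a b n j) := by
  rw [stepFun, Finset.sum_eq_single_of_mem j (Finset.mem_range.2 hj), indicator_of_mem hx]
  intro i _ hij
  refine indicator_of_notMem (fun hi ↦ ?_) _
  rcases lt_or_gt_of_ne hij with h | h
  · exact absurd (hi.2.trans (monotone_grid hab n h)) (not_le.2 hx.1)
  · exact absurd (hx.2.trans (monotone_grid hab n h)) (not_le.2 hi.1)

lemma stepFun_of_notMem (hab : a ≤ b) {x : ℝ} (hx : x ∉ Ioc a b) : stepFun φ a b n x = 0 := by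
  refine Finset.sum_eq_zero fun j hj ↦ indicator_of_notMem (fun h ↦ hx ⟨?_, ?_⟩) _
  · exact (grid_mem_Icc hab (Finset.mem_range.1 hj).le).1.trans_lt h.1
  · exact h.2.trans (grid_mem_Icc hab (Finset.mem_range.1 hj)).2

lemma abs_sub_stepFun_le (hab : a ≤ b) (hε : 0 ≤ ε) (h0 : ∀ x ∉ Ioc a b, φ x = 0)
    (h : ∀ x y, |x - y| ≤ (b - a) / (n + 1) → |φ x - φ y| ≤ ε) (x : ℝ) :
    |φ x - stepFun φ a b n x| ≤ ε := by
  by_cases hx : x ∈ Ioc a b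
  · obtain ⟨j, hj, hxj⟩ := exists_mem_Ioc_grid n hx
    rw [stepFun_of_mem hab hj hxj]
    refine h _ _ ?_
    rw [← grid_succ_sub a b n j, abs_of_nonneg (by linarith [hxj.1])]
    linarith [hxj.2]
  · rw [h0 x hx, stepFun_of_notMem hab hx, sub_zero, abs_zero]
    exact hε

lemma measurable_stepFun : Measurable (stepFun φ a b n) :=
  Finset.measurable_sum _ fun _ _ ↦ measurable_const.indicator measurableSet_Ioc

/-- Uniformly continuous functions are uniform limits of step functions. -/
lemma exists_forall_abs_sub_stepFun_le (hφ : UniformContinuous φ) (hab : a ≤ b) (hε : 0 < ε)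
    (h0 : ∀ x ∉ Ioc a b, φ x = 0) : ∀ᶠ n : ℕ in atTop, ∀ x, |φ x - stepFun φ a b n x| ≤ ε := by
  obtain ⟨δ, hδ, h⟩ := Metric.uniformContinuous_iff.1 hφ ε hε
  have hlim : Tendsto (fun n : ℕ ↦ (b - a) / ((n : ℝ) + 1)) atTop (𝓝 0) := by
    have := (tendsto_one_div_add_atTop_nhds_zero_nat (𝕜 := ℝ)).const_mul (b - a)
    simpa only [mul_one_div, mul_zero] using this
  filter_upwards [hlim (Iio_mem_nhds hδ)] with n hn x
  refine abs_sub_stepFun_le hab hε.le h0 (fun x y hxy ↦ ?_) x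
  exact (h (hxy.trans_lt hn)).le

end StepFunction

/-- The integral of a real function against a vector measure. -/
abbrev pairing (m : VectorMeasure ℝ (Phase N)) (φ : ℝ → ℝ) : Phase N :=
  m.integral φ (ContinuousLinearMap.lsmul ℝ ℝ)

section Pairing

variable {m : VectorMeasure ℝ (Phase N)} {φ : ℝ → ℝ} {a b ε : ℝ} {n : ℕ}

lemma norm_lsmul_le : ‖(ContinuousLinearMap.lsmul ℝ ℝ : ℝ →L[ℝ] Phase N →L[ℝ] Phase N)‖ ≤ 1 :=
  ContinuousLinearMap.opNorm_lsmul_le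

lemma norm_pairing_le [IsFiniteMeasure m.variation] (hε : 0 ≤ ε) (h : ∀ x, |φ x| ≤ ε) :
    ‖pairing m φ‖ ≤ ε * m.variation.real univ := by
  refine (VectorMeasure.norm_integral_le_of_norm_le_const (C := ε)
    (Eventually.of_forall h)).trans ?_
  gcongr
  exact mul_le_of_le_one_right hε norm_lsmul_le

lemma pairing_stepFun [IsFiniteMeasure m.variation] :
    pairing m (stepFun φ a b n) = ∑ j ∈ Finset.range (n + 1),
      φ (grid a b n j) • m (Ioc (grid a b n j) (grid a b n (j + 1))) := by
  have h : stepFun φ a b n = fun x ↦ ∑ j ∈ Finset.range (n + 1),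
    (Ioc (grid a b n j) (grid a b n (j + 1))).indicator (fun _ ↦ φ (grid a b n j)) x := rfl
  rw [pairing, h, VectorMeasure.integral_finsetSum _ fun j _ ↦
    (integrable_const _).indicator measurableSet_Ioc]
  refine Finset.sum_congr rfl fun j _ ↦ ?_
  rw [VectorMeasure.integral_indicator_const _ measurableSet_Ioc]
  rfl

lemma integrable_variation [IsFiniteMeasure m.variation] (hm : Measurable φ)
    (h : ∀ x, |φ x| ≤ ε) : Integrable φ m.variation :=
  Integrable.of_bound hm.aestronglyMeasurable ε (Eventually.of_forall h)

/-- Error estimate for the approximation of integrals by sums over a grid. -/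
lemma norm_pairing_sub_sum_le [IsFiniteMeasure m.variation] (hφ : Measurable φ) {C : ℝ}
    (hC : ∀ x, |φ x| ≤ C) (hε : 0 ≤ ε) (h : ∀ x, |φ x - stepFun φ a b n x| ≤ ε) :
    ‖pairing m φ - ∑ j ∈ Finset.range (n + 1),
      φ (grid a b n j) • m (Ioc (grid a b n j) (grid a b n (j + 1)))‖ ≤
      ε * m.variation.real univ := by
  have hs : ∀ x, |stepFun φ a b n x| ≤ C + ε := fun x ↦ by
    have h1 := abs_sub_abs_le_abs_sub (stepFun φ a b n x) (φ x)
    rw [abs_sub_comm] at h1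
    linarith [h x, hC x]
  rw [← pairing_stepFun, pairing, pairing, ← VectorMeasure.integral_fun_sub
    (integrable_variation hφ hC) (integrable_variation measurable_stepFun hs)]
  exact norm_pairing_le hε h

lemma tendsto_sum_pairing [IsFiniteMeasure m.variation] (hφ : Continuous φ)
    (hab : a ≤ b) (h0 : ∀ x ∉ Ioc a b, φ x = 0) :
    Tendsto (fun n : ℕ ↦ ∑ j ∈ Finset.range (n + 1),
      φ (grid a b n j) • m (Ioc (grid a b n j) (grid a b n (j + 1)))) atTop
      (𝓝 (pairing m φ)) := by
  have hc : HasCompactSupport φ := HasCompactSupport.intro isCompact_Icc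
    fun x hx ↦ h0 x fun h ↦ hx (Ioc_subset_Icc_self h)
  obtain ⟨C, hC⟩ := hc.exists_bound_of_continuous hφ
  rw [Metric.tendsto_atTop']
  intro ε hε
  have hV : 0 ≤ m.variation.real univ := measureReal_nonneg
  have hε' : 0 < ε / (m.variation.real univ + 1) := by positivity
  obtain ⟨n₀, hn₀⟩ := eventually_atTop.1 (exists_forall_abs_sub_stepFun_le
    (hc.uniformContinuous_of_continuous hφ) hab hε' h0)
  refine ⟨n₀, fun n hn ↦ ?_⟩
  rw [dist_comm, dist_eq_norm]
  refine (norm_pairing_sub_sum_le hφ.measurable hC hε'.le (hn₀ n hn.le)).trans_lt ?_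
  rw [div_mul_eq_mul_div, div_lt_iff₀ (by positivity)]
  nlinarith

end Pairing

/-! ### Smooth approximations of intervals -/

section Bump

variable {a b : ℝ}

/-- A smooth bump function supported in `[a, b]`; these functions increase to the indicator function
of `(a, b)`. -/
def intervalBump (hab : a < b) (n : ℕ) : ContDiffBump ((a + b) / 2) where
  -- The shift by 2 keeps the inner radius positive for `n = 0`.
  rIn := (b - a) / 2 * (1 - 1 / ((n : ℝ) + 2))
  rOut := (b - a) / 2
  rIn_pos := by
    have h1 : 0 < (b - a) / 2 := by linarith
    have h2 : 1 / ((n : ℝ) + 2) < 1 := by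
      rw [div_lt_one (by positivity)]
      linarith [(Nat.cast_nonneg n : (0 : ℝ) ≤ n)]
    exact mul_pos h1 (by linarith)
  rIn_lt_rOut := by
    have h1 : 0 < (b - a) / 2 := by linarith
    have h2 : 0 < 1 / ((n : ℝ) + 2) := by positivity
    nlinarith

lemma abs_intervalBump_le (hab : a < b) (n : ℕ) (x : ℝ) : |intervalBump hab n x| ≤ 1 := by
  rw [abs_of_nonneg (intervalBump hab n).nonneg]
  exact (intervalBump hab n).le_one

lemma tendsto_intervalBump (hab : a < b) (x : ℝ) :
    Tendsto (fun n ↦ intervalBump hab n x) atTop (𝓝 ((Ioo a b).indicator (fun _ ↦ 1) x)) := by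
  have hr : 0 < (b - a) / 2 := by linarith
  have hball : Metric.ball ((a + b) / 2) ((b - a) / 2) = Ioo a b := by
    rw [Real.ball_eq_Ioo]
    congr 1 <;> ring
  by_cases hx : x ∈ Ioo a b
  · rw [indicator_of_mem hx]
    rw [← hball, Metric.mem_ball] at hx
    have hlim : Tendsto (fun n : ℕ ↦ (b - a) / 2 * (1 - 1 / ((n : ℝ) + 2))) atTop
        (𝓝 ((b - a) / 2 * (1 - 0))) := by
      refine (Tendsto.sub tendsto_const_nhds ?_).const_mul _
      refine tendsto_const_nhds.div_atTop ?_
      exact tendsto_natCast_atTop_atTop.atTop_add tendsto_const_nhds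
    rw [sub_zero, mul_one] at hlim
    refine tendsto_const_nhds.congr' ?_
    filter_upwards [hlim (Ioi_mem_nhds hx)] with n hn
    exact ((intervalBump hab n).one_of_mem_closedBall (Metric.mem_closedBall.2 hn.le)).symm
  · rw [indicator_of_notMem hx]
    refine tendsto_const_nhds.congr fun n ↦ ?_
    rw [← hball, Metric.mem_ball, not_lt] at hx
    exact ((intervalBump hab n).zero_of_le_dist hx).symm

/-- Dominated convergence recovers the mass of an open interval from smooth test functions. It is
used for measurability in time and for the vanishing of families. -/
lemma tendsto_pairing_intervalBump {m : VectorMeasure ℝ (Phase N)} [IsFiniteMeasure m.variation]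
    (hab : a < b) : Tendsto (fun n ↦ pairing m (intervalBump hab n)) atTop (𝓝 (m (Ioo a b))) := by
  have h := VectorMeasure.tendsto_integral_of_dominated_convergence (μ := m)
    (B := ContinuousLinearMap.lsmul ℝ ℝ) (fun _ ↦ 1)
    (fun n ↦ (intervalBump hab n).continuous.aestronglyMeasurable) (integrable_const 1)
    (fun n ↦ Eventually.of_forall fun x ↦ abs_intervalBump_le hab n x)
    (Eventually.of_forall fun x ↦ tendsto_intervalBump hab x)
  rw [VectorMeasure.integral_indicator_const _ measurableSet_Ioo] at h
  simpa using h

end Bump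

/-! ### Families of measures -/

section Family

variable {ν : Measure ℝ} {m m' : ℝ → VectorMeasure ℝ (Phase N)}

/-- The mass of the line is a limit of masses of intervals with rational end points; the end points
are cast through `ℚ` to match hypotheses on rational intervals. -/
lemma tendsto_vectorMeasure_Ioo (m : VectorMeasure ℝ (Phase N)) :
    Tendsto (fun n : ℕ ↦ m (Ioo (((-(n : ℤ) - 1 : ℤ) : ℚ) : ℝ) (((n : ℤ) + 1 : ℤ) : ℚ))) atTop
      (𝓝 (m univ)) := by
  have h := m.tendsto_vectorMeasure_iUnion_atTop_nat
    (s := fun n : ℕ ↦ Ioo (((-(n : ℤ) - 1 : ℤ) : ℚ) : ℝ) (((n : ℤ) + 1 : ℤ) : ℚ)) ?_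
    fun _ ↦ measurableSet_Ioo
  · convert! h using 3
    symm
    rw [eq_univ_iff_forall]
    intro x
    obtain ⟨n, hn⟩ := exists_nat_gt |x|
    rw [abs_lt] at hn
    refine mem_iUnion.2 ⟨n, ?_, ?_⟩ <;> push_cast <;> linarith [hn.1, hn.2]
  · intro n k hnk
    have : (n : ℝ) ≤ k := by exact_mod_cast hnk
    refine Ioo_subset_Ioo ?_ ?_ <;> push_cast <;> linarith

lemma vectorMeasure_eq_zero_of_Ioo {m : VectorMeasure ℝ (Phase N)}
    (h : ∀ a b : ℚ, a < b → m (Ioo (a : ℝ) b) = 0) : m = 0 := by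
  refine VectorMeasure.ext_of_generateFrom _ ?_
    ((BorelSpace.measurable_eq (α := ℝ)).trans Real.borel_eq_generateFrom_Ioo_rat)
    Real.isPiSystem_Ioo_rat ?_
  · intro s hs
    simp only [mem_iUnion, mem_singleton_iff] at hs
    obtain ⟨a, b, hab, rfl⟩ := hs
    exact h a b hab
  · refine tendsto_nhds_unique (tendsto_vectorMeasure_Ioo m) (tendsto_const_nhds.congr fun n ↦ ?_)
    rw [h]
    · rfl
    · exact_mod_cast (by omega : -(n : ℤ) - 1 < n + 1)

/-- A family of vector measures is weakly measurable if its values on intervals are measurable. -/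
lemma aestronglyMeasurable_of_Ioo
    (h : ∀ a b : ℚ, a < b → AEStronglyMeasurable (fun t ↦ m t (Ioo (a : ℝ) b)) ν) {B : Set ℝ}
    (hB : MeasurableSet B) : AEStronglyMeasurable (fun t ↦ m t B) ν := by
  -- The complement step of the π-λ induction subtracts from the mass of the whole line.
  have huniv : AEStronglyMeasurable (fun t ↦ m t univ) ν :=
    aestronglyMeasurable_of_tendsto_ae atTop (fun n : ℕ ↦ h (-(n : ℤ) - 1 : ℤ) ((n : ℤ) + 1 : ℤ)
      (by exact_mod_cast (by omega : -(n : ℤ) - 1 < n + 1)))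
      (Eventually.of_forall fun t ↦ tendsto_vectorMeasure_Ioo (m t))
  induction B, hB using MeasurableSpace.induction_on_inter
    ((BorelSpace.measurable_eq (α := ℝ)).trans Real.borel_eq_generateFrom_Ioo_rat)
    Real.isPiSystem_Ioo_rat with
  | empty => simpa using aestronglyMeasurable_const
  | basic s hs =>
    simp only [mem_iUnion, mem_singleton_iff] at hs
    obtain ⟨a, b, hab, rfl⟩ := hs
    exact h a b hab
  | compl s hs ih =>
    simp only [VectorMeasure.of_compl hs]
    exact huniv.sub ih
  | iUnion f hd hf ih =>
    refine aestronglyMeasurable_of_tendsto_ae atTop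
      (fun n ↦ Finset.aestronglyMeasurable_fun_sum (Finset.range n) fun i _ ↦ ih i)
      (Eventually.of_forall fun t ↦ ?_)
    exact ((m t).m_iUnion hf hd).tendsto_sum_nat

end Family

/-! ### Test functions and families of measures -/

/-- Continuous functions of `(t, x)` with support in `(0, T] × [-R, R]`, bounded by `C` and Lipschitz
continuous with constant `L` in each variable. -/
structure IsTestData (φ : ℝ → ℝ → ℝ) (T R C L : ℝ) : Prop where
  zero_of_nonpos : ∀ t ≤ 0, ∀ x, φ t x = 0
  zero_of_lt : ∀ t, T < t → ∀ x, φ t x = 0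
  zero_of_abs : ∀ t x, R < |x| → φ t x = 0
  bound : ∀ t x, |φ t x| ≤ C
  lipschitz_time : ∀ t s x, |φ t x - φ s x| ≤ L * |t - s|
  lipschitz_space : ∀ t x y, |φ t x - φ t y| ≤ L * |x - y|
  pos : 0 < T ∧ 0 < R ∧ 0 ≤ C ∧ 0 ≤ L

section TestFunction

variable {φ : ℝ → ℝ → ℝ} {T R C L : ℝ}

lemma IsTestFunction.hasDerivAt (hφ : IsTestFunction φ) (t x : ℝ) :
    HasDerivAt (fun r ↦ φ r x) (deriv (fun r ↦ φ r x) t) t := by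
  have h : Differentiable ℝ fun z : ℝ × ℝ ↦ φ z.1 z.2 := hφ.1.differentiable (by simp)
  exact (h.comp (differentiable_id.prodMk (differentiable_const x)) t).hasDerivAt

lemma IsTestFunction.exists_isTestData (hφ : IsTestFunction φ) :
    ∃ T R C L, IsTestData φ T R C L := by
  set f : ℝ × ℝ → ℝ := fun z ↦ φ z.1 z.2 with hf
  obtain ⟨C, hC⟩ := hφ.2.1.exists_bound_of_continuous hφ.1.continuous
  obtain ⟨L, hL⟩ := (hφ.1.of_le (by simp)).lipschitzWith_of_hasCompactSupport hφ.2.1 one_ne_zero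
  obtain ⟨r, hr⟩ := hφ.2.1.isCompact.isBounded.subset_closedBall 0
  have h0 : ∀ z, z ∉ tsupport f → f z = 0 := fun z hz ↦ image_eq_zero_of_notMem_tsupport hz
  have hz : ∀ t x : ℝ, (max 1 r < |t| ∨ max 1 r < |x|) → φ t x = 0 := by
    intro t x h
    refine h0 (t, x) fun hmem ↦ ?_
    have h1 := hr hmem
    rw [mem_closedBall_zero_iff, Prod.norm_def, max_le_iff] at h1
    rcases h with h | h
    · exact absurd ((le_max_right _ _).trans_lt h) (not_lt.2 h1.1)
    · exact absurd ((le_max_right _ _).trans_lt h) (not_lt.2 h1.2)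
  -- The maximum with 1 makes the time and space bounds positive even if the support is empty.
  refine ⟨max 1 r, max 1 r, C, L, ?_, ?_, ?_, ?_, ?_, ?_, ?_⟩
  · intro t ht x
    refine h0 (t, x) fun hmem ↦ ?_
    exact absurd (hφ.2.2 hmem).1 (not_lt.2 ht)
  · exact fun t ht x ↦ hz t x (Or.inl (ht.trans_le (le_abs_self t)))
  · exact fun t x hx ↦ hz t x (Or.inr hx)
  · exact fun t x ↦ hC (t, x)
  · intro t s x
    have := hL.dist_le_mul (t, x) (s, x)
    simpa [Prod.dist_eq, Real.dist_eq] using this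
  · intro t x y
    have := hL.dist_le_mul (t, x) (t, y)
    simpa [Prod.dist_eq, Real.dist_eq] using this
  · exact ⟨by positivity, by positivity, (norm_nonneg _).trans (hC 0), L.coe_nonneg⟩

lemma IsTestFunction.continuous_right (hφ : IsTestFunction φ) (t : ℝ) : Continuous (φ t) :=
  hφ.1.continuous.comp (Continuous.prodMk_right t)

lemma IsTestFunction.continuous_left (hφ : IsTestFunction φ) (x : ℝ) : Continuous fun t ↦ φ t x :=
  hφ.1.continuous.comp (Continuous.prodMk_left x)

/-- The margin 1 is needed because `φ` is only known to vanish for `|x| > R`, while a half-open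
interval omits its left end point. -/
lemma IsTestData.zero_of_notMem (h : IsTestData φ T R C L) (t : ℝ) :
    ∀ x ∉ Ioc (-(R + 1)) (R + 1), φ t x = 0 := by
  intro x hx
  refine h.zero_of_abs t x ?_
  rw [lt_abs]
  by_contra! hcon
  exact hx ⟨by linarith [hcon.2], by linarith [hcon.1]⟩

lemma isTestFunction_mul {χ ξ : ℝ → ℝ} (hχ : ContDiff ℝ ∞ χ) (hχc : HasCompactSupport χ)
    (hχs : tsupport χ ⊆ Ioi 0) (hξ : ContDiff ℝ ∞ ξ) (hξc : HasCompactSupport ξ) :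
    IsTestFunction fun t x ↦ χ t * ξ x := by
  have h0 : ∀ z : ℝ × ℝ, z ∉ tsupport χ ×ˢ tsupport ξ → χ z.1 * ξ z.2 = 0 := by
    intro z hz
    by_cases h1 : z.1 ∈ tsupport χ
    · rw [image_eq_zero_of_notMem_tsupport (f := ξ) (fun h2 ↦ hz ⟨h1, h2⟩), mul_zero]
    · rw [image_eq_zero_of_notMem_tsupport h1, zero_mul]
  refine ⟨(hχ.comp contDiff_fst).mul (hξ.comp contDiff_snd),
    HasCompactSupport.intro (IsCompact.prod hχc hξc) h0, ?_⟩
  refine (closure_minimal (fun z hz ↦ ?_)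
    ((isClosed_tsupport χ).prod (isClosed_tsupport ξ))).trans
    (Set.prod_mono hχs (subset_univ _))
  by_contra h
  exact hz (h0 z h)

end TestFunction

section Family

variable {m : ℝ → VectorMeasure ℝ (Phase N)} {φ : ℝ → ℝ → ℝ} {a b : ℝ}

lemma IsBoundedMeasureFamily.isFiniteMeasure (hm : IsBoundedMeasureFamily m) :
    ∀ᵐ t ∂(volume.restrict (Ioi (0 : ℝ))), IsFiniteMeasure (m t).variation := by
  obtain ⟨C, hC⟩ := hm.bounded
  filter_upwards [hC] with t ht using ⟨ht.trans_lt (by finiteness)⟩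

/-- For a.e. `t` the pairing is the limit of sums over grids independent of `t`, and the masses of
the grid cells are measurable in `t`. -/
lemma IsBoundedMeasureFamily.aestronglyMeasurable_pairing (hm : IsBoundedMeasureFamily m)
    (hφ : ∀ x, Measurable fun t ↦ φ t x) (hc : ∀ t, Continuous (φ t)) (hab : a ≤ b)
    (h0 : ∀ t, ∀ x ∉ Ioc a b, φ t x = 0) :
    AEStronglyMeasurable (fun t ↦ pairing (m t) (φ t)) (volume.restrict (Ioi (0 : ℝ))) := by
  refine aestronglyMeasurable_of_tendsto_ae atTop (f := fun n t ↦ ∑ j ∈ Finset.range (n + 1),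
      φ t (grid a b n j) • m t (Ioc (grid a b n j) (grid a b n (j + 1)))) (fun n ↦ ?_) ?_
  · exact Finset.aestronglyMeasurable_fun_sum _ fun j _ ↦
      (hφ _).aestronglyMeasurable.smul (hm.measurable _ measurableSet_Ioc)
  · filter_upwards [hm.isFiniteMeasure] with t ht
    exact tendsto_sum_pairing (hc t) hab (h0 t)

lemma IsBoundedMeasureFamily.exists_norm_pairing_le (hm : IsBoundedMeasureFamily m) {C : ℝ}
    (hC : 0 ≤ C) (h : ∀ t x, |φ t x| ≤ C) :
    ∃ D, 0 ≤ D ∧ ∀ᵐ t ∂(volume.restrict (Ioi (0 : ℝ))), ‖pairing (m t) (φ t)‖ ≤ D := by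
  obtain ⟨V, hV⟩ := hm.bounded
  refine ⟨C * V, by positivity, ?_⟩
  filter_upwards [hV, hm.isFiniteMeasure] with t ht hf
  refine (norm_pairing_le hC (h t)).trans ?_
  gcongr
  exact ENNReal.toReal_mono ENNReal.coe_ne_top ht

lemma integrableOn_Ioi_of_bound {E : Type*} [NormedAddCommGroup E] {f : ℝ → E} {T D : ℝ}
    (hf : AEStronglyMeasurable f (volume.restrict (Ioi (0 : ℝ))))
    (hD : ∀ᵐ t ∂(volume.restrict (Ioi (0 : ℝ))), ‖f t‖ ≤ D) (h0 : ∀ t, T < t → f t = 0) :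
    IntegrableOn f (Ioi 0) := by
  have hi : IntegrableOn ((Ioc 0 T).indicator fun _ ↦ D) (Ioi 0) :=
    ((integrable_indicator_iff measurableSet_Ioc).2
      (integrableOn_const (by simp))).integrableOn
  refine hi.mono' hf ?_
  filter_upwards [hD, ae_restrict_mem measurableSet_Ioi] with t ht ht0
  by_cases htT : t ≤ T
  · rwa [indicator_of_mem (show t ∈ Ioc 0 T from ⟨ht0, htT⟩)]
  · rw [indicator_of_notMem (fun h ↦ htT h.2), h0 t (not_le.1 htT), norm_zero]

lemma IsBoundedMeasureFamily.integrableOn_pairing (hm : IsBoundedMeasureFamily m)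
    (hφ : IsTestFunction φ) : IntegrableOn (fun t ↦ pairing (m t) (φ t)) (Ioi 0) := by
  obtain ⟨T, R, C, L, h⟩ := hφ.exists_isTestData
  obtain ⟨D, -, hD⟩ := hm.exists_norm_pairing_le h.pos.2.2.1 h.bound
  refine integrableOn_Ioi_of_bound (T := T) (hm.aestronglyMeasurable_pairing
    (fun x ↦ (hφ.continuous_left x).measurable) hφ.continuous_right (by linarith [h.pos.2.1])
    h.zero_of_notMem) hD fun t ht ↦ ?_
  have : φ t = fun _ ↦ 0 := funext fun x ↦ h.zero_of_lt t ht x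
  rw [this]
  exact VectorMeasure.integral_zero

/-- A family of measures whose integrals against all test functions vanish is zero. -/
lemma IsBoundedMeasureFamily.ae_eq_zero (hm : IsBoundedMeasureFamily m)
    (h : ∀ φ, IsTestFunction φ → ∫ t in Ioi (0 : ℝ), pairing (m t) (φ t) = 0) :
    ∀ᵐ t ∂(volume.restrict (Ioi (0 : ℝ))), m t = 0 := by
  -- Tests of product form `χ t * ξ x`, with `ξ` from a countable set of bumps, reduce the claim to
  -- the fundamental lemma of the calculus of variations in `t` alone.
  have hb : ∀ a b : ℚ, ∀ hab : (a : ℝ) < b, ∀ n : ℕ, ∀ᵐ t ∂(volume.restrict (Ioi (0 : ℝ))),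
      pairing (m t) (intervalBump hab n) = 0 := by
    intro a b hab n
    set ξ := intervalBump hab n
    have hm1 : AEStronglyMeasurable (fun t ↦ pairing (m t) ξ) (volume.restrict (Ioi (0 : ℝ))) := by
      refine hm.aestronglyMeasurable_pairing (φ := fun _ ↦ ξ) (a := a) (b := b)
        (fun x ↦ measurable_const) (fun _ ↦ ξ.continuous) hab.le fun _ x hx ↦ ?_
      refine ξ.zero_of_le_dist ?_
      by_contra! hcon
      rw [Real.dist_eq, abs_lt] at hcon
      have h1 : ξ.rOut = ((b : ℝ) - a) / 2 := rfl
      rw [h1] at hcon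
      exact hx ⟨by linarith [hcon.1], by linarith [hcon.2]⟩
    obtain ⟨D, -, hD⟩ := hm.exists_norm_pairing_le (φ := fun _ ↦ ξ) zero_le_one
      fun _ x ↦ abs_intervalBump_le hab n x
    have hloc : LocallyIntegrableOn (fun t ↦ pairing (m t) ξ) (Ioi (0 : ℝ)) := by
      rw [locallyIntegrableOn_iff isOpen_Ioi.isLocallyClosed]
      intro k hk hkc
      have hfin : IsFiniteMeasure (volume.restrict k) := ⟨by simpa using hkc.measure_lt_top⟩
      exact Integrable.of_bound (hm1.mono_measure (Measure.restrict_mono hk le_rfl)) D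
        (ae_restrict_of_ae_restrict_of_subset hk hD)
    have hz := isOpen_Ioi.ae_eq_zero_of_integral_contDiff_smul_eq_zero hloc fun χ hχ hχc hχs ↦ by
      have ht : IsTestFunction fun t x ↦ χ t * ξ x := isTestFunction_mul hχ hχc hχs ξ.contDiff
        ξ.hasCompactSupport
      have h2 := h _ ht
      rw [← setIntegral_eq_integral_of_forall_compl_eq_zero (s := Ioi 0)]
      · rw [← h2]
        refine setIntegral_congr_fun measurableSet_Ioi fun t _ ↦ ?_
        exact (VectorMeasure.integral_fun_smul _ _ (χ t) ξ).symm
      · intro t ht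
        rw [image_eq_zero_of_notMem_tsupport (fun h ↦ ht (hχs h)), zero_smul]
    exact (ae_restrict_iff' measurableSet_Ioi).2 hz
  -- Only countably many null sets occur, so a single exceptional set serves all rational intervals
  -- and all bumps.
  have hall : ∀ᵐ t ∂(volume.restrict (Ioi (0 : ℝ))), ∀ a b : ℚ, ∀ hab : (a : ℝ) < b, ∀ n : ℕ,
      pairing (m t) (intervalBump hab n) = 0 := by
    simp only [ae_all_iff]
    exact hb
  filter_upwards [hall, hm.isFiniteMeasure] with t ht hf
  refine vectorMeasure_eq_zero_of_Ioo fun a b hab ↦ ?_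
  have hab' : (a : ℝ) < b := by exact_mod_cast hab
  refine tendsto_nhds_unique (tendsto_pairing_intervalBump hab') ?_
  simp only [ht a b hab']
  exact tendsto_const_nhds

end Family

/-! ### Difference quotients in time -/

section DiffQuot

variable {φ : ℝ → ℝ → ℝ} {T R C L : ℝ}

lemma integrable_of_support_subset {X E : Type*} [MeasurableSpace X] [NormedAddCommGroup E]
    {μ : Measure X} {f : X → E} {s : Set X} {D : ℝ} (hf : AEStronglyMeasurable f μ) (hs : μ s ≠ ⊤)
    (hD : ∀ᵐ z ∂μ, ‖f z‖ ≤ D) (h0 : ∀ z ∉ s, f z = 0) : Integrable f μ := by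
  have hfin : IsFiniteMeasure (μ.restrict s) := ⟨by simpa using hs.lt_top⟩
  rw [← integrableOn_iff_integrable_of_support_subset (s := s)
    (fun z hz ↦ by_contra fun h ↦ hz (h0 z h))]
  exact Integrable.of_bound hf.restrict D (ae_restrict_of_ae hD)

/-- Integrals over the half-plane `t > 0` of functions that vanish outside of it. -/
lemma integral_eq_setIntegral_Ioi {E : Type*} [NormedAddCommGroup E] [NormedSpace ℝ E]
    {f g : ℝ × ℝ → E} (hf : Integrable f) (h0 : ∀ t x, t ≤ 0 → f (t, x) = 0)
    (hfg : ∀ t x, 0 < t → f (t, x) = g (t, x)) :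
    ∫ z, f z = ∫ t in Ioi (0 : ℝ), ∫ x, g (t, x) := by
  rw [Measure.volume_eq_prod, integral_prod f hf,
    ← setIntegral_eq_integral_of_forall_compl_eq_zero (s := Ioi (0 : ℝ))]
  · refine setIntegral_congr_fun measurableSet_Ioi fun t ht ↦ ?_
    simp only [hfg t _ ht]
  · intro t ht
    simp only [h0 t _ (not_lt.1 ht), integral_zero]

/-- Testing difference quotients in time of a convergent sequence: the limit is the distributional
derivative in time of the limit. -/
lemma tendsto_integral_diffQuot {f : ℕ → ℝ × ℝ → Phase N} {v : ℝ × ℝ → Phase N} {δ : ℕ → ℝ}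
    (hδ : ∀ k, 0 < δ k) (hδ0 : Tendsto δ atTop (𝓝 0))
    (hf : ∀ k, AEStronglyMeasurable (f k) (volume.restrict (Ioi (0 : ℝ) ×ˢ (univ : Set ℝ))))
    (hb : ∀ k, ∀ᵐ z ∂(volume.restrict (Ioi (0 : ℝ) ×ˢ (univ : Set ℝ))), ‖f k z‖ ≤ C)
    (hlim : ∀ᵐ z ∂(volume.restrict (Ioi (0 : ℝ) ×ˢ (univ : Set ℝ))),
      Tendsto (fun k ↦ f k z) atTop (𝓝 (v z)))
    (hφ : IsTestFunction φ) :
    Tendsto (fun k ↦ ∫ t in Ioi (0 : ℝ), ∫ x,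
        φ t x • (δ k)⁻¹ • (f k (t + δ k, x) - f k (t, x))) atTop
      (𝓝 (-∫ t in Ioi (0 : ℝ), ∫ x, deriv (fun r ↦ φ r x) t • v (t, x))) := by
  classical
  obtain ⟨T, R, M, L, hd⟩ := hφ.exists_isTestData
  -- A negative bound would make the open half-plane a null set.
  have hC : 0 ≤ C := by
    by_contra! hneg
    have h1 := hb 0
    have h2 : ∀ᵐ z ∂(volume.restrict (Ioi (0 : ℝ) ×ˢ (univ : Set ℝ))), False := by
      filter_upwards [h1] with z hz
      exact absurd hz (not_le.2 (hneg.trans_le (norm_nonneg _)))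
    rw [ae_iff] at h2
    simp [Measure.volume_eq_prod, Measure.prod_prod] at h2
  set S : Set (ℝ × ℝ) := Ioi (0 : ℝ) ×ˢ (univ : Set ℝ)
  have hS : MeasurableSet S := measurableSet_Ioi.prod MeasurableSet.univ
  -- Extension by zero to the whole plane allows free translation in time; no boundary term appears
  -- because `φ` vanishes for `t ≤ 0`.
  set g : ℕ → ℝ × ℝ → Phase N := fun k ↦ S.indicator (f k) with hg
  set g₀ : ℝ × ℝ → Phase N := S.indicator v with hg₀
  have hgm : ∀ k, AEStronglyMeasurable (g k) volume := fun k ↦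
    (aestronglyMeasurable_indicator_iff hS).2 (hf k)
  have hgb : ∀ k, ∀ᵐ z, ‖g k z‖ ≤ C := fun k ↦ by
    filter_upwards [(ae_restrict_iff' hS).1 (hb k)] with z hz
    by_cases h : z ∈ S
    · simpa only [hg, indicator_of_mem h] using hz h
    · simpa only [hg, indicator_of_notMem h, norm_zero] using hC
  have hgl : ∀ᵐ z, Tendsto (fun k ↦ g k z) atTop (𝓝 (g₀ z)) := by
    filter_upwards [(ae_restrict_iff' hS).1 hlim] with z hz
    by_cases h : z ∈ S
    · simpa only [hg, hg₀, indicator_of_mem h] using hz h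
    · simpa only [hg, hg₀, indicator_of_notMem h] using tendsto_const_nhds
  have hφc : Continuous fun z : ℝ × ℝ ↦ φ z.1 z.2 := hφ.1.continuous
  set B : ℝ → Set (ℝ × ℝ) := fun D ↦ Icc 0 (T + D) ×ˢ Icc (-R) R with hB
  have hBfin : ∀ D, volume (B D) ≠ ⊤ := fun D ↦
    (isCompact_Icc.prod isCompact_Icc).measure_lt_top.ne
  have hφ0 : ∀ D, 0 ≤ D → ∀ z ∉ B D, ∀ r, 0 ≤ r → r ≤ D → φ (z.1 - r) z.2 = 0 := by
    intro D hD z hz r hr hrD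
    by_contra hne
    refine hz ⟨⟨?_, ?_⟩, abs_le.1 ?_⟩
    · by_contra! h
      exact hne (hd.zero_of_nonpos _ (by linarith) _)
    · by_contra! h
      exact hne (hd.zero_of_lt _ (by linarith) _)
    · by_contra! h
      exact hne (hd.zero_of_abs _ _ h)
  have hshift : ∀ r, 0 ≤ r → ∀ k, Integrable fun z : ℝ × ℝ ↦ φ (z.1 - r) z.2 • g k z := by
    intro r hr k
    refine integrable_of_support_subset (s := B r) (D := M * C)
      (AEStronglyMeasurable.smul (Continuous.aestronglyMeasurable
        (hφc.comp ((continuous_fst.sub continuous_const).prodMk continuous_snd))) (hgm k))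
      (hBfin r) ?_ fun z hz ↦ by rw [hφ0 r hr z hz r hr le_rfl, zero_smul]
    filter_upwards [hgb k] with z hz
    rw [norm_smul]
    exact mul_le_mul (hd.bound _ _) hz (norm_nonneg _) hd.pos.2.2.1
  -- Discrete integration by parts: translation invariance moves the time shift from the approximate
  -- solution to the test function.
  have htrans : ∀ r k, ∫ z : ℝ × ℝ, φ z.1 z.2 • g k (z + (r, 0)) =
      ∫ z : ℝ × ℝ, φ (z.1 - r) z.2 • g k z := by
    intro r k
    rw [← integral_add_right_eq_self (fun z : ℝ × ℝ ↦ φ (z.1 - r) z.2 • g k z) (r, 0)]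
    simp
  have htransi : ∀ r, 0 ≤ r → ∀ k, Integrable fun z : ℝ × ℝ ↦ φ z.1 z.2 • g k (z + (r, 0)) := by
    intro r hr k
    have := (hshift r hr k).comp_add_right (r, 0)
    simpa using this
  have hint : ∀ k, ∫ t in Ioi (0 : ℝ), ∫ x, φ t x • (δ k)⁻¹ • (f k (t + δ k, x) - f k (t, x)) =
      ∫ z : ℝ × ℝ, ((δ k)⁻¹ * (φ (z.1 - δ k) z.2 - φ z.1 z.2)) • g k z := by
    intro k
    have e0 := hshift 0 le_rfl k
    simp only [sub_zero] at e0
    have e1 : Integrable fun z : ℝ × ℝ ↦ (δ k)⁻¹ •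
        (φ z.1 z.2 • g k (z + (δ k, 0)) - φ z.1 z.2 • g k z) :=
      ((htransi _ (hδ k).le k).sub e0).smul (δ k)⁻¹
    rw [← integral_eq_setIntegral_Ioi (g := fun z : ℝ × ℝ ↦
      φ z.1 z.2 • (δ k)⁻¹ • (f k (z.1 + δ k, z.2) - f k (z.1, z.2))) e1, integral_smul,
      integral_sub (htransi _ (hδ k).le k) e0, htrans, ← integral_sub (hshift _ (hδ k).le k) e0,
      ← integral_smul]
    · refine integral_congr_ae (Eventually.of_forall fun z ↦ ?_)
      simp only [← sub_smul, smul_smul]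
    · intro t x ht
      simp [hd.zero_of_nonpos t ht x]
    · intro t x ht
      have h1 : (t, x) ∈ S := ⟨ht, mem_univ _⟩
      have h2 : (t + δ k, x) ∈ S := ⟨add_pos ht (hδ k), mem_univ _⟩
      simp only [hg, Prod.mk_add_mk, add_zero, indicator_of_mem h1, indicator_of_mem h2]
      rw [← smul_sub, smul_comm]
  simp only [hint]
  -- The shift on `φ` is backward, hence the minus sign in the limit.
  have hder : ∀ z : ℝ × ℝ, Tendsto (fun k ↦ (δ k)⁻¹ * (φ (z.1 - δ k) z.2 - φ z.1 z.2)) atTop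
      (𝓝 (-deriv (fun r ↦ φ r z.2) z.1)) := by
    intro z
    have h1 := (hφ.hasDerivAt z.1 z.2).tendsto_slope
    have h2 : Tendsto (fun k ↦ z.1 - δ k) atTop (𝓝[≠] z.1) := by
      refine tendsto_nhdsWithin_iff.2 ⟨?_, Eventually.of_forall fun k ↦ ?_⟩
      · simpa using tendsto_const_nhds.sub hδ0
      · have := hδ k
        simp [this.ne']
    refine ((h1.comp h2).neg).congr fun k ↦ ?_
    simp only [Function.comp, slope_def_field]
    rw [sub_sub_cancel_left, div_neg, neg_neg, div_eq_inv_mul]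
  have hderb : ∀ t x, |deriv (fun r ↦ φ r x) t| ≤ L := by
    intro t x
    refine norm_deriv_le_of_lipschitz (C := ⟨L, hd.pos.2.2.2⟩) (f := fun r ↦ φ r x)
      (LipschitzWith.of_dist_le_mul fun s r ↦ ?_)
    rw [Real.dist_eq, Real.dist_eq]
    exact hd.lipschitz_time s r x
  have hrhs : -∫ t in Ioi (0 : ℝ), ∫ x, deriv (fun r ↦ φ r x) t • v (t, x) =
      ∫ z : ℝ × ℝ, (-deriv (fun r ↦ φ r z.2) z.1) • g₀ z := by
    simp only [neg_smul, integral_neg]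
    congr 1
    symm
    refine integral_eq_setIntegral_Ioi (g := fun z ↦ deriv (fun r ↦ φ r z.2) z.1 • v z) ?_ ?_ ?_
    · refine integrable_of_support_subset (s := B 1) (D := L * C) ?_ (hBfin 1) ?_ ?_
      · have hdm : AEStronglyMeasurable (fun z : ℝ × ℝ ↦ deriv (fun r ↦ φ r z.2) z.1) volume := ?_
        · exact hdm.smul (aestronglyMeasurable_of_tendsto_ae atTop hgm hgl)
        refine aestronglyMeasurable_of_tendsto_ae (f := fun k (z : ℝ × ℝ) ↦
          -((δ k)⁻¹ * (φ (z.1 - δ k) z.2 - φ z.1 z.2))) atTop (fun k ↦ ?_)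
          (Eventually.of_forall fun z ↦ ?_)
        · refine Continuous.aestronglyMeasurable (Continuous.neg (continuous_const.mul (Continuous.sub
            (hφc.comp ((continuous_fst.sub continuous_const).prodMk continuous_snd)) hφc)))
        · simpa using (hder z).neg
      · filter_upwards [hgl, ae_all_iff.2 hgb] with z h1 h2
        rw [norm_smul]
        exact mul_le_mul (hderb _ _) (le_of_tendsto h1.norm (Eventually.of_forall h2))
          (norm_nonneg _) hd.pos.2.2.2
      · intro z hz
        have h1 : Tendsto (fun k ↦ (δ k)⁻¹ * (φ (z.1 - δ k) z.2 - φ z.1 z.2)) atTop (𝓝 0) := by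
          refine tendsto_const_nhds.congr' ?_
          filter_upwards [hδ0 (Iic_mem_nhds one_pos)] with k hk
          have e1 := hφ0 1 zero_le_one z hz (δ k) (hδ k).le hk
          have e2 := hφ0 1 zero_le_one z hz 0 le_rfl zero_le_one
          rw [sub_zero] at e2
          rw [e1, e2, sub_zero, mul_zero]
        have h2 := tendsto_nhds_unique (hder z) h1
        rw [neg_eq_zero] at h2
        rw [h2, zero_smul]
    · intro t x ht
      rw [hg₀, indicator_of_notMem (fun h ↦ absurd h.1 (not_lt.2 ht)), smul_zero]
    · intro t x ht
      rw [hg₀, indicator_of_mem (show (t, x) ∈ S from ⟨ht, mem_univ _⟩)]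
  rw [hrhs]
  refine tendsto_integral_filter_of_dominated_convergence
    ((B 1).indicator fun _ ↦ L * C) (Eventually.of_forall fun k ↦ ?_) ?_ ?_ ?_
  · exact AEStronglyMeasurable.smul (Continuous.aestronglyMeasurable (continuous_const.mul
      (Continuous.sub (hφc.comp ((continuous_fst.sub continuous_const).prodMk continuous_snd))
        hφc))) (hgm k)
  · filter_upwards [hδ0 (Iic_mem_nhds one_pos)] with k hk
    filter_upwards [hgb k] with z hz
    by_cases hzB : z ∈ B 1
    · rw [indicator_of_mem hzB, norm_smul]
      refine mul_le_mul ?_ hz (norm_nonneg _) hd.pos.2.2.2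
      have h1 := hd.lipschitz_time (z.1 - δ k) z.1 z.2
      rw [sub_sub_cancel_left, abs_neg, abs_of_pos (hδ k)] at h1
      rw [norm_mul, norm_inv, Real.norm_of_nonneg (hδ k).le, inv_mul_le_iff₀ (hδ k), mul_comm]
      exact h1
    · have e1 := hφ0 1 zero_le_one z hzB (δ k) (hδ k).le hk
      have e2 := hφ0 1 zero_le_one z hzB 0 le_rfl zero_le_one
      rw [sub_zero] at e2
      rw [indicator_of_notMem hzB, e1, e2, sub_zero, mul_zero, zero_smul, norm_zero]
  · exact (integrable_indicator_iff (measurableSet_Icc.prod measurableSet_Icc)).2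
      (integrableOn_const (hBfin 1))
  · filter_upwards [hgl] with z hz
    exact (hder z).smul hz

end DiffQuot

/-! ### Weak limits of integrable functions with converging primitives -/

section BoundedVariation

variable {f g : ℝ → Phase N}

lemma edist_le_eVariationOn_Iic_sub (hf : BoundedVariationOn f univ) {x y : ℝ} (hxy : x ≤ y) :
    ‖f y - f x‖ ≤ (eVariationOn f (Iic y)).toReal - (eVariationOn f (Iic x)).toReal := by
  have hfin : ∀ s, eVariationOn f s ≠ ⊤ := fun s ↦ hf.mono (subset_univ s)
  have h := eVariationOn.union f (s := Iic x) (t := Icc x y) (x := x) isGreatest_Iic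
    (isLeast_Icc hxy)
  rw [Iic_union_Icc_eq_Iic hxy] at h
  rw [h, ENNReal.toReal_add (hfin _) (hfin _), add_sub_cancel_left, ← dist_eq_norm,
    ← ENNReal.ofReal_le_iff_le_toReal (hfin _), ← edist_dist]
  exact eVariationOn.edist_le f (right_mem_Icc.2 hxy) (left_mem_Icc.2 hxy)

/-- Where `f` fails to be right-continuous, the monotone function given by its variation on `(-∞,
x]` is discontinuous. -/
lemma countable_rightLim_ne (hf : BoundedVariationOn f univ) :
    {x | f.rightLim x ≠ f x}.Countable := by
  have hmono : Monotone fun x ↦ (eVariationOn f (Iic x)).toReal := fun x y hxy ↦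
    ENNReal.toReal_mono (hf.mono (subset_univ _)) (eVariationOn.mono f (Iic_subset_Iic.2 hxy))
  refine hmono.countable_not_continuousAt.mono fun x hx ↦ ?_
  intro hc
  refine hx ?_
  refine tendsto_nhds_unique (hf.tendsto_rightLim x) ?_
  have h1 : Tendsto (fun y ↦ (eVariationOn f (Iic y)).toReal - (eVariationOn f (Iic x)).toReal)
      (𝓝[>] x) (𝓝 0) := by
    have := (hc.tendsto.mono_left (nhdsWithin_le_nhds (s := Ioi x))).sub
      (tendsto_const_nhds (x := (eVariationOn f (Iic x)).toReal))
    rwa [sub_self] at this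
  rw [tendsto_iff_norm_sub_tendsto_zero]
  refine squeeze_zero' (Eventually.of_forall fun _ ↦ norm_nonneg _) ?_ h1
  filter_upwards [self_mem_nhdsWithin] with y hy
  exact edist_le_eVariationOn_Iic_sub hf (le_of_lt hy)

lemma isRCBV_rightLim (hf : BoundedVariationOn f univ) : IsRCBV f.rightLim where
  bv := hf.rightLim
  rightLim_eq := funext fun x ↦ rightLim_rightLim (hf.tendsto_rightLim x)

lemma rightLim_ae_eq (hf : BoundedVariationOn f univ) : f.rightLim =ᵐ[volume] f :=
  (countable_rightLim_ne hf).ae_notMem volume |>.mono fun _ hx ↦ not_not.1 hx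

/-- Functions of bounded variation that agree on a dense set have the same right limits. -/
lemma rightLim_congr_of_dense (hf : BoundedVariationOn f univ) (hg : BoundedVariationOn g univ)
    {s : Set ℝ} (hs : Dense s) (h : EqOn f g s) : f.rightLim = g.rightLim := by
  ext1 x
  have hne : (𝓝[s ∩ Ioi x] x).NeBot := by
    rw [← mem_closure_iff_nhdsWithin_neBot, inter_comm]
    have h1 : x ∈ closure (Ioi x) := by rw [closure_Ioi]; exact self_mem_Ici
    exact closure_minimal (hs.open_subset_closure_inter isOpen_Ioi) isClosed_closure h1
  have h1 := (hf.tendsto_rightLim x).mono_left (nhdsWithin_mono x (inter_subset_right (s := s)))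
  have h2 := (hg.tendsto_rightLim x).mono_left (nhdsWithin_mono x (inter_subset_right (s := s)))
  refine tendsto_nhds_unique h1 (h2.congr' ?_)
  filter_upwards [self_mem_nhdsWithin] with y hy using (h hy.1).symm

/-- The total variation is lower semicontinuous under pointwise convergence. -/
lemma eVariationOn_le_of_tendsto {ι : Type*} {l : Filter ι} [l.NeBot] {F : ι → ℝ → Phase N}
    (hF : ∀ x, Tendsto (fun i ↦ F i x) l (𝓝 (f x))) {V : ℝ≥0∞}
    (hV : ∀ i, eVariationOn (F i) univ ≤ V) : eVariationOn f univ ≤ V := by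
  by_contra! h
  obtain ⟨i, hi⟩ := (eVariationOn.lowerSemicontinuous_aux (fun x _ ↦ hF x) h).exists
  exact absurd (hV i) (not_le.2 hi)

/-- Bounded sequences converge along ultrafilters. -/
lemma exists_tendsto_ultrafilter {ι : Type*} (U : Ultrafilter ι) {F : ι → ℝ → Phase N} {C : ℝ}
    (hC : ∀ i x, ‖F i x‖ ≤ C) : ∃ f : ℝ → Phase N, ∀ x, Tendsto (fun i ↦ F i x) U (𝓝 (f x)) := by
  have h : ∀ x, ∃ y, Tendsto (fun i ↦ F i x) U (𝓝 y) := by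
    intro x
    obtain ⟨y, -, hy⟩ := (isCompact_closedBall (0 : Phase N) C).ultrafilter_le_nhds
      (U.map fun i ↦ F i x) (by
        rw [le_principal_iff]
        exact (Eventually.of_forall fun i ↦ mem_closedBall_zero_iff.2 (hC i x) :
          ∀ᶠ i in U, F i x ∈ Metric.closedBall 0 C))
    exact ⟨y, hy⟩
  choose f hf using h
  exact ⟨f, hf⟩

end BoundedVariation

/-! ### Primitives of integrable functions and grid sums. -/

section Primitive

variable {D : ℝ → Phase N} {φ : ℝ → ℝ} {a b ε : ℝ} {n : ℕ}

lemma eVariationOn_primitive_le (hD : Integrable D) :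
    eVariationOn (fun x ↦ ∫ y in (0 : ℝ)..x, D y) univ ≤ ∫⁻ x, ‖D x‖ₑ := by
  refine iSup_le fun ⟨n, u, hu, _⟩ ↦ ?_
  calc _ ≤ ∑ i ∈ Finset.range n, ∫⁻ x in Ioc (u i) (u (i + 1)), ‖D x‖ₑ := by
        refine Finset.sum_le_sum fun i _ ↦ ?_
        have hle : u i ≤ u (i + 1) := hu (Nat.le_succ i)
        rw [edist_eq_enorm_sub, intervalIntegral.integral_interval_sub_left
          hD.intervalIntegrable hD.intervalIntegrable, intervalIntegral.integral_of_le hle]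
        exact enorm_integral_le_lintegral_enorm _
    _ = ∫⁻ x in ⋃ i ∈ Finset.range n, Ioc (u i) (u (i + 1)), ‖D x‖ₑ := by
        refine (lintegral_biUnion_finset (fun i _ j _ hij ↦ ?_)
          (fun _ _ ↦ measurableSet_Ioc) _).symm
        exact hu.pairwise_disjoint_on_Ioc_succ hij
    _ ≤ _ := setLIntegral_le_lintegral _ _

lemma integral_stepFun_smul (hD : Integrable D) : ∫ x, stepFun φ a b n x • D x =
    ∑ j ∈ Finset.range (n + 1),
      φ (grid a b n j) • ∫ x in Ioc (grid a b n j) (grid a b n (j + 1)), D x := by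
  simp only [stepFun, Finset.sum_smul]
  have h : ∀ j x, (Ioc (grid a b n j) (grid a b n (j + 1))).indicator
      (fun _ ↦ φ (grid a b n j)) x • D x =
      (Ioc (grid a b n j) (grid a b n (j + 1))).indicator (fun y ↦ φ (grid a b n j) • D y) x := by
    intro j x
    rw [indicator_smul_apply_left]
  simp only [h]
  rw [integral_finsetSum _ fun j _ ↦ Integrable.indicator (f := fun y ↦ φ (grid a b n j) • D y)
    (hD.smul (φ (grid a b n j))) measurableSet_Ioc]
  refine Finset.sum_congr rfl fun j _ ↦ ?_
  rw [integral_indicator measurableSet_Ioc, integral_smul]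

lemma norm_integral_smul_le (hD : Integrable D) (h : ∀ x, |φ x| ≤ ε) :
    ‖∫ x, φ x • D x‖ ≤ ε * ∫ x, ‖D x‖ := by
  rw [← integral_const_mul]
  refine norm_integral_le_of_norm_le (hD.norm.const_mul ε) (Eventually.of_forall fun x ↦ ?_)
  rw [norm_smul]
  exact mul_le_mul_of_nonneg_right (h x) (norm_nonneg _)

lemma norm_integral_sub_sum_le (hD : Integrable D) (hφ : Measurable φ) {C : ℝ}
    (hC : ∀ x, |φ x| ≤ C) (h : ∀ x, |φ x - stepFun φ a b n x| ≤ ε) :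
    ‖(∫ x, φ x • D x) - ∑ j ∈ Finset.range (n + 1),
      φ (grid a b n j) • ∫ x in Ioc (grid a b n j) (grid a b n (j + 1)), D x‖ ≤
      ε * ∫ x, ‖D x‖ := by
  have h1 : Integrable fun x ↦ φ x • D x :=
    hD.bdd_smul C hφ.aestronglyMeasurable (Eventually.of_forall hC)
  have h2 : Integrable fun x ↦ stepFun φ a b n x • D x := by
    refine hD.bdd_smul (C + ε) measurable_stepFun.aestronglyMeasurable
      (Eventually.of_forall fun x ↦ ?_)
    have h1 := abs_sub_abs_le_abs_sub (stepFun φ a b n x) (φ x)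
    rw [abs_sub_comm] at h1
    rw [Real.norm_eq_abs]
    linarith [h x, hC x]
  rw [← integral_stepFun_smul hD, ← integral_sub h1 h2]
  simp only [← sub_smul]
  exact norm_integral_smul_le hD h

end Primitive

/-! ### Weak limits identified by the limits of primitives. -/

section WeakLimit

variable {D : ℕ → ℝ → Phase N} {φ : ℝ → ℝ} {G : ℝ → Phase N} {R : ℝ} {V : ℝ≥0}

lemma grid_add (a b η : ℝ) (n j : ℕ) : grid (a + η) (b + η) n j = grid a b n j + η := by
  simp only [grid]
  ring

lemma integral_norm_le_of_lintegral_le {f : ℝ → Phase N} (hf : Integrable f)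
    (hV : ∫⁻ x, ‖f x‖ₑ ≤ V) : ∫ x, ‖f x‖ ≤ V := by
  rw [integral_norm_eq_lintegral_enorm hf.aestronglyMeasurable]
  exact ENNReal.toReal_mono ENNReal.coe_ne_top hV

lemma variation_vectorMeasure_rightLim_le (hG : BoundedVariationOn G univ)
    (hGV : eVariationOn G univ ≤ V) :
    (isRCBV_rightLim hG).bv.vectorMeasure.variation univ ≤ V :=
  (((isRCBV_rightLim hG).variation_vectorMeasure_le univ).trans
    (isRCBV_rightLim hG).measure_univ_le).trans
    ((eVariationOn.eVariationOn_rightLim_le isOpen_univ).trans hGV)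

/-- A grid sum for `φ` involves only increments of primitives, which converge. Its distance to both
integrals is controlled by the oscillation of `φ` times `V`, uniformly in the index of the sequence.
-/
lemma tendsto_integral_smul_ultrafilter {U : Ultrafilter ℕ} (hD : ∀ n, Integrable (D n))
    (hV : ∀ n, ∫⁻ x, ‖D n x‖ₑ ≤ V) (hbv : BoundedVariationOn G univ)
    (hGV : eVariationOn G univ ≤ V)
    (hG : ∀ x, Tendsto (fun n ↦ ∫ y in (0 : ℝ)..x, D n y) U (𝓝 (G x)))
    (hφ : Continuous φ) (hR : 0 ≤ R) (h0 : ∀ x, R < |x| → φ x = 0) :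
    Tendsto (fun n ↦ ∫ x, φ x • D n x) U
      (𝓝 (pairing (isRCBV_rightLim hbv).bv.vectorMeasure φ)) := by
  set hw := isRCBV_rightLim hbv
  set m := hw.bv.vectorMeasure
  have hmV := variation_vectorMeasure_rightLim_le hbv hGV
  have hmfin : IsFiniteMeasure m.variation := ⟨hmV.trans_lt ENNReal.coe_lt_top⟩
  have hmV' : m.variation.real univ ≤ V := ENNReal.toReal_mono ENNReal.coe_ne_top hmV
  have hc : HasCompactSupport φ := HasCompactSupport.intro (isCompact_Icc (a := -R) (b := R))
    fun x hx ↦ h0 x (not_le.1 fun h ↦ hx (abs_le.1 h))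
  obtain ⟨C, hC⟩ := hc.exists_bound_of_continuous hφ
  rw [Metric.tendsto_nhds]
  intro ε hε
  -- Two discretization errors `e * V` and one convergence error below `e` add up to less than `e *
  -- (2 * V + 2) = ε`.
  set e := ε / (2 * V + 2) with he
  have he0 : 0 < e := by positivity
  obtain ⟨δ, hδ, hmod⟩ :=
    Metric.uniformContinuous_iff.1 (hc.uniformContinuous_of_continuous hφ) e he0
  -- The grid will be shifted to the right by some `η` in `(0, 1)`, and must still cover the
  -- support.
  set a := -R - 2 with ha
  set b := R with hb
  have hab : a ≤ b := by linarith
  obtain ⟨n, hn⟩ : ∃ n : ℕ, (b - a) / (n + 1) < δ := by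
    obtain ⟨n, hn⟩ := exists_nat_gt ((b - a) / δ)
    refine ⟨n, ?_⟩
    rw [div_lt_iff₀ hδ] at hn
    rw [div_lt_iff₀ (by positivity)]
    nlinarith
  -- The measure sees the right limits of `G` whereas the primitives converge to `G` itself. The
  -- grid is shifted so that its nodes avoid the countable set where the two differ.
  have hcount : {η | ∃ j : ℕ, G.rightLim (grid a b n j + η) ≠ G (grid a b n j + η)}.Countable := by
    rw [ofPred_exists]
    exact countable_iUnion fun j ↦
      (countable_rightLim_ne hbv).preimage (add_right_injective (grid a b n j))
  obtain ⟨η, hη, hη0, hη1⟩ := (hcount.dense_compl ℝ).exists_between (zero_lt_one (α := ℝ))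
  have hG' : ∀ j, G.rightLim (grid (a + η) (b + η) n j) = G (grid (a + η) (b + η) n j) := by
    intro j
    by_contra hne
    rw [grid_add] at hne
    exact hη ⟨j, hne⟩
  set y : ℕ → ℝ := grid (a + η) (b + η) n with hy
  have hab' : a + η ≤ b + η := by linarith
  have hstep : ∀ x, |φ x - stepFun φ (a + η) (b + η) n x| ≤ e := by
    refine fun x ↦ abs_sub_stepFun_le hab' he0.le (fun x hx ↦ h0 x ?_) (fun x z hxz ↦ ?_) x
    · by_contra! hcon
      rw [abs_le] at hcon
      exact hx ⟨by linarith [hcon.1], by linarith [hcon.2]⟩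
    · rw [add_sub_add_right_eq_sub] at hxz
      exact (hmod (hxz.trans_lt hn)).le
  have hm1 := norm_pairing_sub_sum_le (m := m) hφ.measurable hC he0.le hstep
  have hincr : ∀ j, m (Ioc (y j) (y (j + 1))) = G (y (j + 1)) - G (y j) := fun j ↦ by
    rw [hw.vectorMeasure_Ioc (monotone_grid hab' n (Nat.le_succ j)), hG', hG']
  have hsum : Tendsto (fun k ↦ ∑ j ∈ Finset.range (n + 1),
      φ (y j) • ∫ x in Ioc (y j) (y (j + 1)), D k x) U
      (𝓝 (∑ j ∈ Finset.range (n + 1), φ (y j) • m (Ioc (y j) (y (j + 1))))) := by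
    refine tendsto_finsetSum _ fun j _ ↦ Tendsto.const_smul ?_ _
    rw [hincr]
    refine ((hG (y (j + 1))).sub (hG (y j))).congr fun k ↦ ?_
    rw [intervalIntegral.integral_interval_sub_left (hD k).intervalIntegrable
      (hD k).intervalIntegrable,
      intervalIntegral.integral_of_le (monotone_grid hab' n (Nat.le_succ j))]
  filter_upwards [Metric.tendsto_nhds.1 hsum e he0] with k hk
  have hk1 := norm_integral_sub_sum_le (hD k) hφ.measurable hC hstep
  rw [dist_eq_norm] at hk ⊢
  set S := ∑ j ∈ Finset.range (n + 1), φ (y j) • m (Ioc (y j) (y (j + 1)))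
  set Sk := ∑ j ∈ Finset.range (n + 1), φ (y j) • ∫ x in Ioc (y j) (y (j + 1)), D k x
  have hb1 : e * m.variation.real univ ≤ e * V := by gcongr
  have hb2 : e * ∫ x, ‖D k x‖ ≤ e * V := by
    gcongr
    exact integral_norm_le_of_lintegral_le (hD k) (hV k)
  have heq : e * (2 * V + 2) = ε := by
    rw [he]
    field_simp
  calc ‖(∫ x, φ x • D k x) - pairing m φ‖
      = ‖((∫ x, φ x • D k x) - Sk) + (Sk - S) - (pairing m φ - S)‖ := by congr 1; abel
    _ ≤ ‖(∫ x, φ x • D k x) - Sk‖ + ‖Sk - S‖ + ‖pairing m φ - S‖ :=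
        (norm_sub_le _ _).trans (by gcongr; exact norm_add_le _ _)
    _ < ε := by nlinarith

/-- A sequence of integrable functions, bounded in `L¹`, whose primitives converge at the rational
points, converges weakly to a measure. -/
lemma exists_weak_limit (hD : ∀ n, Integrable (D n)) (hV : ∀ n, ∫⁻ x, ‖D n x‖ₑ ≤ V)
    (hr : ∀ r : ℚ, ∃ l, Tendsto (fun n ↦ ∫ y in (0 : ℝ)..r, D n y) atTop (𝓝 l)) :
    ∃ m : VectorMeasure ℝ (Phase N), m.variation univ ≤ V ∧
      ∀ φ : ℝ → ℝ, Continuous φ → ∀ R, 0 ≤ R → (∀ x, R < |x| → φ x = 0) →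
        Tendsto (fun n ↦ ∫ x, φ x • D n x) atTop (𝓝 (pairing m φ)) := by
  have hFb : ∀ n x, ‖∫ y in (0 : ℝ)..x, D n y‖ ≤ V := fun n x ↦
    intervalIntegral.norm_integral_le_integral_norm_uIoc.trans
      ((setIntegral_le_integral (hD n).norm (Eventually.of_forall fun _ ↦ norm_nonneg _)).trans
        (integral_norm_le_of_lintegral_le (hD n) (hV n)))
  have hlim : ∀ U : Ultrafilter ℕ, ∃ G : ℝ → Phase N, eVariationOn G univ ≤ V ∧
      ∀ x, Tendsto (fun n ↦ ∫ y in (0 : ℝ)..x, D n y) U (𝓝 (G x)) := by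
    intro U
    obtain ⟨G, hG⟩ := exists_tendsto_ultrafilter U hFb
    exact ⟨G, eVariationOn_le_of_tendsto hG fun n ↦ (eVariationOn_primitive_le (hD n)).trans (hV n),
      hG⟩
  have hbv : ∀ G : ℝ → Phase N, eVariationOn G univ ≤ V → BoundedVariationOn G univ :=
    fun G hG ↦ (hG.trans_lt ENNReal.coe_lt_top).ne
  choose G hGV hG using hlim
  set U₀ : Ultrafilter ℕ := hyperfilter ℕ
  have hU₀ : (U₀ : Filter ℕ) ≤ atTop := by
    rw [← Nat.cofinite_eq_atTop]
    exact hyperfilter_le_cofinite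
  refine ⟨(isRCBV_rightLim (hbv _ (hGV U₀))).bv.vectorMeasure,
    variation_vectorMeasure_rightLim_le (hbv _ (hGV U₀)) (hGV U₀), fun φ hφ R hR h0 ↦ ?_⟩
  rw [tendsto_iff_ultrafilter]
  intro U hU
  -- The measure was built from one ultrafilter `U₀`. Limits of the primitives along any other
  -- ultrafilter agree with it at the rational points, hence have the same right limits and define
  -- the same measure; so the whole sequence converges.
  have heq : (G U).rightLim = (G U₀).rightLim := by
    refine rightLim_congr_of_dense (hbv _ (hGV U)) (hbv _ (hGV U₀)) Rat.denseRange_cast ?_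
    rintro _ ⟨r, rfl⟩
    obtain ⟨l, hl⟩ := hr r
    exact (tendsto_nhds_unique (hG U r) (hl.mono_left hU)).trans
      (tendsto_nhds_unique (hG U₀ r) (hl.mono_left hU₀)).symm
  have h := tendsto_integral_smul_ultrafilter hD hV (hbv _ (hGV U)) (hGV U) (hG U) hφ hR h0
  simpa only [heq] using h

end WeakLimit

/-! ### Piecewise constant functions on uniform cells -/

section Cell

variable {U W : ℤ → Phase N} {d : ℝ} {Ω : Set (Phase N)} {C : ℝ}

/-- The function that equals `U i` on the cell `[(i-1) d, i d)`. -/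
def cellFun (d : ℝ) (U : ℤ → Phase N) (x : ℝ) : Phase N := U (⌊x / d⌋ + 1)

lemma floor_div_eq_iff (hd : 0 < d) {x : ℝ} {i : ℤ} :
    ⌊x / d⌋ = i ↔ x ∈ Ico (i * d) ((i + 1) * d) := by
  rw [Int.floor_eq_iff, le_div_iff₀ hd, div_lt_iff₀ hd, mem_Ico]

lemma cellFun_of_mem (hd : 0 < d) {x : ℝ} {i : ℤ} (hx : x ∈ Ico (i * d) ((i + 1) * d)) :
    cellFun d U x = U (i + 1) := by
  rw [cellFun, (floor_div_eq_iff hd).2 hx]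

lemma measurable_floor_div : Measurable fun x : ℝ ↦ ⌊x / d⌋ :=
  Int.measurable_floor.comp (measurable_id.div_const d)

lemma measurable_cellFun : Measurable (cellFun d U) :=
  (measurable_of_countable fun i : ℤ ↦ U (i + 1)).comp measurable_floor_div

lemma lintegral_floor_div (hd : 0 < d) (f : ℤ → ℝ≥0∞) :
    ∫⁻ x : ℝ, f ⌊x / d⌋ = ENNReal.ofReal d * ∑' i, f i := by
  have hU : (⋃ i : ℤ, Ico (i * d) ((i + 1) * d)) = univ := by
    rw [eq_univ_iff_forall]
    exact fun x ↦ mem_iUnion.2 ⟨⌊x / d⌋, (floor_div_eq_iff hd).1 rfl⟩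
  rw [← setLIntegral_univ, ← hU, lintegral_iUnion (fun _ ↦ measurableSet_Ico), ← ENNReal.tsum_mul_left]
  · refine tsum_congr fun i ↦ ?_
    have : ∫⁻ x in Ico (i * d) ((i + 1) * d), f ⌊x / d⌋ =
        ∫⁻ _ in Ico (i * d) ((i + 1) * d), f i :=
      setLIntegral_congr_fun measurableSet_Ico fun x hx ↦ by
        simp only [(floor_div_eq_iff hd).2 hx]
    rw [this, setLIntegral_const, Real.volume_Ico, mul_comm]
    congr 2
    ring
  · intro i j hij
    rw [Function.onFun, disjoint_left]
    intro x hi hj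
    exact hij (((floor_div_eq_iff hd).2 hi).symm.trans ((floor_div_eq_iff hd).2 hj))

lemma lintegral_cellFun_sub (hd : 0 < d) :
    ∫⁻ x, ‖cellFun d U x - cellFun d W x‖ₑ = ENNReal.ofReal d * ∑' i, ‖U i - W i‖ₑ := by
  have h := lintegral_floor_div hd fun i ↦ ‖U (i + 1) - W (i + 1)‖ₑ
  rw [← (Equiv.addRight (1 : ℤ)).tsum_eq fun i ↦ ‖U i - W i‖ₑ]
  exact h

/-- A finite set of interfaces is enlarged to a symmetric window, and the piecewise constant
function is sampled at the left ends of the corresponding consecutive cells. -/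
lemma tsum_enorm_sub_le (hd : 0 < d) :
    ∑' i, ‖U (i + 1) - U i‖ₑ ≤ eVariationOn (cellFun d U) univ := by
  have hcell : ∀ i : ℤ, cellFun d U ((i - 1) * d) = U i := fun i ↦ by
    have := cellFun_of_mem (U := U) hd (x := (i - 1) * d) (i := i - 1)
      ⟨by push_cast; rfl, by push_cast; nlinarith⟩
    rwa [sub_add_cancel] at this
  rw [ENNReal.tsum_eq_iSup_sum]
  refine iSup_le fun s ↦ ?_
  obtain ⟨n, hn⟩ : ∃ n : ℕ, ∀ i ∈ s, |i| < n := by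
    obtain ⟨b, hb⟩ := (s.image fun i ↦ |i|.toNat).bddAbove
    refine ⟨b + 1, fun i hi ↦ ?_⟩
    have := hb (Finset.mem_coe.2 (Finset.mem_image_of_mem _ hi))
    have h0 := abs_nonneg i
    push_cast
    omega
  have hsub : s ⊆ (Finset.range (2 * n)).image fun j : ℕ ↦ (j : ℤ) - n := by
    intro i hi
    have := abs_lt.1 (hn i hi)
    exact Finset.mem_image.2 ⟨(i + n).toNat, Finset.mem_range.2 (by omega), by omega⟩
  refine (Finset.sum_le_sum_of_subset hsub).trans ?_
  rw [Finset.sum_image (fun i _ j _ h ↦ by simpa using h)]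
  have hmono : Monotone fun j : ℕ ↦ ((j : ℝ) - n - 1) * d := fun i j hij ↦ by
    have : (i : ℝ) ≤ j := by exact_mod_cast hij
    simp only
    gcongr
  refine le_trans (le_of_eq (Finset.sum_congr rfl fun j _ ↦ ?_))
    (eVariationOn.sum_le (f := cellFun d U) (n := 2 * n) hmono fun _ ↦ mem_univ _)
  have e1 := hcell ((j : ℤ) - n)
  have e2 := hcell ((j : ℤ) - n + 1)
  push_cast at e1 e2 ⊢
  rw [edist_eq_enorm_sub, ← e1, ← e2]
  congr 4
  ring

lemma eventually_cellFun_right (hd : 0 < d) (x : ℝ) : ∀ᶠ y in 𝓝[≥] x, cellFun d U y = cellFun d U x := by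
  have hx := (floor_div_eq_iff hd).1 (rfl : ⌊x / d⌋ = ⌊x / d⌋)
  filter_upwards [Ico_mem_nhdsGE hx.2] with y hy
  rw [cellFun_of_mem hd ⟨hx.1.trans hy.1, hy.2⟩, cellFun]

lemma eventually_cellFun_left (hd : 0 < d) (x : ℝ) : ∀ᶠ y in 𝓝[<] x, cellFun d U y = U ⌈x / d⌉ := by
  have h1 : (⌈x / d⌉ - 1 : ℤ) * d < x := by
    rw [← lt_div_iff₀ hd, ← Int.lt_ceil]
    omega
  have h2 : x ≤ ⌈x / d⌉ * d := by
    rw [← div_le_iff₀ hd]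
    exact Int.le_ceil _
  filter_upwards [Ioo_mem_nhdsLT h1] with y hy
  rw [cellFun_of_mem hd (i := ⌈x / d⌉ - 1) ⟨hy.1.le, by push_cast; rw [sub_add_cancel]; linarith [hy.2]⟩]
  rw [sub_add_cancel]

lemma isRCBV_cellFun (hd : 0 < d) (hbv : BoundedVariationOn (cellFun d U) univ) :
    IsRCBV (cellFun d U) where
  bv := hbv
  rightLim_eq := funext fun x ↦ tendsto_nhds_unique (hbv.tendsto_rightLim x)
    (tendsto_const_nhds.congr' (EventuallyEq.symm
      ((eventually_cellFun_right hd x).filter_mono (nhdsWithin_mono x Ioi_subset_Ici_self))))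

lemma leftLim_cellFun (hd : 0 < d) (x : ℝ) : (cellFun d U).leftLim x = U ⌈x / d⌉ :=
  leftLim_eq_of_tendsto (tendsto_const_nhds.congr' (EventuallyEq.symm (eventually_cellFun_left hd x)))

lemma isAdmissible_cellFun (hd : 0 < d) (hbv : BoundedVariationOn (cellFun d U) univ)
    (hΩ : ∀ i, U i ∈ Ω) (hC : ∀ i, ‖U i‖ ≤ C) : IsAdmissible Ω C (cellFun d U) where
  toIsRCBV := isRCBV_cellFun hd hbv
  leftLim_mem x := by
    rw [leftLim_cellFun hd]
    exact hΩ _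
  mem x := hΩ _
  norm_le x := hC _

lemma approx_eq_cellFun (dx dt : ℝ) (u : ℕ → ℤ → Phase N) (t : ℝ) :
    approx dx dt u t = cellFun dx (u ⌊t / dt⌋₊) := rfl

lemma measurable_approx (dx dt : ℝ) (u : ℕ → ℤ → Phase N) :
    Measurable fun z : ℝ × ℝ ↦ approx dx dt u z.1 z.2 := by
  have h : Measurable fun z : ℝ × ℝ ↦ (⌊z.1 / dt⌋₊, ⌊z.2 / dx⌋) :=
    (Nat.measurable_floor.comp (measurable_fst.div_const dt)).prodMk
      (Int.measurable_floor.comp (measurable_snd.div_const dx))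
  exact (measurable_of_countable fun i : ℕ × ℤ ↦ u i.1 (i.2 + 1)).comp h

end Cell

/-! ### Estimates of the scheme -/

section Scheme

variable {Ω : Set (Phase N)} {A : Phase N → Phase N →L[ℝ] Phase N}
  {Φ : ℝ → Phase N → Phase N → Phase N} {p q : ℕ}
  {Mm Mp : ℕ → (Fin (p + q + 1) → Phase N) → Phase N} {U : ℤ → Phase N} {C : ℝ} {K : ℝ≥0}

lemma edist_le_sum_edist {E : Type*} [PseudoEMetricSpace E] (f : ℕ → E) {n i j : ℕ} (hi : i ≤ n)
    (hj : j ≤ n) : edist (f i) (f j) ≤ ∑ l ∈ Finset.range n, edist (f l) (f (l + 1)) := by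
  wlog hij : i ≤ j generalizing i j
  · rw [edist_comm]
    exact this hj hi (le_of_not_ge hij)
  refine (edist_le_Ico_sum_edist f hij).trans (Finset.sum_le_sum_of_subset fun l hl ↦ ?_)
  rw [Finset.mem_Ico] at hl
  exact Finset.mem_range.2 (by omega)

/-- Since `M` vanishes on the constant stencil `U i`, its value is at most `K` times the distance to
that stencil, which telescopes into `p + q` consecutive increments. Summed over `i`, each increment
is counted `p + q` times. -/
lemma tsum_enorm_stencil_le {M : (Fin (p + q + 1) → Phase N) → Phase N}
    (hM : LipschitzOnWith K M {w | ∀ j, w j ∈ Ω ∧ ‖w j‖ ≤ C}) (h0 : ∀ a ∈ Ω, M (fun _ ↦ a) = 0)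
    (hΩ : ∀ i, U i ∈ Ω) (hC : ∀ i, ‖U i‖ ≤ C) :
    ∑' i, ‖M (stencil p q U i)‖ₑ ≤ K * ((p + q : ℕ) * ∑' i, ‖U (i + 1) - U i‖ₑ) := by
  have h1 : ∀ i, ‖M (stencil p q U i)‖ₑ ≤
      K * ∑ l ∈ Finset.range (p + q), ‖U (i - q + l + 1) - U (i - q + l)‖ₑ := by
    intro i
    have h2 := hM (show stencil p q U i ∈ {w | ∀ j, w j ∈ Ω ∧ ‖w j‖ ≤ C} from
      fun j ↦ ⟨hΩ _, hC _⟩) (show (fun _ ↦ U i) ∈ {w | ∀ j, w j ∈ Ω ∧ ‖w j‖ ≤ C} from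
      fun _ ↦ ⟨hΩ _, hC _⟩)
    rw [h0 _ (hΩ i), edist_zero_right] at h2
    refine h2.trans (mul_le_mul_right ?_ _)
    rw [edist_pi_le_iff]
    intro j
    -- The entry of index `q` in the stencil is `U i` itself, so every entry is compared with it by
    -- telescoping.
    have h3 := edist_le_sum_edist (fun l : ℕ ↦ U (i - q + l)) (n := p + q) (i := j) (j := q)
      (by omega) (by omega)
    rw [sub_add_cancel] at h3
    refine h3.trans (le_of_eq (Finset.sum_congr rfl fun l _ ↦ ?_))
    rw [edist_comm, edist_eq_enorm_sub]
    push_cast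
    rw [add_assoc]
  calc ∑' i, ‖M (stencil p q U i)‖ₑ
      ≤ ∑' i, K * ∑ l ∈ Finset.range (p + q), ‖U (i - q + l + 1) - U (i - q + l)‖ₑ :=
        ENNReal.tsum_le_tsum h1
    _ = K * ∑ l ∈ Finset.range (p + q), ∑' i : ℤ, ‖U (i - q + l + 1) - U (i - q + l)‖ₑ := by
        rw [ENNReal.tsum_mul_left, Summable.tsum_finsetSum fun _ _ ↦ ENNReal.summable]
    _ = K * ((p + q : ℕ) * ∑' i, ‖U (i + 1) - U i‖ₑ) := by
        congr 1
        have h4 : ∀ l : ℕ, ∑' i : ℤ, ‖U (i - q + l + 1) - U (i - q + l)‖ₑ =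
            ∑' i, ‖U (i + 1) - U i‖ₑ := fun l ↦ by
          rw [← (Equiv.addRight ((l : ℤ) - q)).tsum_eq fun i ↦ ‖U (i + 1) - U i‖ₑ]
          refine tsum_congr fun i ↦ ?_
          simp only [Equiv.coe_addRight]
          congr 3 <;> ring_nf
        simp only [h4, Finset.sum_const, Finset.card_range, nsmul_eq_mul]

end Scheme

/-! ### Uniform bounds and time regularity of scheme solutions. -/

section Run

variable {Ω : Set (Phase N)} {A : Phase N → Phase N →L[ℝ] Phase N}
  {Φ : ℝ → Phase N → Phase N → Phase N} {p q : ℕ} {hp : 1 ≤ p}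
  {Mm Mp : ℕ → (Fin (p + q + 1) → Phase N) → Phase N} {C V : ℝ≥0} {dx dt : ℝ}
  {u : ℕ → ℤ → Phase N} {k : ℕ}

/-- A grid function with values in `Ω`, bounded in sup-norm and total variation by `C`. -/
structure IsBoundedRun (Ω : Set (Phase N)) (C : ℝ≥0) (dx dt : ℝ) (u : ℕ → ℤ → Phase N) : Prop where
  dx_pos : 0 < dx
  dt_pos : 0 < dt
  mem : ∀ n i, u n i ∈ Ω
  norm_le : ∀ n i, ‖u n i‖ ≤ C
  variation_le : ∀ n, eVariationOn (cellFun dx (u n)) univ ≤ C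

lemma isBoundedRun_of_approx (hdx : 0 < dx) (hdt : 0 < dt) (hmem : ∀ n i, u n i ∈ Ω)
    (h : ∀ t ≥ (0 : ℝ), (∀ x, ‖approx dx dt u t x‖ ≤ C) ∧ eVariationOn (approx dx dt u t) univ ≤ C) :
    IsBoundedRun Ω C dx dt u := by
  have hfloor : ∀ n : ℕ, ⌊(n * dt) / dt⌋₊ = n := fun n ↦ by
    rw [mul_div_cancel_right₀ _ hdt.ne', Nat.floor_natCast]
  refine ⟨hdx, hdt, hmem, fun n i ↦ ?_, fun n ↦ ?_⟩
  · have h1 := (h (n * dt) (by positivity)).1 (((i - 1 : ℤ) : ℝ) * dx)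
    rw [approx_eq_cellFun, hfloor, cellFun_of_mem hdx ⟨le_rfl, by nlinarith⟩, sub_add_cancel] at h1
    exact h1
  · have h1 := (h (n * dt) (by positivity)).2
    rwa [approx_eq_cellFun, hfloor] at h1

lemma IsBoundedRun.bv (h : IsBoundedRun Ω C dx dt u) (n : ℕ) :
    BoundedVariationOn (cellFun dx (u n)) univ :=
  ((h.variation_le n).trans_lt ENNReal.coe_lt_top).ne

lemma IsBoundedRun.isAdmissible (h : IsBoundedRun Ω C dx dt u) (t : ℝ) :
    IsAdmissible Ω C (approx dx dt u t) :=
  isAdmissible_cellFun h.dx_pos (h.bv _) (h.mem _) (h.norm_le _)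

/-- The sums of the numerical functions over the interfaces are bounded. -/
lemma IsPathConsistent.exists_tsum_le (hM : IsPathConsistent Ω A Φ p q hp Mm Mp) (C : ℝ≥0) :
    ∃ V : ℝ≥0, ∀ k dx dt u, IsBoundedRun Ω C dx dt u → ∀ n,
      ∑' i, ‖Mp k (stencil p q (u n) i)‖ₑ + ∑' i, ‖Mm k (stencil p q (u n) i)‖ₑ ≤ V := by
  obtain ⟨L, hL⟩ := hM.lipschitz C
  refine ⟨2 * (L * ((p + q : ℕ) * C)), fun k dx dt u h n ↦ ?_⟩
  have hle : (L : ℝ≥0∞) * ((p + q : ℕ) * ∑' i, ‖u n (i + 1) - u n i‖ₑ) ≤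
      (L * ((p + q : ℕ) * C) : ℝ≥0) := by
    push_cast
    gcongr
    exact (tsum_enorm_sub_le h.dx_pos).trans (h.variation_le n)
  have h1 := (tsum_enorm_stencil_le (hL k).2 (fun a ha ↦ (hM.consistent k a ha).2) (h.mem n)
    (h.norm_le n)).trans hle
  have h2 := (tsum_enorm_stencil_le (hL k).1 (fun a ha ↦ (hM.consistent k a ha).1) (h.mem n)
    (h.norm_le n)).trans hle
  refine (add_le_add h1 h2).trans (le_of_eq ?_)
  push_cast
  ring

/-- A bounded run whose fluctuations are summable with sum at most `V`, at all times. -/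
structure IsSchemeRun (Ω : Set (Phase N)) (p q : ℕ) (Mm Mp : (Fin (p + q + 1) → Phase N) → Phase N)
    (C V : ℝ≥0) (dx dt : ℝ) (u : ℕ → ℤ → Phase N) : Prop extends IsBoundedRun Ω C dx dt u where
  solution : IsSchemeSolution p q Mm Mp dx dt u
  tsum_le : ∀ n, ∑' i, ‖Mp (stencil p q (u n) i)‖ₑ + ∑' i, ‖Mm (stencil p q (u n) i)‖ₑ ≤ V

variable {Mm Mp : (Fin (p + q + 1) → Phase N) → Phase N}

lemma IsSchemeRun.tsum_fluctuation_le (h : IsSchemeRun Ω p q Mm Mp C V dx dt u) (n : ℕ) :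
    ∑' i, ‖Mp (stencil p q (u n) (i - 1)) + Mm (stencil p q (u n) i)‖ₑ ≤ V := by
  calc ∑' i, ‖Mp (stencil p q (u n) (i - 1)) + Mm (stencil p q (u n) i)‖ₑ
      ≤ ∑' i, (‖Mp (stencil p q (u n) (i - 1))‖ₑ + ‖Mm (stencil p q (u n) i)‖ₑ) :=
        ENNReal.tsum_le_tsum fun i ↦ enorm_add_le _ _
    _ = ∑' i, ‖Mp (stencil p q (u n) i)‖ₑ + ∑' i, ‖Mm (stencil p q (u n) i)‖ₑ := by
        rw [ENNReal.tsum_add, ← (Equiv.subRight (1 : ℤ)).tsum_eq fun i ↦ ‖Mp (stencil p q (u n) i)‖ₑ]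
        rfl
    _ ≤ V := h.tsum_le n

lemma IsSchemeRun.tsum_succ_sub_le (h : IsSchemeRun Ω p q Mm Mp C V dx dt u) (n : ℕ) :
    ∑' i, ‖u (n + 1) i - u n i‖ₑ ≤ ENNReal.ofReal (dt / dx) * V := by
  have hpos : 0 ≤ dt / dx := (div_pos h.dt_pos h.dx_pos).le
  calc ∑' i, ‖u (n + 1) i - u n i‖ₑ = ∑' i, ENNReal.ofReal (dt / dx) *
        ‖Mp (stencil p q (u n) (i - 1)) + Mm (stencil p q (u n) i)‖ₑ := by
        refine tsum_congr fun i ↦ ?_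
        rw [h.solution n i, sub_sub_cancel_left, enorm_neg, enorm_smul,
          Real.enorm_eq_ofReal hpos]
    _ ≤ _ := by
        rw [ENNReal.tsum_mul_left]
        exact mul_le_mul_right (h.tsum_fluctuation_le n) _

lemma IsSchemeRun.tsum_sub_le (h : IsSchemeRun Ω p q Mm Mp C V dx dt u) (n m : ℕ) :
    ∑' i, ‖u (n + m) i - u n i‖ₑ ≤ m * (ENNReal.ofReal (dt / dx) * V) := by
  induction m with
  | zero => simp
  | succ m ih =>
    calc ∑' i, ‖u (n + (m + 1)) i - u n i‖ₑ
        ≤ ∑' i, (‖u (n + m + 1) i - u (n + m) i‖ₑ + ‖u (n + m) i - u n i‖ₑ) := by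
          refine ENNReal.tsum_le_tsum fun i ↦ ?_
          rw [← sub_add_sub_cancel _ (u (n + m) i)]
          exact enorm_add_le _ _
      _ ≤ ENNReal.ofReal (dt / dx) * V + m * (ENNReal.ofReal (dt / dx) * V) := by
          rw [ENNReal.tsum_add]
          exact add_le_add (h.tsum_succ_sub_le _) ih
      _ = _ := by push_cast; ring

lemma IsSchemeRun.lintegral_cellFun_sub_le (h : IsSchemeRun Ω p q Mm Mp C V dx dt u) (n m : ℕ) :
    ∫⁻ x, ‖cellFun dx (u (n + m)) x - cellFun dx (u n) x‖ₑ ≤ ENNReal.ofReal (m * dt) * V := by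
  rw [lintegral_cellFun_sub h.dx_pos]
  refine (mul_le_mul_right (h.tsum_sub_le n m) _).trans (le_of_eq ?_)
  have h1 : ENNReal.ofReal (m * dt) =
      ENNReal.ofReal dx * (m * ENNReal.ofReal (dt / dx)) := by
    rw [← ENNReal.ofReal_natCast, ← ENNReal.ofReal_mul (Nat.cast_nonneg m),
      ← ENNReal.ofReal_mul h.dx_pos.le]
    congr 1
    have := h.dx_pos.ne'
    field_simp
  rw [h1]
  ring

/-- The approximate solutions are Lipschitz continuous in time with values in `L¹`, up to `dt`. -/
lemma IsSchemeRun.lintegral_sub_le (h : IsSchemeRun Ω p q Mm Mp C V dx dt u) {s t : ℝ}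
    (hs : 0 ≤ s) (hst : s ≤ t) :
    ∫⁻ x, ‖approx dx dt u t x - approx dx dt u s x‖ₑ ≤ ENNReal.ofReal (t - s + dt) * V := by
  -- The times `s` and `t` are separated by `m` time steps with `m * dt ≤ t - s + dt`; the extra
  -- `dt` is the rounding of the integer parts.
  obtain ⟨m, hm⟩ := Nat.exists_eq_add_of_le (Nat.floor_mono (div_le_div_of_nonneg_right hst h.dt_pos.le))
  rw [approx_eq_cellFun, approx_eq_cellFun, hm]
  refine (h.lintegral_cellFun_sub_le _ m).trans ?_
  gcongr
  have h1 := Nat.floor_le (div_nonneg (hs.trans hst) h.dt_pos.le)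
  have h2 := Nat.lt_floor_add_one (s / dt)
  rw [hm] at h1
  push_cast at h1
  rw [le_div_iff₀ h.dt_pos] at h1
  rw [div_lt_iff₀ h.dt_pos] at h2
  nlinarith

lemma IsBoundedRun.approx_add_dt (h : IsBoundedRun Ω C dx dt u) {t : ℝ} (ht : 0 ≤ t) :
    approx dx dt u (t + dt) = cellFun dx (u (⌊t / dt⌋₊ + 1)) := by
  rw [approx_eq_cellFun, add_div, div_self h.dt_pos.ne',
    Nat.floor_add_one (div_nonneg ht h.dt_pos.le)]

lemma IsSchemeRun.lintegral_diffQuot_le (h : IsSchemeRun Ω p q Mm Mp C V dx dt u) {t : ℝ}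
    (ht : 0 ≤ t) :
    ∫⁻ x, ‖dt⁻¹ • (approx dx dt u (t + dt) x - approx dx dt u t x)‖ₑ ≤ V := by
  have h1 := h.lintegral_cellFun_sub_le ⌊t / dt⌋₊ 1
  rw [Nat.cast_one, one_mul, ← h.approx_add_dt ht] at h1
  simp only [enorm_smul]
  have hm : Measurable fun x ↦ approx dx dt u (t + dt) x - approx dx dt u t x :=
    measurable_cellFun.sub measurable_cellFun
  rw [lintegral_const_mul _ hm.enorm]
  refine (mul_le_mul_right h1 _).trans (le_of_eq ?_)
  rw [← mul_assoc, Real.enorm_eq_ofReal (inv_nonneg.2 h.dt_pos.le),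
    ← ENNReal.ofReal_mul (inv_nonneg.2 h.dt_pos.le), inv_mul_cancel₀ h.dt_pos.ne',
    ENNReal.ofReal_one, one_mul]

end Run

/-! ### Limits of approximate solutions -/

section Slice

variable {Ω : Set (Phase N)} {A : Phase N → Phase N →L[ℝ] Phase N}
  {Φ : ℝ → Phase N → Phase N → Phase N} {C : ℝ≥0} {f g : ℝ → Phase N}

/-- Functions of bounded variation that agree almost everywhere agree on a dense set, hence have the
same right limits: the representative does not depend on the choice made. -/
lemma bvVersion_eq (hf : BoundedVariationOn f univ) (h : f =ᵐ[volume] g) :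
    bvVersion g = f.rightLim := by
  have hg : HasBVVersion g := ⟨f, hf, h⟩
  rw [bvVersion, dif_pos hg]
  exact rightLim_congr_of_dense hg.choose_spec.1 hf
    (Measure.dense_of_ae (hg.choose_spec.2.trans h.symm)) fun x hx ↦ hx

/-- The function `f` has a right-continuous representative bounded by `C`, with total variation at
most `C` and one-sided limits in `Ω`. -/
structure IsSlice (Ω : Set (Phase N)) (C : ℝ≥0) (f : ℝ → Phase N) : Prop where
  hasBVVersion : HasBVVersion f
  isAdmissible : IsAdmissible Ω C (bvVersion f)
  variation_le : eVariationOn (bvVersion f) univ ≤ C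
  ae_eq : bvVersion f =ᵐ[volume] f

/-- A pointwise limit along an ultrafilter exists everywhere by boundedness, inherits the variation
bound by lower semicontinuity, and equals `f` wherever the sequence converges to `f`. No selection
of a subsequence is needed. -/
lemma isSlice_of_tendsto {U : ℕ → ℝ → Phase N} (hC : ∀ k x, ‖U k x‖ ≤ C)
    (hV : ∀ k, eVariationOn (U k) univ ≤ C)
    (hf : ∀ᵐ x, Tendsto (fun k ↦ U k x) atTop (𝓝 (f x)))
    (hΩ : ∀ x, (bvVersion f).leftLim x ∈ Ω ∧ (bvVersion f).rightLim x ∈ Ω) : IsSlice Ω C f := by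
  set 𝒰 : Ultrafilter ℕ := hyperfilter ℕ
  have h𝒰 : (𝒰 : Filter ℕ) ≤ atTop := by
    rw [← Nat.cofinite_eq_atTop]
    exact hyperfilter_le_cofinite
  obtain ⟨w, hw⟩ := exists_tendsto_ultrafilter 𝒰 hC
  have hwV := eVariationOn_le_of_tendsto hw hV
  have hbv : BoundedVariationOn w univ := (hwV.trans_lt ENNReal.coe_lt_top).ne
  have hae : w =ᵐ[volume] f := by
    filter_upwards [hf] with x hx using tendsto_nhds_unique (hw x) (hx.mono_left h𝒰)
  have heq := bvVersion_eq hbv hae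
  have hrc := isRCBV_rightLim hbv
  have hnorm : ∀ x, ‖w x‖ ≤ C := fun x ↦
    le_of_tendsto (hw x).norm (Eventually.of_forall fun k ↦ hC k x)
  refine ⟨⟨w, hbv, hae⟩, ⟨by rwa [heq], fun x ↦ (hΩ x).1, fun x ↦ ?_, fun x ↦ ?_⟩, ?_, ?_⟩
  · have := (hΩ x).2
    rwa [heq, hrc.rightLim_eq, ← heq] at this
  · rw [heq]
    exact le_of_tendsto (hbv.tendsto_rightLim x).norm (Eventually.of_forall hnorm)
  · rw [heq]
    exact (eVariationOn.eVariationOn_rightLim_le isOpen_univ).trans hwV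
  · rw [heq]
    exact (rightLim_ae_eq hbv).trans hae

lemma tendsto_diffQuot_of_hasDerivWithinAt {E : Type*} [NormedAddCommGroup E] [NormedSpace ℝ E]
    {F : ℝ → E} {F' : E} {s : Set ℝ} {a : ℝ} (h : HasDerivWithinAt F F' s a) {δ : ℕ → ℝ}
    (hδ : ∀ k, 0 < δ k) (hδ0 : Tendsto δ atTop (𝓝 0)) (hs : ∀ᶠ k in atTop, a + δ k ∈ s) :
    Tendsto (fun k ↦ (δ k)⁻¹ • (F (a + δ k) - F a)) atTop (𝓝 F') := by
  have h1 := hasDerivWithinAt_iff_tendsto_slope.1 h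
  have h2 : Tendsto (fun k ↦ a + δ k) atTop (𝓝[s \ {a}] a) := by
    refine tendsto_nhdsWithin_iff.2 ⟨by simpa using tendsto_const_nhds.add hδ0, ?_⟩
    filter_upwards [hs] with k hk
    exact ⟨hk, by simpa using (hδ k).ne'⟩
  refine (h1.comp h2).congr fun k ↦ ?_
  simp [slope_def_module]

lemma IsRCBV.intervalIntegrable (hf : IsRCBV f) (hC : ∀ x, ‖f x‖ ≤ C) (a b : ℝ) :
    IntervalIntegrable f volume a b := by
  exact (intervalIntegrable_const (c := (C : ℝ))).mono_fun' hf.measurable.aestronglyMeasurable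
    (Eventually.of_forall hC)

/-- Point values become limits of averages, which depend only on the class of `f` modulo null sets;
this yields the measurability in time of point values of slices. -/
lemma IsRCBV.tendsto_average (hf : IsRCBV f) (hC : ∀ x, ‖f x‖ ≤ C) (x : ℝ) :
    Tendsto (fun n : ℕ ↦ (1 / ((n : ℝ) + 1))⁻¹ • ∫ y in x..x + 1 / ((n : ℝ) + 1), f y) atTop
      (𝓝 (f x)) := by
  have h := intervalIntegral.integral_hasDerivWithinAt_right
    (hf.intervalIntegrable hC x x) (s := Ici x) (t := Ioi x)
    (hf.measurable.stronglyMeasurable.stronglyMeasurableAtFilter) (hf.tendsto_right x)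
  have := tendsto_diffQuot_of_hasDerivWithinAt h (δ := fun n : ℕ ↦ 1 / ((n : ℝ) + 1))
    (fun n ↦ by positivity) tendsto_one_div_add_atTop_nhds_zero_nat
    (Eventually.of_forall fun n ↦ by simp only [mem_Ici, le_add_iff_nonneg_right]; positivity)
  simpa using this

lemma restrict_halfPlane : (volume : Measure (ℝ × ℝ)).restrict (Ioi (0 : ℝ) ×ˢ (univ : Set ℝ)) =
    (volume.restrict (Ioi (0 : ℝ))).prod volume := by
  rw [Measure.volume_eq_prod, ← Measure.prod_restrict, Measure.restrict_univ]

variable {v : ℝ → ℝ → Phase N}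

lemma aestronglyMeasurable_setIntegral
    (hv : AEStronglyMeasurable (fun z : ℝ × ℝ ↦ v z.1 z.2)
      (volume.restrict (Ioi (0 : ℝ) ×ˢ (univ : Set ℝ)))) (B : Set ℝ) :
    AEStronglyMeasurable (fun t ↦ ∫ x in B, v t x) (volume.restrict (Ioi (0 : ℝ))) := by
  rw [restrict_halfPlane] at hv
  have h1 : AEStronglyMeasurable (fun z : ℝ × ℝ ↦ v z.1 z.2)
      ((volume.restrict (Ioi (0 : ℝ))).prod (volume.restrict B)) :=
    hv.mono_ac (Measure.AbsolutelyContinuous.rfl.prod Measure.absolutelyContinuous_restrict)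
  exact h1.integral_prod_right'

lemma aestronglyMeasurable_intervalIntegral
    (hv : AEStronglyMeasurable (fun z : ℝ × ℝ ↦ v z.1 z.2)
      (volume.restrict (Ioi (0 : ℝ) ×ˢ (univ : Set ℝ)))) (a b : ℝ) :
    AEStronglyMeasurable (fun t ↦ ∫ x in a..b, v t x) (volume.restrict (Ioi (0 : ℝ))) :=
  (aestronglyMeasurable_setIntegral hv _).sub (aestronglyMeasurable_setIntegral hv _)

lemma aestronglyMeasurable_bvVersion
    (hv : AEStronglyMeasurable (fun z : ℝ × ℝ ↦ v z.1 z.2)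
      (volume.restrict (Ioi (0 : ℝ) ×ˢ (univ : Set ℝ))))
    (hs : ∀ᵐ t ∂(volume.restrict (Ioi (0 : ℝ))), IsSlice Ω C (v t)) (x : ℝ) :
    AEStronglyMeasurable (fun t ↦ bvVersion (v t) x) (volume.restrict (Ioi (0 : ℝ))) := by
  refine aestronglyMeasurable_of_tendsto_ae (f := fun (n : ℕ) t ↦
    (1 / ((n : ℝ) + 1))⁻¹ • ∫ y in x..x + 1 / ((n : ℝ) + 1), v t y) atTop (fun n ↦
    (aestronglyMeasurable_intervalIntegral hv _ _).const_smul (1 / ((n : ℝ) + 1))⁻¹) ?_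
  filter_upwards [hs] with t ht
  refine (ht.isAdmissible.tendsto_average ht.isAdmissible.norm_le x).congr fun n ↦ ?_
  congr 1
  exact intervalIntegral.integral_congr_ae (ht.ae_eq.mono fun _ h _ ↦ h)

/-- The product of an interval is a limit of finite sums of path integrals between point values of
the slice, and each such term is measurable in `t`. -/
lemma aestronglyMeasurable_slicedProduct (hD : IsRegularData Ω A Φ)
    (hv : AEStronglyMeasurable (fun z : ℝ × ℝ ↦ v z.1 z.2)
      (volume.restrict (Ioi (0 : ℝ) ×ˢ (univ : Set ℝ))))
    (hs : ∀ᵐ t ∂(volume.restrict (Ioi (0 : ℝ))), IsSlice Ω C (v t)) {a b : ℝ} :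
    AEStronglyMeasurable (fun t ↦ slicedProduct A Φ v t (Ioc a b))
      (volume.restrict (Ioi (0 : ℝ))) := by
  classical
  rcases lt_or_ge b a with hba | hab
  · simpa [Ioc_eq_empty_of_le hba.le] using aestronglyMeasurable_const
  -- The path integral is continuous on `Ω ×ˢ Ω` only and is extended by zero to a Borel function;
  -- the point values of the good slices lie in `Ω`.
  set P : Phase N × Phase N → Phase N := (Ω ×ˢ Ω).piecewise
    (fun z ↦ pathIntegral A Φ z.1 z.2) fun _ ↦ 0 with hP
  have hPm : Measurable P := hD.continuousOn_pathIntegral.measurable_piecewise continuousOn_const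
    (hD.isOpen.prod hD.isOpen).measurableSet
  refine aestronglyMeasurable_of_tendsto_ae (f := fun (n : ℕ) t ↦ ∑ j ∈ Finset.range (n + 1),
    P (bvVersion (v t) (grid a b n j), bvVersion (v t) (grid a b n (j + 1)))) atTop (fun n ↦ ?_) ?_
  · refine Finset.aestronglyMeasurable_fun_sum _ fun j _ ↦ ?_
    exact (hPm.comp_aemeasurable
      ((aestronglyMeasurable_bvVersion hv hs _).aemeasurable.prodMk
        (aestronglyMeasurable_bvVersion hv hs _).aemeasurable)).aestronglyMeasurable
  · filter_upwards [hs] with t ht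
    refine (tendsto_sum_nonconsProduct hD ht.isAdmissible hab).congr fun n ↦
      Finset.sum_congr rfl fun j _ ↦ ?_
    rw [hP, piecewise_eq_of_mem _ _ _ (Set.mk_mem_prod (ht.isAdmissible.mem _)
      (ht.isAdmissible.mem _))]

lemma vectorMeasure_tendsto_Ioo (m : VectorMeasure ℝ (Phase N)) (a b : ℝ) :
    Tendsto (fun n : ℕ ↦ m (Ioc a (b - 1 / ((n : ℝ) + 1)))) atTop (𝓝 (m (Ioo a b))) := by
  have h := m.tendsto_vectorMeasure_iUnion_atTop_nat
    (s := fun n : ℕ ↦ Ioc a (b - 1 / ((n : ℝ) + 1))) ?_ fun _ ↦ measurableSet_Ioc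
  · convert! h using 3
    ext x
    simp only [mem_Ioo, mem_iUnion, mem_Ioc]
    constructor
    · rintro ⟨h1, h2⟩
      obtain ⟨n, hn⟩ := exists_nat_one_div_lt (sub_pos.2 h2)
      exact ⟨n, h1, by linarith⟩
    · rintro ⟨n, h1, h2⟩
      have : 0 < 1 / ((n : ℝ) + 1) := by positivity
      exact ⟨h1, by linarith⟩
  · intro n k hnk
    exact Ioc_subset_Ioc_right (sub_le_sub_left (one_div_le_one_div_of_le (by positivity)
      (by gcongr)) _)

/-- The nonconservative products of the slices form a bounded family of measures. -/
lemma isBoundedMeasureFamily_slicedProduct (hD : IsRegularData Ω A Φ)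
    (hv : AEStronglyMeasurable (fun z : ℝ × ℝ ↦ v z.1 z.2)
      (volume.restrict (Ioi (0 : ℝ) ×ˢ (univ : Set ℝ))))
    (hs : ∀ᵐ t ∂(volume.restrict (Ioi (0 : ℝ))), IsSlice Ω C (v t)) :
    IsBoundedMeasureFamily (slicedProduct A Φ v) where
  measurable B hB := aestronglyMeasurable_of_Ioo (fun a b _ ↦
    aestronglyMeasurable_of_tendsto_ae atTop
      (fun _ ↦ aestronglyMeasurable_slicedProduct hD hv hs)
      (Eventually.of_forall fun _ ↦ vectorMeasure_tendsto_Ioo _ _ _)) hB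
  bounded := by
    obtain ⟨c, hc⟩ := hD.bound C
    refine ⟨c * C, ?_⟩
    filter_upwards [hs] with t ht
    refine (variation_nonconsProduct_le hD hc ht.isAdmissible univ).trans ?_
    rw [Measure.smul_apply, ENNReal.coe_mul]
    exact mul_le_mul_right (ht.isAdmissible.measure_univ_le.trans ht.variation_le) (c : ℝ≥0∞)

end Slice

/-! ### The time derivative of the limit -/

section TimeDerivative

variable {Ω : Set (Phase N)} {C V : ℝ≥0} {v : ℝ → ℝ → Phase N} {E : Set ℝ} {s t : ℝ}

/-- A family of slices that is Lipschitz continuous in time, for times in `E`, with values in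
`L¹`. -/
structure IsLipschitzFamily (Ω : Set (Phase N)) (C V : ℝ≥0) (v : ℝ → ℝ → Phase N) (E : Set ℝ) :
    Prop where
  measurable : AEStronglyMeasurable (fun z : ℝ × ℝ ↦ v z.1 z.2)
    (volume.restrict (Ioi (0 : ℝ) ×ˢ (univ : Set ℝ)))
  ae_norm_le : ∀ᵐ z ∂(volume.restrict (Ioi (0 : ℝ) ×ˢ (univ : Set ℝ))), ‖v z.1 z.2‖ ≤ C
  ae_mem : ∀ᵐ t ∂(volume.restrict (Ioi (0 : ℝ))), t ∈ E
  isSlice : ∀ t ∈ E, IsSlice Ω C (v t)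
  lintegral_le : ∀ s ∈ E, ∀ t ∈ E, s ≤ t → ∫⁻ x, ‖v t x - v s x‖ₑ ≤ ENNReal.ofReal (t - s) * V

lemma IsSlice.aestronglyMeasurable {f : ℝ → Phase N} (h : IsSlice Ω C f) :
    AEStronglyMeasurable f volume :=
  h.isAdmissible.measurable.aestronglyMeasurable.congr h.ae_eq

lemma IsSlice.ae_norm_le {f : ℝ → Phase N} (h : IsSlice Ω C f) : ∀ᵐ x, ‖f x‖ ≤ C := by
  filter_upwards [h.ae_eq] with x hx
  rw [← hx]
  exact h.isAdmissible.norm_le x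

lemma IsSlice.intervalIntegrable {f : ℝ → Phase N} (h : IsSlice Ω C f) (a b : ℝ) :
    IntervalIntegrable f volume a b :=
  (intervalIntegrable_const (c := (C : ℝ))).mono_fun' h.aestronglyMeasurable.restrict
    (ae_restrict_of_ae h.ae_norm_le)

namespace IsLipschitzFamily

variable (h : IsLipschitzFamily Ω C V v E)
include h

lemma integrable_sub (hs : s ∈ E) (ht : t ∈ E) (hst : s ≤ t) :
    Integrable fun x ↦ v t x - v s x :=
  ⟨(h.isSlice t ht).aestronglyMeasurable.sub (h.isSlice s hs).aestronglyMeasurable,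
    (h.lintegral_le s hs t ht hst).trans_lt (by finiteness)⟩

lemma norm_integral_sub_le (hs : s ∈ E) (ht : t ∈ E) (hst : s ≤ t) (r : ℝ) :
    ‖(∫ x in (0 : ℝ)..r, v t x) - ∫ x in (0 : ℝ)..r, v s x‖ ≤ V * (t - s) := by
  have hi := h.integrable_sub hs ht hst
  rw [← intervalIntegral.integral_sub ((h.isSlice t ht).intervalIntegrable _ _)
    ((h.isSlice s hs).intervalIntegrable _ _)]
  refine intervalIntegral.norm_integral_le_integral_norm_uIoc.trans
      ((setIntegral_le_integral hi.norm (Eventually.of_forall fun _ ↦ norm_nonneg _)).trans ?_)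
  rw [integral_norm_eq_lintegral_enorm hi.aestronglyMeasurable]
  refine (ENNReal.toReal_mono (by finiteness) (h.lintegral_le s hs t ht hst)).trans (le_of_eq ?_)
  rw [ENNReal.toReal_mul, ENNReal.toReal_ofReal (sub_nonneg.2 hst), mul_comm]
  rfl

lemma lipschitzOnWith_integral (r : ℝ) :
    LipschitzOnWith V (fun t ↦ ∫ x in (0 : ℝ)..r, v t x) E := by
  refine LipschitzOnWith.of_dist_le_mul fun s hs t ht ↦ ?_
  rw [dist_eq_norm, Real.dist_eq]
  rcases le_total s t with hst | hst
  · rw [norm_sub_rev, abs_sub_comm, abs_of_nonneg (sub_nonneg.2 hst)]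
    exact h.norm_integral_sub_le hs ht hst r
  · rw [abs_of_nonneg (sub_nonneg.2 hst)]
    exact h.norm_integral_sub_le ht hs hst r

/-- Translations preserve null sets, so almost every good time stays good after a fixed shift; this
makes difference quotients meaningful although `E` need not contain intervals. -/
lemma ae_add_mem {δ : ℝ} (hδ : 0 < δ) : ∀ᵐ t ∂(volume.restrict (Ioi (0 : ℝ))), t + δ ∈ E := by
  have h1 : MapsTo (fun t ↦ t + δ) (Ioi (0 : ℝ)) (Ioi 0) := fun t ht ↦ add_pos ht hδ
  exact (((measurePreserving_add_right volume δ).quasiMeasurePreserving).restrict h1).ae h.ae_mem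

lemma aestronglyMeasurable_add {δ : ℝ} (hδ : 0 < δ) :
    AEStronglyMeasurable (fun z : ℝ × ℝ ↦ v (z.1 + δ) z.2)
      (volume.restrict (Ioi (0 : ℝ) ×ˢ (univ : Set ℝ))) := by
  have h1 : MapsTo (fun z : ℝ × ℝ ↦ z + (δ, 0)) (Ioi (0 : ℝ) ×ˢ univ) (Ioi (0 : ℝ) ×ˢ univ) :=
    fun z hz ↦ ⟨add_pos hz.1 hδ, mem_univ _⟩
  have h2 := h.measurable.comp_quasiMeasurePreserving
    (((measurePreserving_add_right volume ((δ, 0) : ℝ × ℝ)).quasiMeasurePreserving).restrict h1)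
  refine h2.congr (Eventually.of_forall fun z ↦ ?_)
  simp

/-- The difference quotients in time, with steps `1 / (n + 1)`. -/
lemma aestronglyMeasurable_integral_diffQuot {φ : ℝ → ℝ → ℝ}
    (hφ : Continuous fun z : ℝ × ℝ ↦ φ z.1 z.2) {δ : ℝ} (hδ : 0 < δ) :
    AEStronglyMeasurable (fun t ↦ ∫ x, φ t x • δ⁻¹ • (v (t + δ) x - v t x))
      (volume.restrict (Ioi (0 : ℝ))) := by
  have h1 : AEStronglyMeasurable (fun z : ℝ × ℝ ↦
      φ z.1 z.2 • δ⁻¹ • (v (z.1 + δ) z.2 - v z.1 z.2))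
      (volume.restrict (Ioi (0 : ℝ) ×ˢ (univ : Set ℝ))) :=
    hφ.aestronglyMeasurable.smul (((h.aestronglyMeasurable_add hδ).sub h.measurable).const_smul δ⁻¹)
  rw [restrict_halfPlane] at h1
  exact h1.integral_prod_right'

lemma lintegral_diffQuot_le {δ : ℝ} (hδ : 0 < δ) (ht : t ∈ E) (htδ : t + δ ∈ E) :
    ∫⁻ x, ‖δ⁻¹ • (v (t + δ) x - v t x)‖ₑ ≤ V := by
  have h1 := h.lintegral_le t ht (t + δ) htδ (by linarith)
  rw [add_sub_cancel_left] at h1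
  simp only [enorm_smul]
  rw [lintegral_const_mul'' _
    (h.integrable_sub ht htδ (by linarith)).aestronglyMeasurable.enorm]
  refine (mul_le_mul_right h1 _).trans (le_of_eq ?_)
  rw [← mul_assoc, Real.enorm_eq_ofReal (inv_nonneg.2 hδ.le),
    ← ENNReal.ofReal_mul (inv_nonneg.2 hδ.le), inv_mul_cancel₀ hδ.ne', ENNReal.ofReal_one, one_mul]

/-- At almost all times the difference quotients converge weakly to a measure. -/
lemma ae_exists_weak_limit {δ : ℕ → ℝ} (hδ : ∀ n, 0 < δ n) (hδ0 : Tendsto δ atTop (𝓝 0)) :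
    ∀ᵐ t ∂(volume.restrict (Ioi (0 : ℝ))), ∃ m : VectorMeasure ℝ (Phase N), m.variation univ ≤ V ∧
      ∀ φ : ℝ → ℝ, Continuous φ → ∀ R, 0 ≤ R → (∀ x, R < |x| → φ x = 0) →
        Tendsto (fun n ↦ ∫ x, φ x • (δ n)⁻¹ • (v (t + δ n) x - v t x)) atTop
          (𝓝 (pairing m φ)) := by
  -- The primitives are Lipschitz on `E` only, so differentiability is obtained within `E`. The
  -- within-derivative is usable along the steps `δ n` since `t + δ n ∈ E` for a.e. `t`.
  have hdiff : ∀ᵐ t ∂(volume.restrict (Ioi (0 : ℝ))), ∀ r : ℚ, t ∈ E →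
      DifferentiableWithinAt ℝ (fun t ↦ ∫ x in (0 : ℝ)..r, v t x) E t :=
    ae_all_iff.2 fun r ↦ ae_restrict_of_ae
      (h.lipschitzOnWith_integral r).locallyBoundedVariationOn.ae_differentiableWithinAt_of_mem
  filter_upwards [hdiff, h.ae_mem, ae_all_iff.2 fun n ↦ h.ae_add_mem (hδ n)] with t h1 ht h2
  refine exists_weak_limit (fun n ↦ ?_) (fun n ↦ h.lintegral_diffQuot_le (hδ n) ht (h2 n))
    fun r ↦ ⟨_, (tendsto_diffQuot_of_hasDerivWithinAt (h1 r ht).hasDerivWithinAt hδ hδ0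
      (Eventually.of_forall h2)).congr fun n ↦ ?_⟩
  · exact (h.integrable_sub ht (h2 n) (by linarith [hδ n])).smul (δ n)⁻¹
  · rw [intervalIntegral.integral_smul,
      intervalIntegral.integral_sub ((h.isSlice _ (h2 n)).intervalIntegrable _ _)
      ((h.isSlice _ ht).intervalIntegrable _ _)]

/-- The distributional derivative in time is a bounded family of measures. -/
lemma exists_timeDerivative : ∃ m : ℝ → VectorMeasure ℝ (Phase N), IsBoundedMeasureFamily m ∧
    ∀ φ, IsTestFunction φ →
      -(∫ t in Ioi (0 : ℝ), ∫ x, deriv (fun r ↦ φ r x) t • v t x) =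
        ∫ t in Ioi (0 : ℝ), pairing (m t) (φ t) := by
  classical
  set δ : ℕ → ℝ := fun n ↦ 1 / ((n : ℝ) + 1)
  have hδ : ∀ n, 0 < δ n := fun n ↦ by positivity
  have hδ0 : Tendsto δ atTop (𝓝 0) := tendsto_one_div_add_atTop_nhds_zero_nat
  have hlim := h.ae_exists_weak_limit hδ hδ0
  have hne : (ae (volume.restrict (Ioi (0 : ℝ)))).NeBot :=
    ae_neBot.2 fun h0 ↦ by simpa using Measure.restrict_eq_zero.1 h0
  -- The measure is chosen separately at each time. Its measurability in `t` is recovered afterwards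
  -- from the pairings with bumps, which are limits of measurable functions.
  obtain ⟨m, hm⟩ := hlim.choice
  have hfin : ∀ᵐ t ∂(volume.restrict (Ioi (0 : ℝ))), IsFiniteMeasure (m t).variation := by
    filter_upwards [hm] with t ht using ⟨ht.1.trans_lt ENNReal.coe_lt_top⟩
  refine ⟨m, ⟨fun B hB ↦ aestronglyMeasurable_of_Ioo (fun a b hab ↦ ?_) hB, V, ?_⟩, fun φ hφ ↦ ?_⟩
  · have hab' : (a : ℝ) < b := by exact_mod_cast hab
    refine aestronglyMeasurable_of_tendsto_ae atTop
      (f := fun k t ↦ pairing (m t) (intervalBump hab' k)) (fun k ↦ ?_) ?_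
    · refine aestronglyMeasurable_of_tendsto_ae atTop (fun n ↦
        h.aestronglyMeasurable_integral_diffQuot (φ := fun _ ↦ intervalBump hab' k)
          ((intervalBump hab' k).continuous.comp continuous_snd) (hδ n)) ?_
      filter_upwards [hm] with t ht
      refine ht.2 _ (intervalBump hab' k).continuous (max |(a : ℝ)| |(b : ℝ)|) (by positivity)
        fun x hx ↦ (intervalBump hab' k).zero_of_le_dist ?_
      rw [Real.dist_eq]
      by_contra! hcon
      have h1 : (intervalBump hab' k).rOut = ((b : ℝ) - a) / 2 := rfl
      rw [h1, abs_lt] at hcon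
      refine absurd hx (not_lt.2 (abs_le_max_abs_abs ?_ ?_)) <;> linarith [hcon.1, hcon.2]
    · filter_upwards [hfin] with t ht
      exact tendsto_pairing_intervalBump hab'
  · filter_upwards [hm] with t ht using ht.1
  · obtain ⟨T, R, M, L, hd⟩ := hφ.exists_isTestData
    -- The constant sequence `v` is used: its own difference quotients converge to the
    -- distributional derivative.
    have h1 := tendsto_integral_diffQuot (f := fun _ z ↦ v z.1 z.2) (v := fun z ↦ v z.1 z.2) hδ hδ0
      (fun _ ↦ h.measurable) (fun _ ↦ h.ae_norm_le) (Eventually.of_forall fun _ ↦ tendsto_const_nhds) hφ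
    refine tendsto_nhds_unique h1 ?_
    refine tendsto_integral_of_dominated_convergence ((Ioc 0 T).indicator fun _ ↦ M * V)
      (fun n ↦ h.aestronglyMeasurable_integral_diffQuot hφ.1.continuous (hδ n))
      (((integrable_indicator_iff measurableSet_Ioc).2 (integrableOn_const (by simp))).integrableOn)
      (fun n ↦ ?_) ?_
    · filter_upwards [h.ae_mem, h.ae_add_mem (hδ n), ae_restrict_mem measurableSet_Ioi] with t h2 h3 h4
      by_cases htT : t ≤ T
      · rw [indicator_of_mem (show t ∈ Ioc 0 T from ⟨h4, htT⟩)]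
        have hi : Integrable fun x ↦ (δ n)⁻¹ • (v (t + δ n) x - v t x) :=
          (h.integrable_sub h2 h3 (by linarith [hδ n])).smul (δ n)⁻¹
        refine (norm_integral_smul_le hi (hd.bound t)).trans ?_
        gcongr
        · exact hd.pos.2.2.1
        · exact integral_norm_le_of_lintegral_le hi (h.lintegral_diffQuot_le (hδ n) h2 h3)
      · rw [indicator_of_notMem fun h : t ∈ Ioc 0 T ↦ htT h.2]
        simp [hd.zero_of_lt t (not_le.1 htT)]
    · filter_upwards [hm] with t ht
      exact ht.2 _ (hφ.continuous_right t) R hd.pos.2.1.le (hd.zero_of_abs t)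

end IsLipschitzFamily

end TimeDerivative

/-! ### The equation satisfied by the limit -/

section Convergence

variable {Ω : Set (Phase N)} {A : Phase N → Phase N →L[ℝ] Phase N}
  {Φ : ℝ → Phase N → Phase N → Phase N} {p q : ℕ}
  {Mm Mp : ℕ → (Fin (p + q + 1) → Phase N) → Phase N} {C V : ℝ≥0} {dx dt : ℕ → ℝ}
  {u : ℕ → ℕ → ℤ → Phase N} {v : ℝ → ℝ → Phase N}

/-- A uniformly bounded sequence of scheme solutions, on meshes that tend to zero, that converges
almost everywhere to `v`. -/
structure IsConvergentScheme (Ω : Set (Phase N)) (p q : ℕ)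
    (Mm Mp : ℕ → (Fin (p + q + 1) → Phase N) → Phase N) (C V : ℝ≥0) (dx dt : ℕ → ℝ)
    (u : ℕ → ℕ → ℤ → Phase N) (v : ℝ → ℝ → Phase N) : Prop where
  run : ∀ k, IsSchemeRun Ω p q (Mm k) (Mp k) C V (dx k) (dt k) (u k)
  tendsto_dx : Tendsto dx atTop (𝓝 0)
  tendsto_dt : Tendsto dt atTop (𝓝 0)
  tendsto_ae : ∀ᵐ z : ℝ × ℝ ∂(volume.restrict (Ioi (0 : ℝ) ×ˢ (univ : Set ℝ))),
    Tendsto (fun k ↦ approx (dx k) (dt k) (u k) z.1 z.2) atTop (𝓝 (v z.1 z.2))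
  limit_mem : ∀ᵐ t ∂(volume.restrict (Ioi (0 : ℝ))), ∀ x,
    (bvVersion (v t)).leftLim x ∈ Ω ∧ (bvVersion (v t)).rightLim x ∈ Ω

/-- The times at which the approximate solutions converge almost everywhere in space. -/
def convergenceTimes (Ω : Set (Phase N)) (dx dt : ℕ → ℝ) (u : ℕ → ℕ → ℤ → Phase N)
    (v : ℝ → ℝ → Phase N) : Set ℝ :=
  {t | 0 < t ∧ (∀ᵐ x, Tendsto (fun k ↦ approx (dx k) (dt k) (u k) t x) atTop (𝓝 (v t x))) ∧
    ∀ x, (bvVersion (v t)).leftLim x ∈ Ω ∧ (bvVersion (v t)).rightLim x ∈ Ω}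

lemma lintegral_enorm_le_of_tendsto {f : ℕ → ℝ → Phase N} {g : ℝ → Phase N} {b : ℕ → ℝ≥0∞}
    {c : ℝ≥0∞} (hf : ∀ k, AEMeasurable (fun x ↦ ‖f k x‖ₑ))
    (hlim : ∀ᵐ x, Tendsto (fun k ↦ f k x) atTop (𝓝 (g x))) (hb : ∀ k, ∫⁻ x, ‖f k x‖ₑ ≤ b k)
    (hbc : Tendsto b atTop (𝓝 c)) : ∫⁻ x, ‖g x‖ₑ ≤ c := by
  calc ∫⁻ x, ‖g x‖ₑ = ∫⁻ x, liminf (fun k ↦ ‖f k x‖ₑ) atTop :=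
        lintegral_congr_ae (by filter_upwards [hlim] with x hx using hx.enorm.liminf_eq.symm)
    _ ≤ liminf (fun k ↦ ∫⁻ x, ‖f k x‖ₑ) atTop := lintegral_liminf_le' hf
    _ ≤ liminf b atTop := liminf_le_liminf (Eventually.of_forall hb)
    _ = c := hbc.liminf_eq

namespace IsConvergentScheme

variable (h : IsConvergentScheme Ω p q Mm Mp C V dx dt u v)
include h

/-- Fatou's lemma transfers the L¹ bounds in time of the approximate solutions to the limit; the
rounding term `dt k` disappears. -/
lemma isLipschitzFamily :
    IsLipschitzFamily Ω C V v (convergenceTimes Ω dx dt u v) where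
  measurable := aestronglyMeasurable_of_tendsto_ae atTop
    (fun k ↦ (measurable_approx (dx k) (dt k) (u k)).aestronglyMeasurable) h.tendsto_ae
  ae_norm_le := by
    filter_upwards [h.tendsto_ae] with z hz
    exact le_of_tendsto hz.norm (Eventually.of_forall fun k ↦ (h.run k).norm_le _ _)
  ae_mem := by
    have h1 := h.tendsto_ae
    rw [restrict_halfPlane] at h1
    filter_upwards [Measure.ae_ae_of_ae_prod h1, h.limit_mem,
      ae_restrict_mem measurableSet_Ioi] with t h2 h3 h4 using ⟨h4, h2, h3⟩
  isSlice t ht := isSlice_of_tendsto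
    (U := fun k ↦ approx (dx k) (dt k) (u k) t) (fun k _ ↦ (h.run k).norm_le _ _)
    (fun k ↦ (h.run k).variation_le _) ht.2.1 ht.2.2
  lintegral_le s hs t ht hst := by
    refine lintegral_enorm_le_of_tendsto
      (f := fun k x ↦ approx (dx k) (dt k) (u k) t x - approx (dx k) (dt k) (u k) s x)
      (fun k ↦ ?_) ?_ (fun k ↦ (h.run k).lintegral_sub_le hs.1.le hst) ?_
    · exact (measurable_cellFun.sub measurable_cellFun).enorm.aemeasurable
    · filter_upwards [hs.2.1, ht.2.1] with x h1 h2 using h2.sub h1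
    · refine ENNReal.Tendsto.mul_const (ENNReal.tendsto_ofReal ?_) (Or.inr ENNReal.coe_ne_top)
      simpa using tendsto_const_nhds.add h.tendsto_dt

lemma ae_isSlice : ∀ᵐ t ∂(volume.restrict (Ioi (0 : ℝ))), IsSlice Ω C (v t) := by
  filter_upwards [h.isLipschitzFamily.ae_mem] with t ht using h.isLipschitzFamily.isSlice t ht

lemma solvesWithSource (hD : IsRegularData Ω A Φ) {m : ℝ → VectorMeasure ℝ (Phase N)}
    (hm : ∀ φ : ℝ → ℝ → ℝ, IsTestFunction φ →
      -(∫ t in Ioi (0 : ℝ), ∫ x, deriv (fun r ↦ φ r x) t • v t x)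
      + ∫ t in Ioi (0 : ℝ), pairing (slicedProduct A Φ v t) (φ t)
      = ∫ t in Ioi (0 : ℝ), pairing (m t) (φ t)) : SolvesWithSource A Φ v m where
  measurable := h.isLipschitzFamily.measurable
  bounded := ⟨C, h.isLipschitzFamily.ae_norm_le⟩
  bv := ⟨C, h.ae_isSlice.mono fun _ ht ↦ ⟨ht.hasBVVersion, ht.variation_le⟩⟩
  product := isBoundedMeasureFamily_slicedProduct hD h.isLipschitzFamily.measurable h.ae_isSlice
  equation := hm

/-- The limit satisfies the equation up to a measure source-term. -/
lemma exists_solvesWithSource (hD : IsRegularData Ω A Φ) :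
    ∃ m : ℝ → VectorMeasure ℝ (Phase N), IsBoundedMeasureFamily m ∧ SolvesWithSource A Φ v m := by
  obtain ⟨m, hm, hmφ⟩ := h.isLipschitzFamily.exists_timeDerivative
  have hP := isBoundedMeasureFamily_slicedProduct hD h.isLipschitzFamily.measurable h.ae_isSlice
  -- The convergence error is by definition v_t plus the nonconservative product; nothing about the
  -- limit of the products of the approximate solutions is needed.
  refine ⟨fun t ↦ m t + slicedProduct A Φ v t, ⟨fun B hB ↦ ?_, ?_⟩,
    h.solvesWithSource hD fun φ hφ ↦ ?_⟩
  · exact (hm.measurable B hB).add (hP.measurable B hB)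
  · obtain ⟨C₁, h₁⟩ := hm.bounded
    obtain ⟨C₂, h₂⟩ := hP.bounded
    refine ⟨C₁ + C₂, ?_⟩
    filter_upwards [h₁, h₂] with t h3 h4
    push_cast
    exact (VectorMeasure.variation_add_le univ).trans (add_le_add h3 h4)
  · rw [hmφ φ hφ, ← integral_add (hm.integrableOn_pairing hφ) (hP.integrableOn_pairing hφ)]
    obtain ⟨T, R, M, L, hd⟩ := hφ.exists_isTestData
    refine integral_congr_ae ?_
    filter_upwards [hm.isFiniteMeasure, hP.isFiniteMeasure] with t h3 h4
    exact (VectorMeasure.integral_add_vectorMeasure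
      (integrable_variation (hφ.continuous_right t).measurable (hd.bound t))
      (integrable_variation (hφ.continuous_right t).measurable (hd.bound t))).symm

end IsConvergentScheme

end Convergence

/-! ### Nonconservative products as integrals along graph completions -/

section CurveSum

variable {Ω : Set (Phase N)} {A : Phase N → Phase N →L[ℝ] Phase N}
  {Φ : ℝ → Phase N → Phase N → Phase N} {w : ℝ → Phase N} {K : Set (Phase N)} {k : ℝ≥0}
  {R a b : ℝ} {φ : ℝ → ℝ}

/-- The velocity of the graph completion, multiplied by `A`. -/
def curveDensity (A : Phase N → Phase N →L[ℝ] Phase N) (Φ : ℝ → Phase N → Phase N → Phase N)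
    (w : ℝ → Phase N) (s : ℝ) : Phase N :=
  A (graphValue Φ w s) (deriv (graphValue Φ w) s)

lemma intervalIntegrable_smul_curveDensity {ξ : ℝ → ℝ} {C : ℝ} (hD : IsRegularData Ω A Φ)
    (hw : IsRCBV w) (h : HasSpeedOn Ω Φ w K k a b) {x y : ℝ} (hx : a ≤ x) (hxy : x ≤ y) (hy : y ≤ b)
    (hξ : Measurable ξ) (hC : ∀ x, |ξ x| ≤ C) :
    IntervalIntegrable (fun s ↦ ξ (graphAbscissa w s) • curveDensity A Φ w s) volume
      (graphLength w x) (graphLength w y) := by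
  have hi := intervalIntegrable_curve hD hw h hx hxy hy
  have hle := hw.strictMono_graphLength.monotone hxy
  rw [intervalIntegrable_iff_integrableOn_Ioc_of_le hle] at hi ⊢
  exact hi.bdd_smul C (hξ.comp hw.continuous_graphAbscissa.measurable).aestronglyMeasurable
    (Eventually.of_forall fun _ ↦ hC _)

lemma abs_stepFun_le {C : ℝ} (hC : ∀ x, |φ x| ≤ C) (hab : a ≤ b) (n : ℕ) (x : ℝ) :
    |stepFun φ a b n x| ≤ C := by
  by_cases hx : x ∈ Ioc a b
  · obtain ⟨j, hj, hxj⟩ := exists_mem_Ioc_grid n hx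
    rw [stepFun_of_mem hab hj hxj]
    exact hC _
  · rw [stepFun_of_notMem hab hx, abs_zero]
    exact (abs_nonneg _).trans (hC 0)

/-- The abscissa of `s` lies in a half-open grid cell exactly when `s` lies in the half-open
interval between the graph lengths of its end points, so the step function is constant along each
piece of the curve. -/
lemma sum_curveIntegral_eq {C : ℝ} (hD : IsRegularData Ω A Φ) (hw : IsRCBV w)
    (h : HasSpeedOn Ω Φ w K k a b) (hab : a ≤ b) (hC : ∀ x, |φ x| ≤ C) (n : ℕ) :
    ∑ j ∈ Finset.range (n + 1),
      φ (grid a b n j) • curveIntegral A Φ w (grid a b n j) (grid a b n (j + 1)) =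
    ∫ s in graphLength w a..graphLength w b,
      stepFun φ a b n (graphAbscissa w s) • curveDensity A Φ w s := by
  have hmono := monotone_grid hab n
  have hsum := intervalIntegral.sum_integral_adjacent_intervals
    (f := fun s ↦ stepFun φ a b n (graphAbscissa w s) • curveDensity A Φ w s) (μ := volume)
    (a := fun j ↦ graphLength w (grid a b n j)) (n := n + 1) fun j hj ↦
      intervalIntegrable_smul_curveDensity hD hw h (grid_mem_Icc hab hj.le).1 (hmono (Nat.le_succ j))
        (grid_mem_Icc hab hj).2 measurable_stepFun (abs_stepFun_le hC hab n)
  rw [grid_zero, grid_last] at hsum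
  rw [← hsum]
  refine Finset.sum_congr rfl fun j hj ↦ ?_
  rw [curveIntegral, ← intervalIntegral.integral_smul]
  refine intervalIntegral.integral_congr_ae (Eventually.of_forall fun s hs ↦ ?_)
  rw [uIoc_of_le (hw.strictMono_graphLength.monotone (hmono (Nat.le_succ j)))] at hs
  have hX : graphAbscissa w s ∈ Ioc (grid a b n j) (grid a b n (j + 1)) :=
    ⟨hw.lt_graphAbscissa_iff.2 hs.1, hw.graphAbscissa_le_iff.2 hs.2⟩
  rw [stepFun_of_mem hab (Finset.mem_range.1 hj) hX]
  rfl

/-- The integral of a function against the nonconservative product, as an integral along the graph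
completion. -/
lemma pairing_nonconsProduct_eq (hD : IsRegularData Ω A Φ) (hw : IsAdmissible Ω R w)
    (h : HasSpeedOn Ω Φ w K k a b) (hK : IsCompact K) (hab : a ≤ b) (hφ : Continuous φ)
    (h0 : ∀ x ∉ Ioc a b, φ x = 0) : pairing (nonconsProduct A Φ w) φ =
      ∫ s in graphLength w a..graphLength w b, φ (graphAbscissa w s) • curveDensity A Φ w s := by
  obtain ⟨c, hc⟩ := hD.bound R
  have hfin : IsFiniteMeasure (nonconsProduct A Φ w).variation :=
    isFiniteMeasure_of_le _ (variation_nonconsProduct_le hD hc hw)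
  have hcs : HasCompactSupport φ := HasCompactSupport.intro isCompact_Icc
    fun x hx ↦ h0 x fun h ↦ hx (Ioc_subset_Icc_self h)
  obtain ⟨C, hC⟩ := hcs.exists_bound_of_continuous hφ
  refine tendsto_nhds_unique (tendsto_sum_pairing hφ hab h0) ?_
  have heq : ∀ n, ∑ j ∈ Finset.range (n + 1),
      φ (grid a b n j) • nonconsProduct A Φ w (Ioc (grid a b n j) (grid a b n (j + 1))) =
      ∫ s in graphLength w a..graphLength w b,
        stepFun φ a b n (graphAbscissa w s) • curveDensity A Φ w s := by
    intro n
    rw [← sum_curveIntegral_eq hD hw.toIsRCBV h hab hC]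
    refine Finset.sum_congr rfl fun j hj ↦ ?_
    have hj' := Finset.mem_range.1 hj
    rw [nonconsProduct_Ioc_eq_curveIntegral hD hw
      (h.mono (grid_mem_Icc hab hj'.le).1 (grid_mem_Icc hab hj').2) hK
      (monotone_grid hab n (Nat.le_succ j))]
  simp only [heq]
  have hle := hw.strictMono_graphLength.monotone hab
  have hi := intervalIntegrable_curve hD hw.toIsRCBV h le_rfl hab le_rfl
  rw [Metric.tendsto_atTop']
  intro ε hε
  set I := ∫ s in graphLength w a..graphLength w b, ‖curveDensity A Φ w s‖ with hI
  have hI0 : 0 ≤ I := intervalIntegral.integral_nonneg hle fun _ _ ↦ norm_nonneg _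
  obtain ⟨n₀, hn₀⟩ := eventually_atTop.1 (exists_forall_abs_sub_stepFun_le
    (hcs.uniformContinuous_of_continuous hφ) hab (show 0 < ε / (I + 1) by positivity) h0)
  refine ⟨n₀, fun n hn ↦ ?_⟩
  rw [dist_comm, dist_eq_norm, ← intervalIntegral.integral_sub
    (intervalIntegrable_smul_curveDensity hD hw.toIsRCBV h le_rfl hab le_rfl hφ.measurable hC)
    (intervalIntegrable_smul_curveDensity hD hw.toIsRCBV h le_rfl hab le_rfl measurable_stepFun
      (abs_stepFun_le hC hab n))]
  have hb : ‖∫ s in graphLength w a..graphLength w b, (φ (graphAbscissa w s) • curveDensity A Φ w s -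
      stepFun φ a b n (graphAbscissa w s) • curveDensity A Φ w s)‖ ≤
      ∫ s in graphLength w a..graphLength w b, ε / (I + 1) * ‖curveDensity A Φ w s‖ := by
    refine intervalIntegral.norm_integral_le_of_norm_le hle (Eventually.of_forall fun s _ ↦ ?_)
      (hi.norm.const_mul _)
    rw [← sub_smul, norm_smul]
    exact mul_le_mul_of_nonneg_right (hn₀ n hn.le _) (norm_nonneg _)
  rw [intervalIntegral.integral_const_mul, ← hI] at hb
  refine hb.trans_lt ?_
  rw [div_mul_eq_mul_div, div_lt_iff₀ (by positivity)]
  nlinarith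

/-- Approximation of integrals along Lipschitz curves by Riemann sums. -/
lemma norm_integral_clm_deriv_sub_sum_le {f : ℝ → Phase N} {g : ℝ → Phase N →L[ℝ] Phase N}
    {L : ℝ≥0} {ε : ℝ} {t : ℕ → ℝ} (ht : Monotone t) (n : ℕ)
    (hf : LipschitzOnWith L f (Icc (t 0) (t n))) (hg : ContinuousOn g (Icc (t 0) (t n)))
    (hε : ∀ j < n, ∀ s ∈ Icc (t j) (t (j + 1)), ‖g s - g (t j)‖ ≤ ε) :
    ‖(∫ s in t 0..t n, g s (deriv f s)) - ∑ j ∈ Finset.range n, g (t j) (f (t (j + 1)) - f (t j))‖ ≤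
      ε * L * (t n - t 0) := by
  have hsub : ∀ j < n, Icc (t j) (t (j + 1)) ⊆ Icc (t 0) (t n) := fun j hj ↦
    Icc_subset_Icc (ht (Nat.zero_le j)) (ht hj)
  have hsum := intervalIntegral.sum_integral_adjacent_intervals
    (f := fun s ↦ g s (deriv f s)) (μ := volume) (a := t) (n := n) fun j hj ↦
      intervalIntegrable_clm_deriv (ht (Nat.le_succ j)) (hf.mono (hsub j hj)) (hg.mono (hsub j hj))
  rw [← hsum, ← Finset.sum_sub_distrib]
  refine (norm_sum_le _ _).trans ?_
  calc _ ≤ ∑ j ∈ Finset.range n, ε * L * (t (j + 1) - t j) := by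
        refine Finset.sum_le_sum fun j hj ↦ ?_
        have hj := Finset.mem_range.1 hj
        exact norm_integral_clm_deriv_sub_le (ht (Nat.le_succ j)) (hf.mono (hsub j hj))
          (hg.mono (hsub j hj)) _ (hε j hj)
    _ = _ := by rw [← Finset.mul_sum, Finset.sum_range_sub]

/-- The sum that approximates the integral of `φ` against the nonconservative product, for the
subdivision `t` of the parameter interval of the graph completion. -/
def curveSum (A : Phase N → Phase N →L[ℝ] Phase N) (Φ : ℝ → Phase N → Phase N → Phase N)
    (φ : ℝ → ℝ) (w : ℝ → Phase N) (t : ℕ → ℝ) (n : ℕ) : Phase N :=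
  ∑ j ∈ Finset.range n, (φ (graphAbscissa w (t j)) • A (graphValue Φ w (t j)))
    (graphValue Φ w (t (j + 1)) - graphValue Φ w (t j))

/-- Since `φ` vanishes outside the projection of the subdivision, the pairing is an integral over
`[t 0, t n]` along a curve of Lipschitz constant `k + 1`. The Riemann sum error then depends only on
the oscillation of the integrand, on `k` and on the parameter length. -/
lemma norm_pairing_sub_curveSum_le (hD : IsRegularData Ω A Φ) (hw : IsAdmissible Ω R w)
    (h : HasSpeedOn Ω Φ w K k a b) (hK : IsCompact K) (hφ : Continuous φ) {t : ℕ → ℝ} {n : ℕ}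
    (ht : Monotone t) {ε : ℝ} (hta : a < graphAbscissa w (t 0)) (htb : graphAbscissa w (t n) ≤ b)
    (h0 : ∀ x ≤ graphAbscissa w (t 0), φ x = 0) (h1 : ∀ x ≥ graphAbscissa w (t n), φ x = 0)
    (hε : ∀ j < n, ∀ s ∈ Icc (t j) (t (j + 1)),
      ‖φ (graphAbscissa w s) • A (graphValue Φ w s) -
        φ (graphAbscissa w (t j)) • A (graphValue Φ w (t j))‖ ≤ ε) :
    ‖pairing (nonconsProduct A Φ w) φ - curveSum A Φ φ w t n‖ ≤ ε * (k + 1) * (t n - t 0) := by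
  have htn : t 0 ≤ t n := ht (Nat.zero_le n)
  have hX := hw.monotone_graphAbscissa htn
  have hab : a ≤ b := hta.le.trans (hX.trans htb)
  have hz : ∀ x ∉ Ioc a b, φ x = 0 := by
    intro x hx
    by_contra hne
    refine hx ⟨?_, ?_⟩
    · by_contra! hcon
      exact hne (h0 x (hcon.trans hta.le))
    · by_contra! hcon
      exact hne (h1 x (htb.trans hcon.le))
  obtain ⟨C, hC⟩ := (HasCompactSupport.intro (isCompact_Icc (a := a) (b := b))
    fun x hx ↦ hz x fun h ↦ hx (Ioc_subset_Icc_self h)).exists_bound_of_continuous hφ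
  have ha' : graphLength w a ≤ t 0 := (hw.lt_graphAbscissa_iff.1 hta).le
  have hb' : t n ≤ graphLength w b := hw.graphAbscissa_le_iff.1 htb
  have hint := intervalIntegrable_smul_curveDensity hD hw.toIsRCBV h le_rfl hab le_rfl
    hφ.measurable hC
  have hle : graphLength w a ≤ graphLength w b := ha'.trans (htn.trans hb')
  have hsub : ∀ {x y}, graphLength w a ≤ x → x ≤ y → y ≤ graphLength w b → IntervalIntegrable
      (fun s ↦ φ (graphAbscissa w s) • curveDensity A Φ w s) volume x y := fun hx hxy hy ↦
    hint.mono_set (by rw [uIcc_of_le hxy, uIcc_of_le hle]; exact Icc_subset_Icc hx hy)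
  have hmain : pairing (nonconsProduct A Φ w) φ = ∫ s in t 0..t n,
      (φ (graphAbscissa w s) • A (graphValue Φ w s)) (deriv (graphValue Φ w) s) := by
    rw [pairing_nonconsProduct_eq hD hw h hK hab hφ hz,
      ← intervalIntegral.integral_add_adjacent_intervals (hsub le_rfl ha' (htn.trans hb'))
        (hsub ha' (htn.trans hb') le_rfl),
      ← intervalIntegral.integral_add_adjacent_intervals (hsub ha' htn hb')
        (hsub (ha'.trans htn) hb' le_rfl),
      intervalIntegral.integral_zero_ae (a := graphLength w a),
      intervalIntegral.integral_zero_ae (a := t n), zero_add, add_zero]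
    · rfl
    · refine Eventually.of_forall fun s hs ↦ ?_
      rw [uIoc_of_le hb'] at hs
      rw [h1 _ (hw.monotone_graphAbscissa hs.1.le), zero_smul]
    · refine Eventually.of_forall fun s hs ↦ ?_
      rw [uIoc_of_le ha'] at hs
      rw [h0 _ (hw.monotone_graphAbscissa hs.2), zero_smul]
  have hmem : Icc (t 0) (t n) ⊆ Icc (graphLength w a) (graphLength w b) := Icc_subset_Icc ha' hb'
  rw [hmain]
  have := norm_integral_clm_deriv_sub_sum_le (f := graphValue Φ w)
    (g := fun s ↦ φ (graphAbscissa w s) • A (graphValue Φ w s)) ht n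
    ((lipschitzOn_graphValue hD.path hw.toIsRCBV h le_rfl le_rfl).mono hmem)
    ((hφ.comp hw.continuous_graphAbscissa).continuousOn.smul
      ((continuousOn_comp_graphValue hD hw.toIsRCBV h le_rfl le_rfl).mono hmem)) hε
  push_cast at this
  exact this

end CurveSum

/-! ### Stability of nonconservative products under convergence of graphs -/

section Stability

variable {Ω : Set (Phase N)} {A : Phase N → Phase N →L[ℝ] Phase N}
  {Φ : ℝ → Phase N → Phase N → Phase N} {w w' : ℝ → Phase N} {K : Set (Phase N)} {k : ℝ≥0}
  {R a b d : ℝ} {φ : ℝ → ℝ}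

/-- The parametrized graph of `w'`, reparametrized by `α`, stays within distance `d` of that
of `w`. -/
def IsCloseGraph (Φ : ℝ → Phase N → Phase N → Phase N) (w' w : ℝ → Phase N) (α : ℝ ≃o ℝ)
    (d : ℝ) : Prop :=
  ∀ s, dist (graphCompletion Φ w' (α s)) (graphCompletion Φ w s) ≤ d

lemma IsCloseGraph.abs_abscissa_sub_le {α : ℝ ≃o ℝ} (h : IsCloseGraph Φ w' w α d) (s : ℝ) :
    |graphAbscissa w' (α s) - graphAbscissa w s| ≤ d :=
  (le_max_left _ _).trans (h s)

lemma IsCloseGraph.dist_value_le {α : ℝ ≃o ℝ} (h : IsCloseGraph Φ w' w α d) (s : ℝ) :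
    dist (graphValue Φ w' (α s)) (graphValue Φ w s) ≤ d :=
  (le_max_right _ _).trans (h s)

lemma isCloseGraph_refl (w : ℝ → Phase N) (hd : 0 ≤ d) :
    IsCloseGraph Φ w w (OrderIso.refl ℝ) d := fun s ↦ by
  rw [OrderIso.refl_apply, dist_self]
  exact hd

/-- The reparametrization moves abscissas by less than 1, so one unit is lost at each end of the
interval. -/
lemma IsCloseGraph.value_mem {α : ℝ ≃o ℝ} (h : IsCloseGraph Φ w' w α d) (hw : IsRCBV w)
    (hd : d < 1) (hK : ∀ s ∈ Icc (graphLength w a) (graphLength w b), ∀ z,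
      dist z (graphValue Φ w s) ≤ d → z ∈ K) {s : ℝ}
    (hs : graphAbscissa w' s ∈ Icc (a + 1) (b - 1)) : graphValue Φ w' s ∈ K := by
  obtain ⟨r, rfl⟩ := α.surjective s
  have h1 := abs_le.1 (h.abs_abscissa_sub_le r)
  refine hK r ⟨(hw.lt_graphAbscissa_iff.1 ?_).le, hw.graphAbscissa_le_iff.1 ?_⟩ _
    (h.dist_value_le r)
  · linarith [hs.1]
  · linarith [hs.2]

/-- The values of `w` lie on its completed graph; a left limit is a limit of values slightly to the
left, which requires the margin `a' < a` and a closed `K`. -/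
lemma hasSpeedOn_of_graphValue_mem (hΦ : IsDLMFamily Ω Φ) (hw : IsAdmissible Ω R w) (hKΩ : K ⊆ Ω)
    (hKc : IsClosed K)
    (hk : ∀ c ∈ K, ∀ d ∈ K, LipschitzOnWith (k * ‖d - c‖₊) (fun s ↦ Φ s c d) (Icc 0 1)) {a' : ℝ}
    (ha : a' < a) (h : ∀ s, graphAbscissa w s ∈ Icc a' b → graphValue Φ w s ∈ K) :
    HasSpeedOn Ω Φ w K k a b := by
  have h1 : ∀ x ∈ Icc a' b, w x ∈ K := fun x hx ↦ by
    rw [← graphValue_graphLength hΦ hw.toIsRCBV (hw.leftLim_mem x) (hw.mem x)]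
    exact h _ (by rwa [hw.graphAbscissa_graphLength])
  refine ⟨hKΩ, fun x hx ↦ ⟨hKc.mem_of_tendsto (hw.tendsto_left x) ?_,
    h1 x ⟨ha.le.trans hx.1, hx.2⟩⟩, hk⟩
  filter_upwards [Ioo_mem_nhdsLT (ha.trans_le hx.1)] with y hy
  exact h1 y ⟨hy.1.le, hy.2.le.trans hx.2⟩

lemma exists_oscillation_le (hA : ContinuousOn A Ω) (hKΩ : K ⊆ Ω) (hK : IsCompact K)
    (hφ : Continuous φ) (a b : ℝ) {ε : ℝ} (hε : 0 < ε) :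
    ∃ η > 0, ∀ x ∈ Icc a b, ∀ y ∈ Icc a b, ∀ c ∈ K, ∀ d ∈ K, |x - y| < η → dist c d < η →
      ‖φ x • A c - φ y • A d‖ ≤ ε := by
  have hu := ((isCompact_Icc (a := a) (b := b)).prod hK).uniformContinuousOn_of_continuous
    (f := fun z : ℝ × Phase N ↦ φ z.1 • A z.2)
    ((hφ.comp continuous_fst).continuousOn.smul
      ((hA.mono hKΩ).comp continuous_snd.continuousOn fun z hz ↦ hz.2))
  obtain ⟨η, hη, h⟩ := Metric.uniformContinuousOn_iff.1 hu ε hε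
  refine ⟨η, hη, fun x hx y hy c hc d hd hxy hcd ↦ ?_⟩
  have := h (x, c) ⟨hx, hc⟩ (y, d) ⟨hy, hd⟩ (max_lt hxy hcd)
  rw [dist_eq_norm] at this
  exact this.le

/-- If the graph of `w'` is close to that of `w`, then the nonconservative product of `w'` is
close to a sum along the image of a subdivision of the graph of `w`. -/
lemma IsCloseGraph.norm_pairing_sub_curveSum_le {α : ℝ ≃o ℝ} (h : IsCloseGraph Φ w' w α d)
    (hD : IsRegularData Ω A Φ) (hw : IsRCBV w) (hw' : IsAdmissible Ω R w') {ρ ε η V : ℝ}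
    (hρ : ∀ x, ρ ≤ |x| → φ x = 0) (hφ : Continuous φ) (hKΩ : K ⊆ Ω) (hK : IsCompact K)
    (hk : ∀ c ∈ K, ∀ d ∈ K, LipschitzOnWith (k * ‖d - c‖₊) (fun s ↦ Φ s c d) (Icc 0 1))
    (hd : d < 1) (hd' : d < η / 3)
    (hKw : ∀ s ∈ Icc (graphLength w (-ρ - 5)) (graphLength w (ρ + 5)), ∀ z,
      dist z (graphValue Φ w s) ≤ d → z ∈ K)
    (hη : ∀ x ∈ Icc (-ρ - 4) (ρ + 4), ∀ y ∈ Icc (-ρ - 4) (ρ + 4), ∀ c ∈ K, ∀ d ∈ K,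
      |x - y| < η → dist c d < η → ‖φ x • A c - φ y • A d‖ ≤ ε) (hε : 0 ≤ ε)
    {t : ℕ → ℝ} {n : ℕ} (ht : Monotone t) (ht0 : graphAbscissa w (t 0) = -ρ - 2)
    (htn : graphAbscissa w (t n) = ρ + 2)
    (hstep : ∀ j < n, ∀ s ∈ Icc (t j) (t (j + 1)), |graphAbscissa w s - graphAbscissa w (t j)| < η / 3
      ∧ dist (graphValue Φ w s) (graphValue Φ w (t j)) < η / 3) (hV : IsRCBV.totalVar w' ≤ V) :
    ‖pairing (nonconsProduct A Φ w') φ - curveSum A Φ φ w' (α ∘ t) n‖ ≤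
      ε * (k + 1) * (2 * ρ + 6 + V) := by
  -- Margins: `K` contains the graph of `w'` over `[-ρ - 4, ρ + 4]`, the speed bound holds over `[-ρ
  -- - 3, ρ + 3]`, and the transported subdivision starts and ends at distance less than 1 from `-ρ
  -- - 2` and `ρ + 2`, where `φ` already vanishes.
  have hX := fun s ↦ abs_le.1 (h.abs_abscissa_sub_le s)
  have h0 := hX (t 0)
  have hn := hX (t n)
  have hmem : ∀ s, graphAbscissa w' s ∈ Icc (-ρ - 4) (ρ + 4) → graphValue Φ w' s ∈ K := fun s hs ↦
    h.value_mem hw hd hKw ⟨by linarith [hs.1], by linarith [hs.2]⟩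
  have hspeed : HasSpeedOn Ω Φ w' K k (-ρ - 3) (ρ + 3) :=
    hasSpeedOn_of_graphValue_mem hD.path hw' hKΩ hK.isClosed hk (by linarith : -ρ - 4 < -ρ - 3)
      fun s hs ↦ hmem s ⟨hs.1, hs.2.trans (by linarith)⟩
  have hmono : Monotone (α ∘ t) := α.monotone.comp ht
  refine (PathConsistent.norm_pairing_sub_curveSum_le (ε := ε) hD hw' hspeed hK hφ hmono
    (by simp only [Function.comp_apply]; linarith) (by simp only [Function.comp_apply]; linarith)
    ?_ ?_ ?_).trans ?_
  · intro x hx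
    refine hρ x (le_trans ?_ (neg_le_abs x))
    simp only [Function.comp_apply] at hx
    linarith
  · intro x hx
    refine hρ x (le_trans ?_ (le_abs_self x))
    simp only [Function.comp_apply] at hx
    linarith
  · intro j hj s hs
    -- The oscillation of the graph of `w'` over the transported piece is at most `η / 3` from the
    -- graph of `w` plus `2 * d` from the distance of the graphs. Only monotonicity and surjectivity
    -- of `α` enter.
    obtain ⟨r, rfl⟩ := α.surjective s
    have hr : r ∈ Icc (t j) (t (j + 1)) := ⟨α.le_iff_le.1 hs.1, α.le_iff_le.1 hs.2⟩
    have hrange : ∀ r ∈ Icc (t 0) (t n), graphAbscissa w' (α r) ∈ Icc (-ρ - 4) (ρ + 4) := by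
      intro r hr
      have h1 := hw.monotone_graphAbscissa hr.1
      have h2 := hw.monotone_graphAbscissa hr.2
      have h3 := hX r
      exact ⟨by linarith, by linarith⟩
    have m1 := hrange r ⟨(ht (Nat.zero_le j)).trans hr.1, hr.2.trans (ht hj)⟩
    have m2 := hrange (t j) ⟨ht (Nat.zero_le j), ht hj.le⟩
    obtain ⟨e1, e2⟩ := hstep j hj r hr
    refine hη _ m1 _ m2 _ (hmem _ m1) _ (hmem _ m2) ?_ ?_
    · have h1 := hX r
      have h2 := hX (t j)
      have h3 := abs_lt.1 e1
      rw [abs_lt]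
      constructor <;> linarith
    · have h1 := dist_triangle4 (graphValue Φ w' (α r)) (graphValue Φ w r) (graphValue Φ w (t j))
        (graphValue Φ w' (α (t j)))
      have h2 := h.dist_value_le r
      have h3 := h.dist_value_le (t j)
      rw [dist_comm] at h3
      rw [Function.comp_apply]
      linarith
  -- The projection of the transported subdivision has length at most `2 * ρ + 4 + 2 * d`, and
  -- passing to the parameter adds at most the total variation.
  · refine mul_le_mul_of_nonneg_left ?_ (by positivity)
    have := hw'.sub_le_graphAbscissa_sub (hmono (Nat.zero_le n))
    simp only [Function.comp_apply] at this ⊢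
    linarith

lemma exists_le_graphDist_add (γ γ' : ℝ → ℝ × Phase N) {e : ℝ≥0∞} (he : 0 < e) :
    ∃ α : ℝ ≃o ℝ, ∀ s, edist (γ (α s)) (γ' s) ≤ graphDist γ γ' + e := by
  by_cases h : graphDist γ γ' = ⊤
  · exact ⟨OrderIso.refl ℝ, fun s ↦ by rw [h, top_add]; exact le_top⟩
  · obtain ⟨α, hα⟩ := exists_lt_of_ciInf_lt (ENNReal.lt_add_right h he.ne')
    exact ⟨α, fun s ↦ (le_iSup (fun s ↦ edist (γ (α s)) (γ' s)) s).trans hα.le⟩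

/-- For a fixed number of nodes only finitely many points of the graphs occur, so convergence of
these points and continuity of `φ` and `A` suffice. -/
lemma tendsto_curveSum (hD : IsRegularData Ω A Φ) (hφ : Continuous φ) {W : ℕ → ℝ → Phase N}
    {T : ℕ → ℕ → ℝ} {t : ℕ → ℝ} {n : ℕ} (ht : ∀ j ≤ n, graphValue Φ w (t j) ∈ Ω)
    (hX : ∀ j, Tendsto (fun m ↦ graphCompletion Φ (W m) (T m j)) atTop
      (𝓝 (graphCompletion Φ w (t j)))) :
    Tendsto (fun m ↦ curveSum A Φ φ (W m) (T m) n) atTop (𝓝 (curveSum A Φ φ w t n)) := by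
  have h1 : ∀ j, Tendsto (fun m ↦ graphAbscissa (W m) (T m j)) atTop
      (𝓝 (graphAbscissa w (t j))) := fun j ↦ (continuous_fst.tendsto _).comp (hX j)
  have h2 : ∀ j, Tendsto (fun m ↦ graphValue Φ (W m) (T m j)) atTop
      (𝓝 (graphValue Φ w (t j))) := fun j ↦ (continuous_snd.tendsto _).comp (hX j)
  refine tendsto_finsetSum _ fun j hj ↦ ?_
  have hA := hD.continuousOn.continuousAt (hD.isOpen.mem_nhds (ht j (Finset.mem_range.1 hj).le))
  exact (isBoundedBilinearMap_apply.continuous.tendsto _).comp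
    ((((hφ.tendsto _).comp (h1 j)).smul (hA.tendsto.comp (h2 j))).prodMk_nhds
      ((h2 (j + 1)).sub (h2 j)))

/-- Stability of nonconservative products under uniform convergence of graph completions. -/
theorem tendsto_pairing_nonconsProduct (hD : IsRegularData Ω A Φ) (hw : IsAdmissible Ω R w)
    {W : ℕ → ℝ → Phase N} (hW : ∀ m, IsAdmissible Ω R (W m)) {V ρ : ℝ}
    (hV : ∀ m, IsRCBV.totalVar (W m) ≤ V)
    (hlim : Tendsto (fun m ↦ graphDist (graphCompletion Φ (W m)) (graphCompletion Φ w)) atTop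
      (𝓝 0)) (hφ : Continuous φ) (hρ0 : 0 ≤ ρ) (hρ : ∀ x, ρ ≤ |x| → φ x = 0) :
    Tendsto (fun m ↦ pairing (nonconsProduct A Φ (W m)) φ) atTop
      (𝓝 (pairing (nonconsProduct A Φ w) φ)) := by
  obtain ⟨K₁, hK₁Ω, hK₁, hK₁w⟩ := hw.exists_isCompact hD.isOpen hw.leftLim_mem hw.mem
    (-ρ - 5) (ρ + 5)
  obtain ⟨k₁, hk₁⟩ := hD.path.exists_speed hK₁Ω hK₁
  have hs₁ : HasSpeedOn Ω Φ w K₁ k₁ (-ρ - 5) (ρ + 5) := ⟨hK₁Ω, hK₁w, hk₁⟩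
  have hLip := lipschitzOn_graphValue hD.path hw.toIsRCBV hs₁ le_rfl le_rfl
  set K₀ := graphValue Φ w '' Icc (graphLength w (-ρ - 5)) (graphLength w (ρ + 5)) with hK₀
  have hK₀c : IsCompact K₀ := isCompact_Icc.image_of_continuousOn hLip.continuousOn
  have hK₀Ω : K₀ ⊆ Ω := by
    rintro _ ⟨s, hs, rfl⟩
    exact graphValue_mem hD.path hw.toIsRCBV hs₁ (hw.graphAbscissa_mem_Icc hs)
  -- A compact neighbourhood of the limit graph inside `Ω`. Nearby graphs stay in it over bounded
  -- abscissas, whence one speed constant `k` for all of them.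
  obtain ⟨δ, hδ, hδΩ⟩ := hK₀c.exists_cthickening_subset_open hD.isOpen hK₀Ω
  set K := Metric.cthickening δ K₀
  have hK : IsCompact K := hK₀c.cthickening
  obtain ⟨k, hk⟩ := hD.path.exists_speed hδΩ hK
  have hKw : ∀ d ≤ δ, ∀ s ∈ Icc (graphLength w (-ρ - 5)) (graphLength w (ρ + 5)), ∀ z,
      dist z (graphValue Φ w s) ≤ d → z ∈ K := fun d hd s hs z hz ↦
    Metric.mem_cthickening_of_dist_le z _ δ K₀ (mem_image_of_mem _ hs) (hz.trans hd)
  -- The variation of `w` is included so that the Riemann sum estimate also applies to `w` itself,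
  -- with the identity reparametrization.
  set V' := max V (IsRCBV.totalVar w)
  have hV0 : 0 ≤ V' := le_max_of_le_right ENNReal.toReal_nonneg
  set B : ℝ := (k + 1) * (2 * ρ + 6 + V') with hB
  have hB0 : 0 ≤ B := by positivity
  rw [Metric.tendsto_atTop']
  intro ε hε
  -- Two Riemann sum errors `ε' * B` and one error `ε'` for the convergence of the sums.
  set ε' := ε / (2 * B + 1) with hε'
  have hε'0 : 0 < ε' := by positivity
  obtain ⟨η, hη, hosc⟩ := exists_oscillation_le (φ := φ) hD.continuousOn hδΩ hK hφ (-ρ - 4) (ρ + 4)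
    hε'0
  have hle : graphLength w (-ρ - 2) ≤ graphLength w (ρ + 2) :=
    hw.strictMono_graphLength.monotone (by linarith)
  -- The mesh is chosen so fine that a cell length times `k₁ + 1`, the Lipschitz constant of the
  -- limit graph, is below `η / 3`.
  obtain ⟨n, hn⟩ := exists_nat_gt ((graphLength w (ρ + 2) - graphLength w (-ρ - 2)) * (k₁ + 1) /
    (η / 3))
  set t := grid (graphLength w (-ρ - 2)) (graphLength w (ρ + 2)) n with ht
  have htmono : Monotone t := monotone_grid hle n
  have ht0 : graphAbscissa w (t 0) = -ρ - 2 := by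
    rw [ht, grid_zero, hw.graphAbscissa_graphLength]
  have htn : graphAbscissa w (t (n + 1)) = ρ + 2 := by
    rw [ht, grid_last, hw.graphAbscissa_graphLength]
  have htmem : ∀ j ≤ n + 1, t j ∈ Icc (graphLength w (-ρ - 5)) (graphLength w (ρ + 5)) :=
    fun j hj ↦ Icc_subset_Icc (hw.strictMono_graphLength.monotone (by linarith))
      (hw.strictMono_graphLength.monotone (by linarith)) (grid_mem_Icc hle hj)
  have hstep : ∀ j < n + 1, ∀ s ∈ Icc (t j) (t (j + 1)),
      |graphAbscissa w s - graphAbscissa w (t j)| < η / 3 ∧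
      dist (graphValue Φ w s) (graphValue Φ w (t j)) < η / 3 := by
    intro j hj s hs
    have h1 : s - t j ≤ (graphLength w (ρ + 2) - graphLength w (-ρ - 2)) / (n + 1) := by
      rw [← grid_succ_sub]
      exact sub_le_sub_right hs.2 _
    have h2 : (k₁ + 1) * (s - t j) < η / 3 := by
      refine (mul_le_mul_of_nonneg_left h1 (by positivity)).trans_lt ?_
      rw [div_lt_iff₀ (by positivity)] at hn
      rw [mul_div_assoc', div_lt_iff₀ (by positivity)]
      nlinarith
    have h3 : 0 ≤ s - t j := sub_nonneg.2 hs.1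
    constructor
    · rw [abs_of_nonneg (sub_nonneg.2 (hw.monotone_graphAbscissa hs.1))]
      refine (hw.graphAbscissa_sub_le hs.1).trans_lt (lt_of_le_of_lt ?_ h2)
      nlinarith [k₁.coe_nonneg]
    · refine (hLip.dist_le_mul s ⟨(htmem j hj.le).1.trans hs.1, hs.2.trans (htmem (j + 1) hj).2⟩ _
        (htmem j hj.le)).trans_lt ?_
      rw [Real.dist_eq, abs_of_nonneg h3]
      exact_mod_cast h2
  have hest : ∀ (w' : ℝ → Phase N) (α : ℝ ≃o ℝ) (d : ℝ), IsAdmissible Ω R w' →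
      IsRCBV.totalVar w' ≤ V' → IsCloseGraph Φ w' w α d → d < 1 → d < η / 3 → d ≤ δ →
      ‖pairing (nonconsProduct A Φ w') φ - curveSum A Φ φ w' (α ∘ t) (n + 1)‖ ≤ ε' * B := by
    intro w' α d hw' hV' hα hd1 hd2 hd3
    rw [hB, ← mul_assoc]
    exact hα.norm_pairing_sub_curveSum_le hD hw.toIsRCBV hw' hρ hφ hδΩ hK hk hd1 hd2 (hKw d hd3)
      hosc hε'0.le htmono ht0 htn hstep hV'
  have hself := hest w (OrderIso.refl ℝ) 0 hw (le_max_right _ _) (isCloseGraph_refl w le_rfl)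
    one_pos (by positivity) hδ.le
  -- The infimum in the graph distance need not be attained; the slack `1 / m`, infinite for `m =
  -- 0`, tends to zero.
  choose α hα using fun m : ℕ ↦ exists_le_graphDist_add (graphCompletion Φ (W m))
    (graphCompletion Φ w) (ENNReal.inv_pos.2 (ENNReal.natCast_ne_top m))
  have hlim' : Tendsto (fun m : ℕ ↦ graphDist (graphCompletion Φ (W m)) (graphCompletion Φ w) +
      (m : ℝ≥0∞)⁻¹) atTop (𝓝 0) := by
    simpa using hlim.add ENNReal.tendsto_inv_nat_nhds_zero
  set d := min (min (1 / 2) (η / 6)) δ with hd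
  have hd0 : 0 < d := by positivity
  have hsum : Tendsto (fun m ↦ curveSum A Φ φ (W m) (α m ∘ t) (n + 1)) atTop
      (𝓝 (curveSum A Φ φ w t (n + 1))) := by
    refine tendsto_curveSum hD hφ (fun j hj ↦ hK₀Ω (mem_image_of_mem _ (htmem j hj))) fun j ↦ ?_
    rw [tendsto_iff_edist_tendsto_0]
    exact tendsto_of_tendsto_of_tendsto_of_le_of_le tendsto_const_nhds hlim'
      (fun _ ↦ zero_le) fun m ↦ hα m (t j)
  obtain ⟨m₁, hm₁⟩ := Metric.tendsto_atTop.1 hsum ε' hε'0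
  obtain ⟨m₂, hm₂⟩ := eventually_atTop.1
    (hlim'.eventually (ge_mem_nhds (ENNReal.ofReal_pos.2 hd0)))
  refine ⟨max m₁ m₂, fun m hm ↦ ?_⟩
  have hclose : IsCloseGraph Φ (W m) w (α m) d := fun s ↦ by
    have := (hα m s).trans (hm₂ m ((le_max_right _ _).trans hm.le))
    rwa [edist_dist, ENNReal.ofReal_le_ofReal_iff hd0.le] at this
  have h1 := hest (W m) (α m) d (hW m) ((hV m).trans (le_max_left _ _)) hclose
    (((min_le_left _ _).trans (min_le_left _ _)).trans_lt (by norm_num))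
    (((min_le_left _ _).trans (min_le_right _ _)).trans_lt (by linarith)) (min_le_right _ _)
  have h2 := hm₁ m ((le_max_left _ _).trans hm.le)
  rw [← dist_eq_norm] at h1 hself
  have h3 := dist_triangle4 (pairing (nonconsProduct A Φ (W m)) φ)
    (curveSum A Φ φ (W m) (α m ∘ t) (n + 1)) (curveSum A Φ φ w t (n + 1))
    (pairing (nonconsProduct A Φ w) φ)
  rw [dist_comm] at hself
  have h4 : ε' * (2 * B + 1) = ε := div_mul_cancel₀ _ (by positivity)
  have h5 : dist (curveSum A Φ φ w t (n + 1)) (pairing (nonconsProduct A Φ w) φ) ≤ ε' * B := hself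
  linarith

end Stability

/-! ### Approximate solutions and nonconservative products -/

section Consistency

variable {Ω : Set (Phase N)} {A : Phase N → Phase N →L[ℝ] Phase N}
  {Φ : ℝ → Phase N → Phase N → Phase N} {U : ℤ → Phase N} {R d L M : ℝ} {φ : ℝ → ℝ} {c : ℝ≥0}

/-- Only the grid cell containing the interface `i * d` contributes to the approximating sums. Hence
these sums are constant, equal to the path integral across the interface. -/
lemma nonconsProduct_cellFun_Ioc (hD : IsRegularData Ω A Φ) (hd : 0 < d)
    (hw : IsAdmissible Ω R (cellFun d U)) {a b : ℝ} {i : ℤ} (ha : a ∈ Ico ((i - 1) * d) (i * d))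
    (hb : b ∈ Ico (i * d) ((i + 1) * d)) :
    nonconsProduct A Φ (cellFun d U) (Ioc a b) = pathIntegral A Φ (U i) (U (i + 1)) := by
  have hab : a ≤ b := ha.2.le.trans hb.1
  have hl : ∀ x ∈ Icc a b, x < i * d → cellFun d U x = U i := fun x hx hxi ↦ by
    have := cellFun_of_mem (U := U) hd (i := i - 1) (x := x)
      ⟨by push_cast; exact ha.1.trans hx.1, by push_cast; rwa [sub_add_cancel]⟩
    rwa [sub_add_cancel] at this
  have hr : ∀ x ∈ Icc a b, i * d ≤ x → cellFun d U x = U (i + 1) := fun x hx hxi ↦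
    cellFun_of_mem hd ⟨hxi, hx.2.trans_lt hb.2⟩
  have hself : ∀ j, pathIntegral A Φ (U j) (U j) = 0 := fun j ↦ by
    refine pathIntegral_self hD.path (?_ : U j ∈ Ω)
    have h1 := cellFun_of_mem (U := U) hd (i := j - 1) (x := (j - 1) * d)
      ⟨by push_cast; exact le_rfl, by push_cast; nlinarith⟩
    rw [sub_add_cancel] at h1
    rw [← h1]
    exact hw.mem _
  refine tendsto_nhds_unique (tendsto_sum_nonconsProduct hD hw hab)
    (tendsto_const_nhds.congr fun n ↦ ?_)
  obtain ⟨j, hj, hij⟩ := exists_mem_Ioc_grid n (⟨ha.2, hb.1⟩ : i * d ∈ Ioc a b)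
  have hmono := monotone_grid hab n
  rw [Finset.sum_eq_single_of_mem j (Finset.mem_range.2 hj)]
  · rw [hl _ (grid_mem_Icc hab hj.le) hij.1, hr _ (grid_mem_Icc hab hj) hij.2]
  · intro l hl' hlj
    have hl' := Finset.mem_range.1 hl'
    rcases lt_or_gt_of_ne hlj with h | h
    · have h2 : grid a b n (l + 1) < i * d := (hmono h).trans_lt hij.1
      rw [hl _ (grid_mem_Icc hab hl'.le) ((hmono (Nat.le_succ l)).trans_lt h2),
        hl _ (grid_mem_Icc hab hl') h2, hself]
    · have h2 : i * d ≤ grid a b n l := hij.2.trans (hmono h)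
      rw [hr _ (grid_mem_Icc hab hl'.le) h2,
        hr _ (grid_mem_Icc hab hl') (h2.trans (hmono (Nat.le_succ l))), hself]

/-- The values of `φ` at the midpoints of the cells. -/
def midValue (φ : ℝ → ℝ) (d : ℝ) (i : ℤ) : ℝ := φ ((i - 1 / 2) * d)

lemma midValue_eq_zero (hd : 0 < d) (hR : ∀ x, R < |x| → φ x = 0) {J : ℕ} (hJ : R < J * d) {i : ℤ}
    (hi : J < |i|) : midValue φ d i = 0 := by
  refine hR _ (hJ.trans_le ?_)
  rw [abs_mul, abs_of_pos hd]
  refine mul_le_mul_of_nonneg_right ?_ hd.le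
  have h1 : (J : ℝ) + 1 ≤ |(i : ℝ)| := by exact_mod_cast hi
  have h2 := abs_sub_abs_le_abs_sub (i : ℝ) (1 / 2)
  rw [abs_of_pos (by norm_num : (0 : ℝ) < 1 / 2)] at h2
  linarith

/-- A grid whose nodes are the midpoints of the cells has exactly one interface in each of its
intervals, so the grid sum for `φ` is the sum over interfaces. Replacing `φ` by its value at the
left node costs at most `L * d`. -/
lemma norm_pairing_cellFun_sub_le (hD : IsRegularData Ω A Φ) (hc : PathBound Ω A Φ R c) (hd : 0 < d)
    (hw : IsAdmissible Ω R (cellFun d U)) (hφ : Measurable φ)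
    (hM : ∀ x, |φ x| ≤ M) (hL : ∀ x y, |φ x - φ y| ≤ L * |x - y|) (hL0 : 0 ≤ L) {r : ℝ}
    (hr : ∀ x, r < |x| → φ x = 0) :
    ‖pairing (nonconsProduct A Φ (cellFun d U)) φ -
      ∑' i, midValue φ d i • pathIntegral A Φ (U i) (U (i + 1))‖ ≤
      L * d * (c * (eVariationOn (cellFun d U) univ).toReal) := by
  obtain ⟨J, hJ⟩ := exists_nat_gt (r / d)
  rw [div_lt_iff₀ hd] at hJ
  have hJ0 : (0 : ℝ) ≤ J := J.cast_nonneg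
  -- There are `2 * J + 1` intervals of length `d`, centred at the interfaces `-J * d, …, J * d`,
  -- and they cover the support of `φ`.
  set a : ℝ := (-J - 1 / 2) * d with ha
  set b : ℝ := (J + 1 / 2) * d with hb
  have hab : a ≤ b := mul_le_mul_of_nonneg_right (by linarith) hd.le
  have hstep : (b - a) / ((2 * J : ℕ) + 1) = d := by
    rw [ha, hb]
    push_cast
    field_simp
    ring
  have hgrid : ∀ j : ℕ, grid a b (2 * J) j = (((j - J : ℤ) : ℝ) - 1 / 2) * d := fun j ↦ by
    rw [grid, ← mul_div_assoc, mul_div_right_comm, hstep, ha]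
    push_cast
    ring
  have hz : ∀ x ∉ Ioc a b, φ x = 0 := by
    intro x hx
    refine hr x (hJ.trans_le ?_)
    by_contra! hcon
    have := abs_lt.1 hcon
    refine hx ⟨?_, ?_⟩
    · rw [ha]; nlinarith
    · rw [hb]; nlinarith
  have hfin : (nonconsProduct A Φ (cellFun d U)).variation univ ≤
      c * eVariationOn (cellFun d U) univ := by
    refine (variation_nonconsProduct_le hD hc hw univ).trans ?_
    rw [Measure.smul_apply]
    exact mul_le_mul_right hw.measure_univ_le _
  have htop : c * eVariationOn (cellFun d U) univ ≠ ⊤ := ENNReal.mul_ne_top ENNReal.coe_ne_top hw.bv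
  have : IsFiniteMeasure (nonconsProduct A Φ (cellFun d U)).variation := ⟨hfin.trans_lt htop.lt_top⟩
  have h1 := norm_pairing_sub_sum_le (m := nonconsProduct A Φ (cellFun d U)) (a := a) (b := b)
    (n := 2 * J) hφ hM (mul_nonneg hL0 hd.le) (abs_sub_stepFun_le hab (mul_nonneg hL0 hd.le) hz
      fun x y hxy ↦ (hL x y).trans (mul_le_mul_of_nonneg_left (hxy.trans hstep.le) hL0))
  have h2 : ∑' i, midValue φ d i • pathIntegral A Φ (U i) (U (i + 1)) =
      ∑ j ∈ Finset.range (2 * J + 1), φ (grid a b (2 * J) j) •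
        nonconsProduct A Φ (cellFun d U) (Ioc (grid a b (2 * J) j) (grid a b (2 * J) (j + 1))) := by
    rw [tsum_eq_sum (s := (Finset.range (2 * J + 1)).image fun j : ℕ ↦ (j : ℤ) - J),
      Finset.sum_image fun i _ j _ h ↦ by simpa using h]
    · refine Finset.sum_congr rfl fun j _ ↦ ?_
      rw [nonconsProduct_cellFun_Ioc hD hd hw (i := (j : ℤ) - J), hgrid, midValue]
      · rw [hgrid]
        constructor <;> nlinarith
      · rw [hgrid]
        push_cast
        constructor <;> nlinarith
    · intro i hi
      rw [midValue_eq_zero hd hr hJ, zero_smul]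
      by_contra! hcon
      have := abs_le.1 hcon
      exact hi (Finset.mem_image.2 ⟨(i + J).toNat, Finset.mem_range.2 (by omega), by omega⟩)
  rw [h2]
  refine h1.trans (mul_le_mul_of_nonneg_left ?_ (mul_nonneg hL0 hd.le))
  have h3 := ENNReal.toReal_mono htop hfin
  rwa [ENNReal.toReal_mul, ENNReal.coe_toReal] at h3

lemma integral_cellFun (hd : 0 < d) {S : Finset ℤ} (hS : ∀ i ∉ S, U i = 0) :
    ∫ x, cellFun d U x = d • ∑' i, U i := by
  have h1 : cellFun d U = fun x ↦ ∑ i ∈ S,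
      (Ico (((i - 1 : ℤ) : ℝ) * d) (((i - 1 : ℤ) + 1) * d)).indicator (fun _ ↦ U i) x := by
    funext x
    rw [Finset.sum_eq_single (⌊x / d⌋ + 1)]
    · rw [indicator_of_mem, cellFun]
      rw [← floor_div_eq_iff hd, add_sub_cancel_right]
    · intro i _ hi
      refine indicator_of_notMem (fun hx ↦ hi ?_) _
      rw [(floor_div_eq_iff hd).2 hx, sub_add_cancel]
    · intro hi
      rw [hS _ hi, indicator_zero]
  rw [h1, integral_finsetSum _ fun i _ ↦ (integrableOn_const (by simp)).integrable_indicator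
    measurableSet_Ico, tsum_eq_sum hS, Finset.smul_sum]
  refine Finset.sum_congr rfl fun i _ ↦ ?_
  rw [integral_indicator_const _ measurableSet_Ico, Real.volume_real_Ico_of_le (by nlinarith)]
  congr 1
  ring

lemma summable_norm_of_tsum_enorm_le {ι : Type*} {f : ι → Phase N} {V : ℝ≥0}
    (h : ∑' i, ‖f i‖ₑ ≤ V) : Summable (fun i ↦ ‖f i‖) ∧ ∑' i, ‖f i‖ ≤ V := by
  have h1 := ENNReal.summable_toReal (ne_top_of_le_ne_top ENNReal.coe_ne_top h)
  have h2 := ENNReal.tsum_toReal_eq (f := fun i ↦ ‖f i‖ₑ) fun _ ↦ enorm_ne_top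
  simp only [toReal_enorm] at h1 h2
  refine ⟨h1, ?_⟩
  rw [← h2]
  exact ENNReal.toReal_le_coe_of_le_coe h

variable {p q : ℕ} {Mm Mp : (Fin (p + q + 1) → Phase N) → Phase N} {C V : ℝ≥0}
  {dx dt : ℝ} {u : ℕ → ℤ → Phase N}

lemma abs_sub_midValue_le (hd : 0 < d) (hL : ∀ x y, |φ x - φ y| ≤ L * |x - y|) (hL0 : 0 ≤ L)
    (x : ℝ) : |φ x - midValue φ d (⌊x / d⌋ + 1)| ≤ L * d := by
  refine (hL _ _).trans (mul_le_mul_of_nonneg_left ?_ hL0)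
  have h := (floor_div_eq_iff hd).1 (rfl : ⌊x / d⌋ = ⌊x / d⌋)
  push_cast
  rw [abs_le]
  constructor <;> nlinarith [h.1, h.2]

lemma summable_smul_of_bound {ι : Type*} {a : ι → ℝ} {f : ι → Phase N} (hf : Summable fun i ↦ ‖f i‖)
    (ha : ∀ i, |a i| ≤ M) : Summable fun i ↦ a i • f i :=
  Summable.of_norm_bounded (hf.mul_left M) fun i ↦ by
    rw [norm_smul]
    exact mul_le_mul_of_nonneg_right (ha i) (norm_nonneg _)

lemma norm_tsum_smul_le {ι : Type*} {a : ι → ℝ} {f : ι → Phase N} (hf : Summable fun i ↦ ‖f i‖)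
    (ha : ∀ i, |a i| ≤ M) : ‖∑' i, a i • f i‖ ≤ M * ∑' i, ‖f i‖ := by
  rw [← tsum_mul_left]
  refine tsum_of_norm_bounded (hf.mul_left M).hasSum fun i ↦ ?_
  rw [norm_smul]
  exact mul_le_mul_of_nonneg_right (ha i) (norm_nonneg _)

/-- Summation by parts: the index shift of `f` is moved to the midpoint values of `φ`, and
consecutive midpoints are at distance `d`. -/
lemma norm_tsum_midValue_sub_le (hd : 0 < d) {f g : ℤ → Phase N} (hf : Summable fun i ↦ ‖f i‖)
    (hg : Summable fun i ↦ ‖g i‖) (hM : ∀ x, |φ x| ≤ M) (hL : ∀ x y, |φ x - φ y| ≤ L * |x - y|)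
    (hL0 : 0 ≤ L) :
    ‖(∑' i, midValue φ d i • (g i + f i)) - ∑' i, midValue φ d i • (f (i - 1) + g i)‖ ≤
      L * d * ∑' i, ‖f i‖ := by
  have hb : ∀ i, |midValue φ d i| ≤ M := fun i ↦ hM _
  have hb' : ∀ i, |midValue φ d (i + 1)| ≤ M := fun i ↦ hM _
  have hf1 : Summable fun i ↦ ‖f (i - 1)‖ :=
    (Equiv.subRight (1 : ℤ)).summable_iff (f := fun i ↦ ‖f i‖) |>.2 hf
  have s1 := summable_smul_of_bound hf hb
  have s2 := summable_smul_of_bound hg hb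
  have s3 := summable_smul_of_bound hf1 hb
  have s4 := summable_smul_of_bound hf hb'
  have h1 : ∑' i, midValue φ d i • f (i - 1) = ∑' i, midValue φ d (i + 1) • f i := by
    rw [← (Equiv.subRight (1 : ℤ)).tsum_eq fun i ↦ midValue φ d (i + 1) • f i]
    simp only [Equiv.subRight_apply, sub_add_cancel]
  have h2 : (∑' i, midValue φ d i • (g i + f i)) - ∑' i, midValue φ d i • (f (i - 1) + g i) =
      ∑' i, (midValue φ d i - midValue φ d (i + 1)) • f i := by
    simp only [smul_add, sub_smul]
    rw [s2.tsum_add s1, s3.tsum_add s2, h1, s1.tsum_sub s4]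
    abel
  rw [h2]
  refine norm_tsum_smul_le hf fun i ↦ ?_
  refine (hL _ _).trans (mul_le_mul_of_nonneg_left (le_of_eq ?_) hL0)
  rw [show ((i : ℝ) - 1 / 2) * d - (((i + 1 : ℤ) : ℝ) - 1 / 2) * d = -d by push_cast; ring, abs_neg,
    abs_of_pos hd]

lemma norm_integral_smul_sub_le {φ ψ : ℝ → ℝ} {D : ℝ → Phase N} {ε : ℝ} (hD : Integrable D)
    (hφ : Measurable φ) (hψ : Measurable ψ) (hM : ∀ x, |φ x| ≤ M) (hM' : ∀ x, |ψ x| ≤ M)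
    (hε : ∀ x, |φ x - ψ x| ≤ ε) :
    ‖(∫ x, φ x • D x) - ∫ x, ψ x • D x‖ ≤ ε * ∫ x, ‖D x‖ := by
  have h1 : Integrable fun x ↦ φ x • D x :=
    hD.bdd_smul M hφ.aestronglyMeasurable (Eventually.of_forall hM)
  have h2 : Integrable fun x ↦ ψ x • D x :=
    hD.bdd_smul M hψ.aestronglyMeasurable (Eventually.of_forall hM')
  rw [← integral_sub h1 h2]
  simp only [← sub_smul]
  exact norm_integral_smul_le hD hε

/-- The increments of the scheme are sums of the numerical functions. -/
lemma IsSchemeRun.integral_midValue_smul (h : IsSchemeRun Ω p q Mm Mp C V dx dt u) {t : ℝ}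
    (ht : 0 ≤ t) {r : ℝ} (hr : ∀ x, r < |x| → φ x = 0) :
    ∫ x, midValue φ dx (⌊x / dx⌋ + 1) •
      dt⁻¹ • (approx dx dt u (t + dt) x - approx dx dt u t x) =
    -∑' i, midValue φ dx i • (Mp (stencil p q (u ⌊t / dt⌋₊) (i - 1)) +
      Mm (stencil p q (u ⌊t / dt⌋₊) i)) := by
  obtain ⟨J, hJ⟩ := exists_nat_gt (r / dx)
  rw [div_lt_iff₀ h.dx_pos] at hJ
  set n := ⌊t / dt⌋₊ with hn
  have h1 : ∀ i, dt⁻¹ • (u (n + 1) i - u n i) =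
      -(dx⁻¹ • (Mp (stencil p q (u n) (i - 1)) + Mm (stencil p q (u n) i))) := fun i ↦ by
    rw [h.solution n i, sub_sub_cancel_left, smul_neg, smul_smul, div_eq_mul_inv, ← mul_assoc,
      inv_mul_cancel₀ h.dt_pos.ne', one_mul]
  have h2 : ∫ x, midValue φ dx (⌊x / dx⌋ + 1) •
      dt⁻¹ • (approx dx dt u (t + dt) x - approx dx dt u t x) =
      ∫ x, cellFun dx (fun i ↦ midValue φ dx i • dt⁻¹ • (u (n + 1) i - u n i)) x := by
    rw [h.approx_add_dt ht]
    rfl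
  rw [h2, integral_cellFun h.dx_pos (S := Finset.Icc (-J : ℤ) J)]
  · simp only [h1]
    rw [← tsum_neg, ← tsum_const_smul'']
    refine tsum_congr fun i ↦ ?_
    rw [smul_neg, smul_neg, smul_comm dx, smul_smul dx, mul_inv_cancel₀ h.dx_pos.ne', one_smul]
  · intro i hi
    rw [midValue_eq_zero h.dx_pos hr hJ, zero_smul]
    by_contra! hcon
    exact hi (Finset.mem_Icc.2 (abs_le.1 hcon))

/-- The difference quotients in time of the approximate solutions are close to the opposite of
their nonconservative products. -/
theorem IsSchemeRun.norm_integral_add_pairing_le (h : IsSchemeRun Ω p q Mm Mp C V dx dt u)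
    (hD : IsRegularData Ω A Φ) (hc : PathBound Ω A Φ C c) (hp : 1 ≤ p)
    (hjump : ∀ w : Fin (p + q + 1) → Phase N, (∀ j, w j ∈ Ω) →
      Mm w + Mp w = pathIntegral A Φ (w ⟨q, by omega⟩) (w ⟨q + 1, by omega⟩)) {t : ℝ} (ht : 0 ≤ t)
    (hφ : Measurable φ) (hM : ∀ x, |φ x| ≤ M) (hL : ∀ x y, |φ x - φ y| ≤ L * |x - y|) (hL0 : 0 ≤ L)
    {r : ℝ} (hr : ∀ x, r < |x| → φ x = 0) :
    ‖(∫ x, φ x • dt⁻¹ • (approx dx dt u (t + dt) x - approx dx dt u t x)) +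
      pairing (nonconsProduct A Φ (approx dx dt u t)) φ‖ ≤ L * dx * (2 * V + c * C) := by
  have hdx := h.dx_pos
  have hLd : 0 ≤ L * dx := mul_nonneg hL0 hdx.le
  set D := fun x ↦ dt⁻¹ • (approx dx dt u (t + dt) x - approx dx dt u t x) with hDdef
  have hDm : Measurable D := (measurable_cellFun.sub measurable_cellFun).const_smul dt⁻¹
  have hDV := h.lintegral_diffQuot_le ht
  have hDi : Integrable D := ⟨hDm.aestronglyMeasurable, hDV.trans_lt ENNReal.coe_lt_top⟩
  have hmid : Measurable fun x : ℝ ↦ midValue φ dx (⌊x / dx⌋ + 1) :=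
    (measurable_of_countable fun i : ℤ ↦ midValue φ dx (i + 1)).comp measurable_floor_div
  -- First error: `φ` is replaced by its midpoint value in each cell, at the cost `L * dx` times the
  -- L¹ bound of the difference quotient.
  have e1 : ‖(∫ x, φ x • D x) - ∫ x, midValue φ dx (⌊x / dx⌋ + 1) • D x‖ ≤ L * dx * V := by
    refine (norm_integral_smul_sub_le hDi hφ hmid hM (fun _ ↦ hM _)
      (abs_sub_midValue_le hdx hL hL0)).trans ?_
    exact mul_le_mul_of_nonneg_left (integral_norm_le_of_lintegral_le hDi hDV) hLd
  set n := ⌊t / dt⌋₊ with hn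
  have e2 := norm_pairing_cellFun_sub_le hD hc hdx (h.isAdmissible t) hφ hM hL hL0 hr
  rw [← approx_eq_cellFun] at e2
  have hvar : (eVariationOn (approx dx dt u t) univ).toReal ≤ C :=
    ENNReal.toReal_le_coe_of_le_coe (h.variation_le _)
  set mp := fun i ↦ Mp (stencil p q (u n) i) with hmp
  set mm := fun i ↦ Mm (stencil p q (u n) i) with hmm
  obtain ⟨hsp, hsp'⟩ := summable_norm_of_tsum_enorm_le ((le_self_add).trans (h.tsum_le n))
  obtain ⟨hsm, -⟩ := summable_norm_of_tsum_enorm_le ((le_add_self).trans (h.tsum_le n))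
  -- The entries of index `q` and `q + 1` of the stencil at the interface `i` are the two states
  -- adjacent to it, so the jump condition applies.
  have hpath : ∀ i, pathIntegral A Φ (u n i) (u n (i + 1)) = mm i + mp i := fun i ↦ by
    refine Eq.trans ?_ (hjump (stencil p q (u n) i) fun j ↦ h.mem n _).symm
    simp only [stencil]
    congr 2 <;> push_cast <;> ring
  -- The nonconservative product attaches both fluctuations of an interface to the same index, while
  -- the scheme sends M⁺ to the cell on its right; the discrepancy is one index shift.
  have e3 : ‖(∑' i, midValue φ dx i • pathIntegral A Φ (u n i) (u n (i + 1))) -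
      ∑' i, midValue φ dx i • (mp (i - 1) + mm i)‖ ≤ L * dx * V := by
    simp only [hpath]
    exact (norm_tsum_midValue_sub_le hdx hsp hsm hM hL hL0).trans
      (mul_le_mul_of_nonneg_left hsp' hLd)
  have e4 := h.integral_midValue_smul ht hr
  have hcalc : (∫ x, φ x • D x) + pairing (nonconsProduct A Φ (approx dx dt u t)) φ =
      ((∫ x, φ x • D x) - ∫ x, midValue φ dx (⌊x / dx⌋ + 1) • D x) +
      (pairing (nonconsProduct A Φ (approx dx dt u t)) φ -
        ∑' i, midValue φ dx i • pathIntegral A Φ (u n i) (u n (i + 1))) +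
      ((∑' i, midValue φ dx i • pathIntegral A Φ (u n i) (u n (i + 1))) -
        ∑' i, midValue φ dx i • (mp (i - 1) + mm i)) := by
    rw [show (∫ x, midValue φ dx (⌊x / dx⌋ + 1) • D x) =
      -∑' i, midValue φ dx i • (mp (i - 1) + mm i) from e4]
    abel
  rw [hcalc]
  have e5 : L * dx * (c * (eVariationOn (approx dx dt u t) univ).toReal) ≤ L * dx * (c * C) := by
    gcongr
  refine (norm_add₃_le).trans ?_
  calc _ ≤ L * dx * V + L * dx * (c * C) + L * dx * V := add_le_add (add_le_add e1 (e2.trans e5)) e3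
    _ = _ := by ring

end Consistency

/-! ### Convergence of graphs -/

section GraphConvergence

variable {Ω : Set (Phase N)} {A : Phase N → Phase N →L[ℝ] Phase N}
  {Φ : ℝ → Phase N → Phase N → Phase N} {p q : ℕ} {hp : 1 ≤ p}
  {Mm Mp : ℕ → (Fin (p + q + 1) → Phase N) → Phase N} {C V : ℝ≥0} {dx dt : ℕ → ℝ}
  {u : ℕ → ℕ → ℤ → Phase N} {v : ℝ → ℝ → Phase N} {φ : ℝ → ℝ → ℝ} {T R M L : ℝ}

/-- The integral in space of `φ` times the difference quotient in time of the approximate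
solution. -/
def diffQuotIntegral (φ : ℝ → ℝ → ℝ) (dx dt : ℝ) (u : ℕ → ℤ → Phase N) (t : ℝ) : Phase N :=
  ∫ x, φ t x • dt⁻¹ • (approx dx dt u (t + dt) x - approx dx dt u t x)

lemma aestronglyMeasurable_diffQuotIntegral (hφ : IsTestFunction φ) (dx dt : ℝ)
    (u : ℕ → ℤ → Phase N) (μ : Measure ℝ) :
    AEStronglyMeasurable (diffQuotIntegral φ dx dt u) μ := by
  have h1 : Measurable fun z : ℝ × ℝ ↦ φ z.1 z.2 • dt⁻¹ •
      (approx dx dt u (z.1 + dt) z.2 - approx dx dt u z.1 z.2) :=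
    hφ.1.continuous.measurable.smul ((((measurable_approx dx dt u).comp
      ((measurable_fst.add_const dt).prodMk measurable_snd)).sub
        (measurable_approx dx dt u)).const_smul dt⁻¹)
  exact (h1.stronglyMeasurable.integral_prod_right').aestronglyMeasurable

namespace IsConvergentScheme

variable (h : IsConvergentScheme Ω p q Mm Mp C V dx dt u v)
include h

lemma norm_diffQuotIntegral_le (hd : IsTestData φ T R M L) (k : ℕ) {t : ℝ} (ht : 0 ≤ t) :
    ‖diffQuotIntegral φ (dx k) (dt k) (u k) t‖ ≤ (Iic T).indicator (fun _ ↦ M * V) t := by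
  by_cases htT : t ∈ Iic T
  · rw [indicator_of_mem htT]
    have hV := (h.run k).lintegral_diffQuot_le ht
    have hm : Measurable fun x ↦ (dt k)⁻¹ •
        (approx (dx k) (dt k) (u k) (t + dt k) x - approx (dx k) (dt k) (u k) t x) :=
      (measurable_cellFun.sub measurable_cellFun).const_smul (dt k)⁻¹
    have hi : Integrable fun x ↦ (dt k)⁻¹ •
        (approx (dx k) (dt k) (u k) (t + dt k) x - approx (dx k) (dt k) (u k) t x) :=
      ⟨hm.aestronglyMeasurable, hV.trans_lt ENNReal.coe_lt_top⟩
    exact (norm_integral_smul_le hi (hd.bound t)).trans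
      (mul_le_mul_of_nonneg_left (integral_norm_le_of_lintegral_le hi hV) hd.pos.2.2.1)
  · rw [indicator_of_notMem htT, diffQuotIntegral]
    simp only [hd.zero_of_lt t (not_le.1 htT), zero_smul, integral_zero, norm_zero, le_refl]

/-- By consistency the difference quotient and the nonconservative product of the approximate
solution cancel up to O(Δx); by stability the latter converges as the graphs do. -/
lemma tendsto_diffQuotIntegral (hD : IsRegularData Ω A Φ)
    (hM : IsPathConsistent Ω A Φ p q hp Mm Mp) (hφ : IsTestFunction φ) {t : ℝ} (ht : 0 < t)
    (hs : IsSlice Ω C (v t))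
    (hlim : Tendsto (fun k ↦ graphDist (graphCompletion Φ (approx (dx k) (dt k) (u k) t))
      (graphCompletion Φ (bvVersion (v t)))) atTop (𝓝 0)) :
    Tendsto (fun k ↦ diffQuotIntegral φ (dx k) (dt k) (u k) t) atTop
      (𝓝 (-pairing (slicedProduct A Φ v t) (φ t))) := by
  obtain ⟨T, R, M, L, hd⟩ := hφ.exists_isTestData
  obtain ⟨c, hc⟩ := hD.bound C
  have h1 : Tendsto (fun k ↦ pairing (nonconsProduct A Φ (approx (dx k) (dt k) (u k) t)) (φ t))
      atTop (𝓝 (pairing (slicedProduct A Φ v t) (φ t))) :=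
    tendsto_pairing_nonconsProduct hD hs.isAdmissible (fun k ↦ (h.run k).isAdmissible t)
      (V := C) (ρ := R + 1)
      (fun k ↦ ENNReal.toReal_le_coe_of_le_coe ((h.run k).variation_le _)) hlim
      (hφ.continuous_right t) (by linarith [hd.pos.2.1]) fun x hx ↦
        hd.zero_of_abs t x (by linarith)
  have h2 : Tendsto (fun k ↦ diffQuotIntegral φ (dx k) (dt k) (u k) t +
      pairing (nonconsProduct A Φ (approx (dx k) (dt k) (u k) t)) (φ t)) atTop (𝓝 0) := by
    refine squeeze_zero_norm (fun k ↦ (h.run k).norm_integral_add_pairing_le hD hc hp (hM.jump k)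
      ht.le (hφ.continuous_right t).measurable (hd.bound t) (hd.lipschitz_space t) hd.pos.2.2.2
      (hd.zero_of_abs t)) ?_
    have := (h.tendsto_dx.const_mul L).mul_const (2 * V + c * C : ℝ)
    rwa [mul_zero, zero_mul] at this
  simpa using h2.sub h1

/-- If the graph completions converge, then the limit satisfies the equation without source. -/
theorem weak_equation (hD : IsRegularData Ω A Φ) (hM : IsPathConsistent Ω A Φ p q hp Mm Mp)
    (hlim : ∀ᵐ t ∂(volume.restrict (Ioi (0 : ℝ))), Tendsto (fun k ↦ graphDist
      (graphCompletion Φ (approx (dx k) (dt k) (u k) t)) (graphCompletion Φ (bvVersion (v t))))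
      atTop (𝓝 0)) (hφ : IsTestFunction φ) :
    -(∫ t in Ioi (0 : ℝ), ∫ x, deriv (fun r ↦ φ r x) t • v t x)
      + ∫ t in Ioi (0 : ℝ), pairing (slicedProduct A Φ v t) (φ t) = 0 := by
  obtain ⟨T, R, M, L, hd⟩ := hφ.exists_isTestData
  -- The same sequence is evaluated in two ways: as a distributional time derivative here, and slice
  -- by slice with dominated convergence below.
  have h1 : Tendsto (fun k ↦ ∫ t in Ioi (0 : ℝ), diffQuotIntegral φ (dx k) (dt k) (u k) t) atTop
      (𝓝 (-∫ t in Ioi (0 : ℝ), ∫ x, deriv (fun r ↦ φ r x) t • v t x)) :=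
    tendsto_integral_diffQuot (f := fun k z ↦ approx (dx k) (dt k) (u k) z.1 z.2)
      (v := fun z ↦ v z.1 z.2) (C := C) (fun k ↦ (h.run k).dt_pos) h.tendsto_dt
      (fun k ↦ (measurable_approx _ _ _).aestronglyMeasurable)
      (fun k ↦ Eventually.of_forall fun z ↦ (h.run k).norm_le _ _) h.tendsto_ae hφ
  have h2 : Tendsto (fun k ↦ ∫ t in Ioi (0 : ℝ), diffQuotIntegral φ (dx k) (dt k) (u k) t) atTop
      (𝓝 (∫ t in Ioi (0 : ℝ), -pairing (slicedProduct A Φ v t) (φ t))) := by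
    refine tendsto_integral_of_dominated_convergence ((Iic T).indicator fun _ ↦ M * V)
      (fun k ↦ aestronglyMeasurable_diffQuotIntegral hφ _ _ _ _) ?_ (fun k ↦ ?_) ?_
    · rw [integrable_indicator_iff measurableSet_Iic, IntegrableOn,
        Measure.restrict_restrict measurableSet_Iic, Iic_inter_Ioi]
      exact integrableOn_const (by simp)
    · filter_upwards [ae_restrict_mem measurableSet_Ioi] with t ht
      exact h.norm_diffQuotIntegral_le hd k (le_of_lt ht)
    · filter_upwards [ae_restrict_mem measurableSet_Ioi, h.ae_isSlice, hlim] with t ht hs hl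
      exact h.tendsto_diffQuotIntegral hD hM hφ ht hs hl
  rw [tendsto_nhds_unique h1 h2, integral_neg, neg_add_cancel]

/-- If the graph completions converge, then the limit is a weak solution. -/
theorem isWeakSolution (hD : IsRegularData Ω A Φ) (hM : IsPathConsistent Ω A Φ p q hp Mm Mp)
    (hlim : ∀ᵐ t ∂(volume.restrict (Ioi (0 : ℝ))), Tendsto (fun k ↦ graphDist
      (graphCompletion Φ (approx (dx k) (dt k) (u k) t)) (graphCompletion Φ (bvVersion (v t))))
      atTop (𝓝 0)) : IsWeakSolution A Φ v :=
  h.solvesWithSource hD fun φ hφ ↦ by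
    rw [h.weak_equation hD hM hlim hφ]
    simp [pairing, VectorMeasure.integral_zero_vectorMeasure]

/-- If the graph completions converge, then the convergence error measure vanishes. -/
theorem source_eq_zero (hD : IsRegularData Ω A Φ) (hM : IsPathConsistent Ω A Φ p q hp Mm Mp)
    (hlim : ∀ᵐ t ∂(volume.restrict (Ioi (0 : ℝ))), Tendsto (fun k ↦ graphDist
      (graphCompletion Φ (approx (dx k) (dt k) (u k) t)) (graphCompletion Φ (bvVersion (v t))))
      atTop (𝓝 0)) {m : ℝ → VectorMeasure ℝ (Phase N)} (hm : IsBoundedMeasureFamily m)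
    (hmv : SolvesWithSource A Φ v m) : ∀ᵐ t ∂(volume.restrict (Ioi (0 : ℝ))), m t = 0 :=
  hm.ae_eq_zero fun φ hφ ↦ by
    rw [← hmv.equation φ hφ]
    exact h.weak_equation hD hM hlim hφ

end IsConvergentScheme

end GraphConvergence

end PathConsistent

end

/-! ### The main theorem. -/

theorem mainTheorem1 {N : ℕ}
    (Ω : Set (PathConsistent.Phase N)) (hΩ : IsOpen Ω)
    (A : PathConsistent.Phase N → PathConsistent.Phase N →L[ℝ] PathConsistent.Phase N)
    (hA : ContDiffOn ℝ ∞ A Ω)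
    (Φ : ℝ → PathConsistent.Phase N → PathConsistent.Phase N → PathConsistent.Phase N)
    (hΦ : PathConsistent.IsDLMFamily Ω Φ)
    -- the scheme
    (p q : ℕ) (hp : 1 ≤ p)
    (Mm Mp : ℕ → (Fin (p + q + 1) → PathConsistent.Phase N) → PathConsistent.Phase N)
    (hM : PathConsistent.IsPathConsistent Ω A Φ p q hp Mm Mp)
    -- the meshes
    (dx dt : ℕ → ℝ) (hdx : ∀ k, 0 < dx k) (hdt : ∀ k, 0 < dt k)
    (hdx0 : Tendsto dx atTop (𝓝 0)) (hdt0 : Tendsto dt atTop (𝓝 0))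
    -- the approximate solutions and their uniform bounds
    (u : ℕ → ℕ → ℤ → PathConsistent.Phase N) (huΩ : ∀ k n i, u k n i ∈ Ω)
    (hu : ∀ k, PathConsistent.IsSchemeSolution p q (Mm k) (Mp k) (dx k) (dt k) (u k))
    (hbound : ∃ C : ℝ≥0, ∀ k, ∀ t ≥ (0 : ℝ),
      (∀ x, ‖PathConsistent.approx (dx k) (dt k) (u k) t x‖ ≤ C) ∧
      eVariationOn (PathConsistent.approx (dx k) (dt k) (u k) t) univ ≤ C)
    -- an almost everywhere convergent subsequence, with a limit taking its values in `Ω`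
    (ψ : ℕ → ℕ) (hψ : StrictMono ψ) (v : ℝ → ℝ → PathConsistent.Phase N)
    (hv : ∀ᵐ z : ℝ × ℝ ∂(volume.restrict (Ioi (0 : ℝ) ×ˢ (univ : Set ℝ))),
      Tendsto (fun k ↦ PathConsistent.approx (dx (ψ k)) (dt (ψ k)) (u (ψ k)) z.1 z.2) atTop
        (𝓝 (v z.1 z.2)))
    (hvΩ : ∀ᵐ t ∂(volume.restrict (Ioi (0 : ℝ))), ∀ x,
      (PathConsistent.bvVersion (v t)).leftLim x ∈ Ω ∧
      (PathConsistent.bvVersion (v t)).rightLim x ∈ Ω) :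
    (∃ m : ℝ → VectorMeasure ℝ (PathConsistent.Phase N),
      PathConsistent.IsBoundedMeasureFamily m ∧ PathConsistent.SolvesWithSource A Φ v m) ∧
    ((∀ᵐ t ∂(volume.restrict (Ioi (0 : ℝ))),
        Tendsto (fun k ↦ PathConsistent.graphDist
          (PathConsistent.graphCompletion Φ
            (PathConsistent.approx (dx (ψ k)) (dt (ψ k)) (u (ψ k)) t))
          (PathConsistent.graphCompletion Φ (PathConsistent.bvVersion (v t))))
          atTop (𝓝 0)) →
      (∀ m : ℝ → VectorMeasure ℝ (PathConsistent.Phase N),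
        PathConsistent.IsBoundedMeasureFamily m → PathConsistent.SolvesWithSource A Φ v m →
        ∀ᵐ t ∂(volume.restrict (Ioi (0 : ℝ))), m t = 0) ∧
      PathConsistent.IsWeakSolution A Φ v) := by
  obtain ⟨C, hC⟩ := hbound
  have hbr : ∀ k, PathConsistent.IsBoundedRun Ω C (dx k) (dt k) (u k) := fun k ↦
    PathConsistent.isBoundedRun_of_approx (hdx k) (hdt k) (huΩ k) (hC k)
  obtain ⟨V, hV⟩ := hM.exists_tsum_le C
  have hD : PathConsistent.IsRegularData Ω A Φ := ⟨hΩ, hA.continuousOn, hΦ,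
    fun R ↦ hM.exists_pathBound hΩ hA.continuousOn hΦ R, hM.continuousOn_pathIntegral⟩
  -- The subsequence is treated as a sequence of its own, with numerical functions also reindexed by
  -- `ψ`. The bounds `C` and `V` persist because they are uniform in the index.
  have h : PathConsistent.IsConvergentScheme Ω p q (Mm ∘ ψ) (Mp ∘ ψ) C V (dx ∘ ψ) (dt ∘ ψ)
      (u ∘ ψ) v :=
    ⟨fun k ↦ ⟨hbr (ψ k), hu (ψ k), hV (ψ k) _ _ _ (hbr (ψ k))⟩, hdx0.comp hψ.tendsto_atTop,
      hdt0.comp hψ.tendsto_atTop, hv, hvΩ⟩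
  have hM' : PathConsistent.IsPathConsistent Ω A Φ p q hp (Mm ∘ ψ) (Mp ∘ ψ) :=
    ⟨fun R ↦ (hM.lipschitz R).imp fun L hL k ↦ hL (ψ k), fun k ↦ hM.consistent (ψ k),
      fun k ↦ hM.jump (ψ k)⟩
  exact ⟨h.exists_solvesWithSource hD, fun hlim ↦
    ⟨fun m hm hmv ↦ h.source_eq_zero hD hM' hlim hm hmv, h.isWeakSolution hD hM' hlim⟩⟩
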